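/- **Setting.** Let $\mathfrak g$ be of type $A_n$ ($n\ge 1$), $D_n$ ($n\ge 4$), $E_6$, $E_7$ or $E_8$, with Cartan matrix $(a_{ij})_{i,j=1}^n$, and let $U_q(\widehat{\mathfrak g})$ be the quantum affine algebra of type $(ADE)^{(1)}$ over $\mathbb F=\mathbb C(q^{1/2})$ in Drinfeld's realization, with generators $x_i^\pm(k)$, $a_i(l)$, $K_i^{\pm1}$, $\gamma^{\pm1/2}$, $q^{\pm d}$ ($1\le i\le n$, $k,l\in\mathbb Z$, $l\ne 0$). Let $L$ be a restricted $U_q(\widehat{\mathfrak g})$-module: for every $v\in L$ and every $i$, $x_i^\pm(k)v=0$ for all sufficiently large $k$. Put $x_i^\pm(z)=\sum_{r\in\mathbb Z}x_i^\pm(r)z^{-r-1}\in\mathcal E(L)=\mathrm{Hom}(L,L((z)))$ and $\mathcal E(L)_t=\mathcal E(L)\otimes\mathbb F[t]$; an element of $\mathcal E(L)\otimes t^\alpha$ is homogeneous of weight $\alpha$. Here $L((z_1,\dots,z_m))=L[[z_1,\dots,z_m]][z_1^{-1},\dots,z_m^{-1}]$. Fix a sign $\pm$ and let $\mathsf q=q^{\pm2}$.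 Let $\mathbb F[z]_0$ be the set of $p\in\mathbb F[z]$ with $p(1)=1$ and $p(\mathsf q^n)\neq0$ for all $n\ge0$. A sequence $(a_1(z)\otimes t^{\alpha_1},\dots,a_m(z)\otimes t^{\alpha_m})$ is *quasi-commutative* if for some $p\in\mathbb F[z]_0$ $$\Big(\prod_{1\le i<j\le m}p(z_j/z_i)\Big)a_1(z_1)a_2(z_2\mathsf q^{\alpha_1})\cdots a_m(z_m\mathsf q^{\alpha_1+\dots+\alpha_{m-1}})\in\mathrm{Hom}(L,L((z_1,\dots,z_m)));$$ a sequence of arbitrary elements of $\mathcal E(L)_t$ is quasi-commutative if every choice of homogeneous components is, and a subset of $\mathcal E(L)_t$ is quasi-commutative if every finite sequence in it is. Let $[m]_{\mathsf q}=(\mathsf q^m-1)/(\mathsf q-1)$, with $[r]_{\mathsf q}!=[r]_{\mathsf q}\cdots[1]_{\mathsf q}$ and ${m\brack l}_{\mathsf q}=[m]_{\mathsf q}\cdots[m-l+1]_{\mathsf q}/[l]_{\mathsf q}!$, and let $a^{[r]}(z)$ be the $r$-th iterate of $a(z)\mapsto (a(z\mathsf q)-a(z))/(z(\mathsf q-1))$.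 For a quasi-commutative pair the products are the bilinear extension of $$(a(z)\otimes t^\alpha)_{-r-1}(b(z)\otimes t^\beta)=\lim_{z_1\to z}\frac{p(z/z_1)}{[r]_{\mathsf q}!}\,a^{[r]}(z_1)\,b(z\mathsf q^{\alpha+r})\otimes t^{\alpha+\beta+r}\qquad(r\ge0),$$ with any $p\in\mathbb F[z]_0$ such that $p(z/z_1)a^{[r]}(z_1)b(z\mathsf q^{\alpha+r})\in\mathrm{Hom}(L,L((z_1,z)))$, and $a_sb=0$ for $s\ge0$. Let $Y(a,z_0)b=\sum_s a_s b\,z_0^{-s-1}$ and $\mathbf 1=1_L\otimes 1$. A *graded nonlocal $\mathsf q$-vertex algebra* $(V,Y,\mathbf 1)$ is a vector space $V=\coprod_{u\in\mathbb Z}V_{(u)}$ with a linear map $Y(\cdot,z_0):V\to(\mathrm{End}\,V)[[z_0^{\pm1}]]$, $Y(a,z_0)=\sum_r a_rz_0^{-r-1}$, and $\mathbf 1\in V$, such that for all $a,b,c\in V$: $a_rb=0$ for $r$ large; $Y(\mathbf 1,z_0)=1_V$; $Y(a,z_0)\mathbf 1\in V[[z_0]]$ has constant term $a$; $a_rV_{(s)}\subseteq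 V_{(s+u-r-1)}$ if $a\in V_{(u)}$; and $Y(a,z_0+z_2)Y(b,z_2\mathsf q^u)c=Y(Y(a,z_0)b,z_2)c$ if $a\in V_{(u)}$, where $z_2z_0=\mathsf qz_0z_2$, the left side is $\sum_{r,s}a_r(b_sc)(z_2\mathsf q^u)^{-s-1}(z_0+z_2)^{-r-1}$ with $(z_0+z_2)^k=\sum_{l\ge0}{k\brack l}_{\mathsf q}z_0^{k-l}z_2^l$, and the right side is $\sum_{r,s}(a_rb)_sc\,z_0^{-r-1}z_2^{-s-1}$. A subspace $V\subseteq\mathcal E(L)_t$ is called a graded nonlocal $\mathsf q$-vertex algebra if every pair in $V$ is quasi-commutative and $V$, with the above $Y$ and $\mathbf 1$ and the gradation by weight, is one. **Theorem.** For every sign $\pm$, with $\mathsf q=q^{\pm2}$, and every $(\alpha_1,\dots,\alpha_n)\in(\mathbb Z_{\ge0})^n$, the set $\mathcal S=\{x_i^\pm(z)\otimes t^{\alpha_i}: i=1,\dots,n\}\subset\mathcal E(L)_t$ is quasi-commutative. There is a unique smallest graded nonlocal $\mathsf q$-vertex algebra $(\langle\mathcal S\rangle,Y,\mathbf 1)$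 in $\mathcal E(L)_t$ that contains $\mathcal S$; it is a quasi-commutative set, and it is spanned by $$\left\{(x_{i_1}^\pm(z)\otimes t^{\alpha_{i_1}})_{r_1}\cdots(x_{i_m}^\pm(z)\otimes t^{\alpha_{i_m}})_{r_m}\mathbf 1:\ 1\le i_j\le n,\ r_j<0,\ j=1,\dots,m,\ m\ge0\right\}.$$ In particular (upper sign, all $\alpha_i=0$) this holds for $\{x_i^+(z)\otimes1\}$ with $\mathsf q=q^2$, and (lower sign, all $\alpha_i=0$) for $\{x_i^-(z)\otimes1\}$ with $\mathsf q=q^{-2}$. -/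

import Mathlib

noncomputable section

open scoped BigOperators

namespace QVA

/-! ## Formal distributions with operator coefficients -/

section Distributions

variable (F : Type*) [Field F] (L : Type*) [AddCommGroup L] [Module F L]

/-- `(End L)[[z_1^{±1}, …, z_m^{±1}]]`: the value at `n` is the coefficient of
`z_1^{n_1} ⋯ z_m^{n_m}`. -/
abbrev Distribution (m : ℕ) : Type _ := (Fin m → ℤ) → Module.End F L

variable {F L}

/-- Membership in `Hom(L, L((z_1, …, z_m)))`, where
`L((z_1, …, z_m)) = L[[z_1, …, z_m]][z_1⁻¹, …, z_m⁻¹]`. -/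
def IsLaurent {m : ℕ} (A : Distribution F L m) : Prop :=
  ∀ v : L, ∃ N : ℤ, ∀ n : Fin m → ℤ, (∃ i, n i < N) → A n v = 0

variable (F L)

/-- `Hom(L, L((z)))` inside `(End L)[[z^{±1}]]`: the value at `n` is the coefficient of `z^n`. -/
def opSeriesSubmodule : Submodule F (ℤ → Module.End F L) where
  carrier := {a | ∀ v : L, ∃ N : ℤ, ∀ n : ℤ, n < N → a n v = 0}
  zero_mem' := fun _ => ⟨0, fun _ _ => rfl⟩
  add_mem' := by
    intro a b ha hb v
    obtain ⟨N, hN⟩ := ha v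
    obtain ⟨M, hM⟩ := hb v
    refine ⟨min N M, fun n hn => ?_⟩
    have h1 : a n v = 0 := hN n (lt_of_lt_of_le hn (min_le_left _ _))
    have h2 : b n v = 0 := hM n (lt_of_lt_of_le hn (min_le_right _ _))
    simp [h1, h2]
  smul_mem' := by
    intro c a ha v
    obtain ⟨N, hN⟩ := ha v
    refine ⟨N, fun n hn => ?_⟩
    simp [hN n hn]

/-- The space `ℰ(L) = Hom(L, L((z)))`. -/
def OpSeries : Type _ := opSeriesSubmodule F L

instance : AddCommGroup (OpSeries F L) := inferInstanceAs (AddCommGroup (opSeriesSubmodule F L))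

instance : Module F (OpSeries F L) := inferInstanceAs (Module F (opSeriesSubmodule F L))

/-- `ℰ(L)_t = ℰ(L) ⊗ F[t]`, as finitely supported families: the value at `α` is the coefficient
of `t^α`, so `a(z) ⊗ t^α` is `Finsupp.single α a`. -/
abbrev OpSeriesT : Type _ := ℕ →₀ OpSeries F L

variable {F L}

theorem finite_antidiagonal_support {A : Distribution F L 2} (hA : IsLaurent A) (n : ℤ) (v : L) :
    (Function.support fun i : ℤ => A ![i, n - i] v).Finite := by
  obtain ⟨N, hN⟩ := hA v
  refine (Set.finite_Icc N (n - N)).subset fun i hi => ?_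
  by_contra hcon
  apply hi
  apply hN
  rw [Set.mem_Icc, not_and_or] at hcon
  rcases hcon with h | h
  · exact ⟨0, by simpa using h⟩
  · refine ⟨1, ?_⟩
    have : n - i < N := by omega
    simpa using this

/-- `lim_{z₁ → z} A(z₁, z)` for `A ∈ Hom(L, L((z₁, z)))`; the coefficient of `z^n` is
`∑_i A_{i, n-i}`, a finite sum on every vector. -/
def limDiag (A : Distribution F L 2) (hA : IsLaurent A) : OpSeries F L where
  val := fun n =>
    { toFun := fun v => ∑ᶠ i : ℤ, A ![i, n - i] v
      map_add' := by
        intro v w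
        simp only [map_add]
        exact finsum_add_distrib (finite_antidiagonal_support hA n v)
          (finite_antidiagonal_support hA n w)
      map_smul' := by
        intro c v
        simp only [map_smul, RingHom.id_apply]
        exact (smul_finsum' c (finite_antidiagonal_support hA n v)).symm }
  property := by
    intro v
    obtain ⟨N, hN⟩ := hA v
    refine ⟨2 * N, fun n hn => ?_⟩
    change ∑ᶠ i : ℤ, A ![i, n - i] v = 0
    refine finsum_eq_zero_of_forall_eq_zero fun i => hN _ ?_
    by_cases h : i < N
    · exact ⟨0, by simpa using h⟩
    · refine ⟨1, ?_⟩
      have : n - i < N := by omega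
      simpa using this

/-- `a(z) ↦ a(cz)`. -/
def rescale (c : F) (a : ℤ → Module.End F L) : ℤ → Module.End F L := fun n => c ^ n • a n

/-- The `q`-derivation `a(z) ↦ (a(zq) - a(z)) / (z(q - 1))`. -/
def qDeriv (q : F) (a : ℤ → Module.End F L) : ℤ → Module.End F L :=
  fun n => (q - 1)⁻¹ • (rescale q a (n + 1) - a (n + 1))

/-- The product `a_1(z_1) a_2(z_2) ⋯ a_m(z_m)` (composition of operators, in this order). -/
def mulDist {m : ℕ} (a : Fin m → ℤ → Module.End F L) : Distribution F L m :=
  fun n => (List.ofFn fun k => a k (n k)).prod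

variable (F) in
/-- The Laurent polynomial `p(z_j / z_i)` in `F[z_1^{±1}, …, z_m^{±1}]`; the monomial `z^d` is
`AddMonoidAlgebra.single d 1`. -/
def ratioPoly {m : ℕ} (p : Polynomial F) (i j : Fin m) : AddMonoidAlgebra F (Fin m → ℤ) :=
  Polynomial.aeval
    (AddMonoidAlgebra.single (Pi.single j (1 : ℤ) - Pi.single i (1 : ℤ) : Fin m → ℤ) (1 : F)) p

/-- The product of a Laurent polynomial and a formal distribution. -/
def laurentMul {m : ℕ} (P : AddMonoidAlgebra F (Fin m → ℤ)) (A : Distribution F L m) :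
    Distribution F L m :=
  fun n => P.coeff.sum fun d c => c • A (n - d)

/-! ## Quantum calculus -/

/-- `[m]_q = (q^m - 1) / (q - 1)`. -/
def qInt (q : F) (m : ℤ) : F := (q ^ m - 1) / (q - 1)

/-- `[l]_q!`. -/
def qFactorial (q : F) (l : ℕ) : F := ∏ k ∈ Finset.range l, qInt q (k + 1)

/-- The `q`-binomial coefficient `[m]_q [m-1]_q ⋯ [m-l+1]_q / [l]_q!`, for `m ∈ ℤ`. -/
def qBinom (q : F) (m : ℤ) (l : ℕ) : F :=
  (∏ k ∈ Finset.range l, qInt q (m - k)) / qFactorial q l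

/-- The set `F[z]_0` of polynomials with `p(1) = 1` and `p(q^n) ≠ 0` for all `n ≥ 0`. -/
def IsAdmissible (q : F) (p : Polynomial F) : Prop :=
  p.eval 1 = 1 ∧ ∀ n : ℕ, p.eval (q ^ n) ≠ 0

/-! ## Quasi-commutativity and the `r`-th products -/

/-- Quasi-commutativity of `(a_1(z) ⊗ t^{α_1}, …, a_m(z) ⊗ t^{α_m})`: some `p` in `F[z]_0` satisfies
`(∏_{i<j} p(z_j/z_i)) a_1(z_1) a_2(z_2 q^{α_1}) ⋯ a_m(z_m q^{α_1+⋯+α_{m-1}})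
  ∈ Hom(L, L((z_1, …, z_m)))`. -/
def IsQuasiCommHom (q : F) {m : ℕ} (a : Fin m → OpSeries F L) (α : Fin m → ℕ) : Prop :=
  ∃ p : Polynomial F, IsAdmissible q p ∧
    IsLaurent (laurentMul
      (∏ ij : Fin m × Fin m with ij.1 < ij.2, ratioPoly F p ij.1 ij.2)
      (mulDist fun k => rescale (q ^ (∑ i : Fin m with i < k, α i)) (a k).1))

/-- Quasi-commutativity of a finite sequence in `ℰ(L)_t`: every choice of homogeneous components
is quasi-commutative (choices involving a zero component impose no condition). -/
def IsQuasiComm (q : F) {m : ℕ} (a : Fin m → OpSeriesT F L) : Prop :=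
  ∀ α : Fin m → ℕ, IsQuasiCommHom q (fun k => a k (α k)) α

/-- A set is quasi-commutative if every finite sequence in it is. -/
def IsQuasiCommSet (q : F) (S : Set (OpSeriesT F L)) : Prop :=
  ∀ (m : ℕ) (a : Fin m → OpSeriesT F L), (∀ k, a k ∈ S) → IsQuasiComm q a

/-- `p(z/z₁) a^{[r]}(z₁) b(z q^{α+r})`, in the variables `(z₁, z)`. -/
def productDist (q : F) (r α : ℕ) (p : Polynomial F) (a b : OpSeries F L) : Distribution F L 2 :=
  laurentMul (ratioPoly F p 0 1)
    (mulDist ![(qDeriv q)^[r] a.1, rescale (q ^ (α + r)) b.1])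

open Classical in
/-- The first tensor factor of `(a(z) ⊗ t^α)_{-r-1} (b(z) ⊗ t^β)` for `r ≥ 0`:
`lim_{z₁ → z} (p(z/z₁) / [r]_q!) a^{[r]}(z₁) b(z q^{α+r})`, for any `p` in `F[z]_0` for which the
limit makes sense (and `0` if there is none, which does not occur for quasi-commutative pairs). -/
def homProduct (q : F) (r α : ℕ) (a b : OpSeries F L) : OpSeries F L :=
  if h : ∃ p : Polynomial F, IsAdmissible q p ∧ IsLaurent (productDist q r α p a b) then
    (qFactorial q r)⁻¹ • limDiag (productDist q r α h.choose a b) h.choose_spec.2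
  else 0

/-- The product `a(z,t)_s b(z,t)`, `s ∈ ℤ`. It is `0` for `s ≥ 0`; for `s = -r-1`, `r ≥ 0`, it is
the sum over homogeneous components of `(a_α(z) ⊗ t^α)_{-r-1} (b_β(z) ⊗ t^β)`, an element of
`ℰ(L) ⊗ t^{α+β+r}`. -/
def product (q : F) (s : ℤ) (a b : OpSeriesT F L) : OpSeriesT F L :=
  if s < 0 then
    a.sum fun α a' => b.sum fun β b' =>
      Finsupp.single (α + β + (-s - 1).toNat) (homProduct q (-s - 1).toNat α a' b')
  else 0

variable (F L) in
/-- The identity operator, as a constant series in `ℰ(L)`. -/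
def oneField : OpSeries F L where
  val := fun n => if n = 0 then 1 else 0
  property := fun _ => ⟨0, fun n hn => by simp [hn.ne]⟩

variable (F L) in
/-- The vacuum vector `1_L ⊗ 1`. -/
def vacuum : OpSeriesT F L := Finsupp.single 0 (oneField F L)

/-- `a(z,t)` is homogeneous of weight `u`, i.e. lies in `ℰ(L) ⊗ t^u` (so is zero if `u < 0`). -/
def HasWeight (u : ℤ) (a : OpSeriesT F L) : Prop := ∀ α : ℕ, (α : ℤ) ≠ u → a α = 0

end Distributions

/-! ## Graded nonlocal `q`-vertex algebras -/

section Abstract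

variable {F : Type*} [Field F] {V : Type*} [AddCommGroup V] [Module F V]

/-- The coefficient of `z₀^i z₂^j` (with `z₀` to the left of `z₂`) in
`Y(a, z₀ + z₂) Y(b, z₂ q^u) c = ∑_{r,s} a_r (b_s c) (z₂ q^u)^{-s-1} (z₀ + z₂)^{-r-1}`,
where `z₂ z₀ = q z₀ z₂` and `(z₀ + z₂)^k = ∑_{l ≥ 0} [k choose l]_q z₀^{k-l} z₂^l`.
As `z₂^x z₀^y = q^{xy} z₀^y z₂^x`, the contributions come from `r = -i-l-1` and `s = l-j-1`. -/
def assocLeft (q : F) (Y : V →ₗ[F] (ℤ → Module.End F V)) (u : ℤ) (a b c : V) (i j : ℤ) : V :=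
  ∑ᶠ l : ℕ, ((q ^ u) ^ (j - l) * qBinom q (i + l) l * q ^ ((j - l) * i)) •
    Y a (-i - l - 1) (Y b (l - j - 1) c)

/-- The coefficient of `z₀^i z₂^j` in
`Y(Y(a, z₀)b, z₂)c = ∑_{r,s} (a_r b)_s c z₀^{-r-1} z₂^{-s-1}`. -/
def assocRight (Y : V →ₗ[F] (ℤ → Module.End F V)) (a b c : V) (i j : ℤ) : V :=
  Y (Y a (-i - 1) b) (-j - 1) c

variable (F V) in
/-- A graded nonlocal `q`-vertex algebra structure on `V`; `Y a r` is the operator `a_r` in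
`Y(a, z₀) = ∑_r a_r z₀^{-r-1}`. -/
structure GradedNonlocalVA (q : F) where
  grading : ℤ → Submodule F V
  grading_internal : DirectSum.IsInternal grading
  Y : V →ₗ[F] (ℤ → Module.End F V)
  one : V
  truncation : ∀ a b : V, ∃ N : ℤ, ∀ r : ℤ, N ≤ r → Y a r b = 0
  vacuum_left : ∀ (r : ℤ) (b : V), Y one r b = if r = -1 then b else 0
  creation : ∀ a : V, (∀ r : ℤ, 0 ≤ r → Y a r one = 0) ∧ Y a (-1) one = a
  grading_mul : ∀ (u s r : ℤ) (a b : V), a ∈ grading u → b ∈ grading s →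
    Y a r b ∈ grading (s + u - r - 1)
  assoc : ∀ (u : ℤ) (a b c : V), a ∈ grading u → ∀ i j : ℤ,
    assocLeft q Y u a b c i j = assocRight Y a b c i j

end Abstract

section Concrete

variable {F : Type*} [Field F] {L : Type*} [AddCommGroup L] [Module F L]

/-- A subspace `V` of `ℰ(L)_t` is a graded nonlocal `q`-vertex algebra `(V, Y, 1)`, with the
vertex operator map `Y` given by the products `a(z,t)_s b(z,t)` (in particular, the products are
meaningful on `V`, and stay in `V`), the vacuum `1_L ⊗ 1`, and the gradation by weight. -/
def IsGradedNonlocalVA (q : F) (V : Submodule F (OpSeriesT F L)) : Prop :=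
  (∀ a ∈ V, ∀ b ∈ V, IsQuasiComm q ![a, b]) ∧
  ∃ W : GradedNonlocalVA F V q,
    (∀ (a b : V) (s : ℤ), (W.Y a s b : OpSeriesT F L) = product q s (a : OpSeriesT F L) b) ∧
    (W.one : OpSeriesT F L) = vacuum F L ∧
    ∀ (u : ℤ) (a : V), a ∈ W.grading u ↔ HasWeight u (a : OpSeriesT F L)

/-- The set of all monomials `a_1(z,t)_{r_1} ⋯ a_m(z,t)_{r_m} 1` with `a_j(z,t) ∈ S`, `r_j < 0`,
`m ≥ 0`. -/
def monomials (q : F) (S : Set (OpSeriesT F L)) : Set (OpSeriesT F L) :=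
  {w | ∃ l : List (OpSeriesT F L × ℤ), (∀ x ∈ l, x.1 ∈ S ∧ x.2 < 0) ∧
    w = l.foldr (fun x b => product q x.2 x.1 b) (vacuum F L)}

end Concrete

/-! ## Quantum affine algebras in the Drinfeld realization -/

/-- The field `ℂ(q^{1/2})`; the variable of `RatFunc` is `q^{1/2}`. -/
abbrev Kq : Type := RatFunc ℂ

/-- The indeterminate `q`. -/
def qq : Kq := RatFunc.X ^ 2

/-- `[m] = (q^m - q^{-m}) / (q - q^{-1})`. -/
def symInt (m : ℤ) : Kq := (qq ^ m - qq ^ (-m)) / (qq - qq⁻¹)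

/-- The binomial coefficient `[m][m-1]⋯[m-l+1] / [l]!`. -/
def symBinom (m : ℤ) (l : ℕ) : Kq :=
  (∏ k ∈ Finset.range l, symInt (m - k)) / ∏ k ∈ Finset.range l, symInt (k + 1)

/-- The generators; the sign is `ε = ±1`: `x ε i k` is `x_i^ε(k)`, `a i l _` is `a_i(l)` (`l ≠ 0`),
`K i` and `Kinv i` are `K_i^{±1}`, `γh` and `γhInv` are `γ^{±1/2}`, `qd` and `qdInv` are
`q^{±d}`. -/
inductive Gen (n : ℕ) : Type
  | x (ε : ℤˣ) (i : Fin n) (k : ℤ)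
  | a (i : Fin n) (l : ℤ) (hl : l ≠ 0)
  | K (i : Fin n)
  | Kinv (i : Fin n)
  | γh
  | γhInv
  | qd
  | qdInv

namespace Free

variable {n : ℕ}

/-- The generators in the free algebra. -/
abbrev g (y : Gen n) : FreeAlgebra Kq (Gen n) := FreeAlgebra.ι Kq y

/-- `γ^{m/2}`, `m ∈ ℤ`. -/
def γpow (m : ℤ) : FreeAlgebra Kq (Gen n) :=
  if 0 ≤ m then g Gen.γh ^ m.toNat else g Gen.γhInv ^ (-m).toNat

/-- The coefficient of `z^r` in `exp(f(z))`, for `f` with zero constant term. -/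
def expCoeff (f : PowerSeries (FreeAlgebra Kq (Gen n))) (r : ℕ) : FreeAlgebra Kq (Gen n) :=
  ∑ k ∈ Finset.range (r + 1), ((k.factorial : Kq)⁻¹) • PowerSeries.coeff r (f ^ k)

/-- `∑_{r ≥ 1} a_i(r) w^r`. -/
def aPos (i : Fin n) : PowerSeries (FreeAlgebra Kq (Gen n)) :=
  PowerSeries.mk fun r => if h : r = 0 then 0 else g (Gen.a i (r : ℤ) (by exact_mod_cast h))

/-- `∑_{r ≥ 1} a_i(-r) w^r`. -/
def aNeg (i : Fin n) : PowerSeries (FreeAlgebra Kq (Gen n)) :=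
  PowerSeries.mk fun r => if h : r = 0 then 0 else
    g (Gen.a i (-(r : ℤ)) (by simpa using h))

/-- `ψ_i(m)`: zero for `m < 0`, and
`∑_{r ≥ 0} ψ_i(r) w^r = K_i exp((q - q⁻¹) ∑_{r ≥ 1} a_i(r) w^r)`. -/
def ψ (i : Fin n) (m : ℤ) : FreeAlgebra Kq (Gen n) :=
  if 0 ≤ m then g (Gen.K i) * expCoeff ((qq - qq⁻¹) • aPos i) m.toNat else 0

/-- `φ_i(m)`: zero for `m > 0`, and
`∑_{r ≥ 0} φ_i(-r) w^r = K_i⁻¹ exp(-(q - q⁻¹) ∑_{r ≥ 1} a_i(-r) w^r)`. -/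
def φ (i : Fin n) (m : ℤ) : FreeAlgebra Kq (Gen n) :=
  if m ≤ 0 then g (Gen.Kinv i) * expCoeff ((-(qq - qq⁻¹)) • aNeg i) (-m).toNat else 0

end Free

open Free in
/-- The defining relations for a simply laced Cartan matrix `A` (so that `(α_i, α_j) = a_{ij}` and
`q_i = q`). -/
inductive DrinfeldRel {n : ℕ} (A : Matrix (Fin n) (Fin n) ℤ) :
    FreeAlgebra Kq (Gen n) → FreeAlgebra Kq (Gen n) → Prop
  | γ_inv : DrinfeldRel A (g Gen.γh * g Gen.γhInv) 1
  | γ_inv' : DrinfeldRel A (g Gen.γhInv * g Gen.γh) 1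
  | qd_inv : DrinfeldRel A (g Gen.qd * g Gen.qdInv) 1
  | qd_inv' : DrinfeldRel A (g Gen.qdInv * g Gen.qd) 1
  | γ_central (y : Gen n) : DrinfeldRel A (g Gen.γh * g y) (g y * g Gen.γh)
  | γInv_central (y : Gen n) : DrinfeldRel A (g Gen.γhInv * g y) (g y * g Gen.γhInv)
  | K_comm (i j : Fin n) : DrinfeldRel A (g (Gen.K i) * g (Gen.K j)) (g (Gen.K j) * g (Gen.K i))
  | K_inv (i : Fin n) : DrinfeldRel A (g (Gen.K i) * g (Gen.Kinv i)) 1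
  | K_inv' (i : Fin n) : DrinfeldRel A (g (Gen.Kinv i) * g (Gen.K i)) 1
  | a_a (i j : Fin n) (k l : ℤ) (hk : k ≠ 0) (hl : l ≠ 0) :
      DrinfeldRel A
        (g (Gen.a i k hk) * g (Gen.a j l hl) - g (Gen.a j l hl) * g (Gen.a i k hk))
        (if k + l = 0 then
          (symInt (A i j * k) / (k : Kq) / (qq - qq⁻¹)) • (γpow (2 * k) - γpow (-2 * k))
        else 0)
  | a_K (i j : Fin n) (k : ℤ) (hk : k ≠ 0) :
      DrinfeldRel A (g (Gen.a i k hk) * g (Gen.K j)) (g (Gen.K j) * g (Gen.a i k hk))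
  | a_Kinv (i j : Fin n) (k : ℤ) (hk : k ≠ 0) :
      DrinfeldRel A (g (Gen.a i k hk) * g (Gen.Kinv j)) (g (Gen.Kinv j) * g (Gen.a i k hk))
  | qd_K (j : Fin n) : DrinfeldRel A (g Gen.qd * g (Gen.K j)) (g (Gen.K j) * g Gen.qd)
  | qd_Kinv (j : Fin n) : DrinfeldRel A (g Gen.qd * g (Gen.Kinv j)) (g (Gen.Kinv j) * g Gen.qd)
  | qdInv_K (j : Fin n) : DrinfeldRel A (g Gen.qdInv * g (Gen.K j)) (g (Gen.K j) * g Gen.qdInv)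
  | qdInv_Kinv (j : Fin n) :
      DrinfeldRel A (g Gen.qdInv * g (Gen.Kinv j)) (g (Gen.Kinv j) * g Gen.qdInv)
  | qd_x (ε : ℤˣ) (i : Fin n) (k : ℤ) :
      DrinfeldRel A (g Gen.qd * g (Gen.x ε i k) * g Gen.qdInv) ((qq ^ k) • g (Gen.x ε i k))
  | qd_a (i : Fin n) (l : ℤ) (hl : l ≠ 0) :
      DrinfeldRel A (g Gen.qd * g (Gen.a i l hl) * g Gen.qdInv) ((qq ^ l) • g (Gen.a i l hl))
  | K_x (ε : ℤˣ) (i j : Fin n) (k : ℤ) :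
      DrinfeldRel A (g (Gen.K i) * g (Gen.x ε j k) * g (Gen.Kinv i))
        ((qq ^ ((ε : ℤ) * A i j)) • g (Gen.x ε j k))
  | a_x (ε : ℤˣ) (i j : Fin n) (k l : ℤ) (hk : k ≠ 0) :
      DrinfeldRel A
        (g (Gen.a i k hk) * g (Gen.x ε j l) - g (Gen.x ε j l) * g (Gen.a i k hk))
        ((((ε : ℤ) : Kq) * symInt (A i j * k) / (k : Kq)) •
          (γpow (-(ε : ℤ) * |k|) * g (Gen.x ε j (k + l))))
  | x_x (ε : ℤˣ) (i j : Fin n) (k l : ℤ) :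
      DrinfeldRel A
        (g (Gen.x ε i (k + 1)) * g (Gen.x ε j l)
          - (qq ^ ((ε : ℤ) * A i j)) • (g (Gen.x ε j l) * g (Gen.x ε i (k + 1))))
        ((qq ^ ((ε : ℤ) * A i j)) • (g (Gen.x ε i k) * g (Gen.x ε j (l + 1)))
          - g (Gen.x ε j (l + 1)) * g (Gen.x ε i k))
  | xp_xm (i j : Fin n) (k l : ℤ) :
      DrinfeldRel A
        (g (Gen.x 1 i k) * g (Gen.x (-1) j l) - g (Gen.x (-1) j l) * g (Gen.x 1 i k))
        (if i = j then
          ((qq - qq⁻¹)⁻¹) • (γpow (k - l) * ψ i (k + l) - γpow (l - k) * φ i (k + l))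
        else 0)
  | serre (ε : ℤˣ) (i j : Fin n) (hij : i ≠ j) (k : ℤ) (l : Fin (1 - A i j).toNat → ℤ) :
      DrinfeldRel A
        (∑ σ : Equiv.Perm (Fin (1 - A i j).toNat), ∑ s ∈ Finset.range ((1 - A i j).toNat + 1),
          ((-1 : Kq) ^ s * symBinom (1 - A i j) s) •
            (((List.ofFn fun r => g (Gen.x ε i (l (σ r)))).take s).prod * g (Gen.x ε j k) *
              ((List.ofFn fun r => g (Gen.x ε i (l (σ r)))).drop s).prod))
        0

/-- The types `A_n` (`n ≥ 1`), `D_n` (`n ≥ 4`), `E_6`, `E_7`, `E_8` of the finite-dimensional simple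
Lie algebra `𝔤`, i.e. the types `(ADE)^{(1)}` of `ĝ`. -/
inductive ADEType : Type
  | A (n : ℕ) (hn : 1 ≤ n)
  | D (n : ℕ) (hn : 4 ≤ n)
  | E6
  | E7
  | E8

namespace ADEType

/-- The rank `n` of `𝔤`. -/
def rank : ADEType → ℕ
  | A n _ => n
  | D n _ => n
  | E6 => 6
  | E7 => 7
  | E8 => 8

/-- The Cartan matrix `(a_{ij})_{i,j=1}^n` of `𝔤`; only this part of the affine Cartan matrix enters
the Drinfeld realization. -/
def cartan : (X : ADEType) → Matrix (Fin X.rank) (Fin X.rank) ℤ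
  | A n _ => CartanMatrix.A n
  | D n _ => CartanMatrix.D n
  | E6 => CartanMatrix.E₆
  | E7 => CartanMatrix.E₇
  | E8 => CartanMatrix.E₈

end ADEType

/-- The quantum affine algebra `U_q(ĝ)` over `ℂ(q^{1/2})`, in the Drinfeld realization. -/
abbrev Uq (X : ADEType) : Type := RingQuot (DrinfeldRel X.cartan)

/-- The element `x_i^ε(k)` of `U_q(ĝ)`. -/
def Uq.x {X : ADEType} (ε : ℤˣ) (i : Fin X.rank) (k : ℤ) : Uq X :=
  RingQuot.mkAlgHom Kq (DrinfeldRel X.cartan) (FreeAlgebra.ι Kq (Gen.x ε i k))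

section Currents

variable {X : ADEType} {L : Type*} [AddCommGroup L] [Module Kq L] [Module (Uq X) L]

variable (X L) in
/-- A module is restricted if for every vector `v`, `x_i^±(k) v = 0` for all sufficiently large
`k`. -/
def IsRestricted : Prop :=
  ∀ (v : L) (ε : ℤˣ) (i : Fin X.rank), ∃ N : ℤ, ∀ k : ℤ, N ≤ k → (Uq.x ε i k : Uq X) • v = 0

variable [IsScalarTower Kq (Uq X) L]

/-- The current `x_i^ε(z) = ∑_r x_i^ε(r) z^{-r-1}` in `ℰ(L)`, for a restricted module `L`. -/
def current (hL : IsRestricted X L) (ε : ℤˣ) (i : Fin X.rank) : OpSeries Kq L where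
  val := fun n => Algebra.lsmul Kq Kq L (Uq.x ε i (-n - 1) : Uq X)
  property := by
    intro v
    obtain ⟨N, hN⟩ := hL v ε i
    refine ⟨-N, fun n hn => ?_⟩
    rw [Algebra.lsmul_coe]
    exact hN _ (by omega)

/-- The set `{x_i^ε(z) ⊗ t^{α_i} : i = 1, …, n}`. -/
def currents (hL : IsRestricted X L) (ε : ℤˣ) (α : Fin X.rank → ℕ) : Set (OpSeriesT Kq L) :=
  Set.range fun i => Finsupp.single (α i) (current hL ε i)

end Currents

end QVA

end

/-!
The currents `x_i^±(z)` of one sign satisfy exchange relations `(1 - c z_j/z_i) x_i(z_i) x_j(z_j) =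
(d - e z_j/z_i) x_j(z_j) x_i(z_i)`: for `a_{ij} ≠ 0` this is the quadratic Drinfeld relation, and
for `a_{ij} = 0` the Serre relation says that the currents commute. Since `a_{ij} ∈ {2, -1, 0}`, the
prefactor does not vanish at the nonnegative powers of `q^{±2}`, even after the scalings required by
the weights (`exists_exchange_current`). In a product of currents, each factor can thus be moved to
the right end at the cost of polynomial prefactors, and the rightmost field has only finitely many
negative powers; so the product becomes a Laurent series in every variable after multiplication by
admissible factors `p(z_j/z_i)` (`regular_of_exchange`). This is the quasi-commutativity of the
generators, and the only place where the quantum affine algebra enters.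

The rest holds for any set of weighted fields all of whose finite sequences are quasi-commutative.
A distribution `X` for which `P X` is a Laurent series, for a product `P` of factors `p(z_j/z_i)`,
has a well-defined value on the diagonal: the `f` with `P(1, …, 1) f = (P X)(z, …, z)`
(`HasDiagonal`). The value does not depend on `P`, because identifying all variables turns `P` into
a nonzero constant, and it can be computed by identifying the variables in steps
(`HasDiagonal.of_push`). The product without derivatives, `a_{-1} b`, is the diagonal value of
`a(z_1) b(q^α z)`; as `(q-1)^r z^r a^{[r]}(z)` is a combination of `a(z), …, a(q^r z)`, every product
`a_{-r-1} b` is a combination of rescaled products without derivatives (`homProduct_eq_sum`).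
Replacing two adjacent fields by such a product is the identification of two adjacent variables, so
it preserves quasi-commutativity (`QuasiCommList.merge`), and both sides of the associativity
relation become combinations of diagonal values of `a(q^{k₁} z) b(q^{k₂} z) c(q^{k₃} z)`. The
coefficients agree by the `q`-Leibniz rule (`aeval_mul_diffPoly`), which gives `homProduct_assoc`.

Hence the space spanned by iterated products of generators with the vacuum is quasi-commutative
(`quasiCommList_of_generated`), and by associativity it is closed under all products
(`Generated.homProduct`). It is a graded nonlocal vertex algebra, and it is contained in every other
one containing the generators, because such an algebra contains the monomials
(`isLeast_generatedSpace`).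
-/

noncomputable section

open scoped BigOperators

namespace QVA

/-! ### Formal distributions and Laurent polynomials -/

section Convolution

variable {F : Type*} [Field F] {G H K : Type*} [AddCommGroup G] [AddCommGroup H] [AddCommGroup K]
  {M N : Type*} [AddCommGroup M] [Module F M] [AddCommGroup N] [Module F N]

/-- The product of a Laurent polynomial `P`, with exponents in `G`, and a formal distribution `X`
with coefficients in `M`. -/
def convMul (P : AddMonoidAlgebra F G) (X : G → M) : G → M :=
  fun n => P.coeff.sum fun d c => c • X (n - d)

variable (F G M) in
/-- Multiplication of formal distributions by monomials. -/
def translation : Multiplicative G →* Module.End F (G → M) where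
  toFun d :=
    { toFun := fun X n => X (n - d.toAdd)
      map_add' := fun _ _ => rfl
      map_smul' := fun _ _ => rfl }
  map_one' := by ext X n; simp
  map_mul' d e := by
    refine LinearMap.ext fun X => funext fun n => ?_
    simp [sub_sub]

/-- `convMul` is the module structure over the Laurent polynomials extending `translation`. -/
theorem convMul_eq_lift (P : AddMonoidAlgebra F G) (X : G → M) :
    convMul P X = AddMonoidAlgebra.lift F _ G (translation F G M) P X := by
  funext n
  rw [AddMonoidAlgebra.lift_apply]
  simp only [convMul, Finsupp.sum, LinearMap.sum_apply, Finset.sum_apply]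
  rfl

theorem convMul_mul (P Q : AddMonoidAlgebra F G) (X : G → M) :
    convMul (P * Q) X = convMul P (convMul Q X) := by
  simp [convMul_eq_lift]

theorem convMul_comm (P Q : AddMonoidAlgebra F G) (X : G → M) :
    convMul P (convMul Q X) = convMul Q (convMul P X) := by
  rw [← convMul_mul, mul_comm, convMul_mul]

@[simp] theorem one_convMul (X : G → M) : convMul (1 : AddMonoidAlgebra F G) X = X := by
  simp [convMul_eq_lift]

@[simp] theorem zero_convMul (X : G → M) : convMul (0 : AddMonoidAlgebra F G) X = 0 := by
  simp [convMul_eq_lift]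

theorem add_convMul (P Q : AddMonoidAlgebra F G) (X : G → M) :
    convMul (P + Q) X = convMul P X + convMul Q X := by
  simp [convMul_eq_lift]

@[simp] theorem convMul_zero (P : AddMonoidAlgebra F G) : convMul P (0 : G → M) = 0 := by
  simp [convMul_eq_lift]

theorem convMul_add (P : AddMonoidAlgebra F G) (X Y : G → M) :
    convMul P (X + Y) = convMul P X + convMul P Y := by
  simp [convMul_eq_lift]

theorem convMul_smul (P : AddMonoidAlgebra F G) (c : F) (X : G → M) :
    convMul P (c • X) = c • convMul P X := by
  simp [convMul_eq_lift]

theorem single_convMul (d : G) (c : F) (X : G → M) (n : G) :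
    convMul (AddMonoidAlgebra.single d c) X n = c • X (n - d) := by
  simp [convMul_eq_lift, translation]

theorem convMul_translate (P : AddMonoidAlgebra F G) (X : G → M) (d : G) :
    convMul P (fun n => X (n + d)) = fun n => convMul P X (n + d) := by
  funext n
  simp [convMul, sub_add_eq_add_sub]

/-- A Laurent polynomial in the monomial `z^d` acts through the powers of `z^d`. -/
theorem aeval_single_convMul (p : Polynomial F) (d : G) (X : G → M) (n : G) :
    convMul (Polynomial.aeval (AddMonoidAlgebra.single d (1 : F)) p) X n
      = p.sum fun k c => c • X (n - k • d) := by
  rw [Polynomial.aeval_eq_sum_range, Polynomial.sum_over_range _ (fun k => by simp)]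
  rw [convMul_eq_lift, map_sum, LinearMap.sum_apply, Finset.sum_apply]
  refine Finset.sum_congr rfl fun k _ => ?_
  rw [← convMul_eq_lift, AddMonoidAlgebra.single_pow, AddMonoidAlgebra.smul_single, single_convMul]
  simp

theorem map_convMul (f : M →ₗ[F] N) (P : AddMonoidAlgebra F G) (X : G → M) (n : G) :
    f (convMul P X n) = convMul P (fun k => f (X k)) n := by
  simp [convMul, Finsupp.sum, map_sum]

/-- `X` has finite support on each fibre of `φ`. -/
def FibreFinite (φ : G →+ H) (X : G → M) : Prop :=
  ∀ h, (φ ⁻¹' {h} ∩ Function.support X).Finite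

/-- The image of a formal distribution under the substitution of variables `z^n ↦ w^{φ n}`;
meaningful when `X` has finite support on the fibres of `φ`. -/
def push (φ : G →+ H) (X : G → M) : H → M := fun h => ∑ᶠ n ∈ φ ⁻¹' {h}, X n

theorem FibreFinite.add {φ : G →+ H} {X Y : G → M} (hX : FibreFinite φ X) (hY : FibreFinite φ Y) :
    FibreFinite φ (X + Y) := fun h =>
  ((hX h).union (hY h)).subset fun n hn => by
    rcases Function.support_add X Y hn.2 with h1 | h1
    exacts [Or.inl ⟨hn.1, h1⟩, Or.inr ⟨hn.1, h1⟩]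

theorem FibreFinite.zero (φ : G →+ H) : FibreFinite φ (0 : G → M) := fun h => by simp

theorem push_zero (φ : G →+ H) : push φ (0 : G → M) = 0 := by
  funext h; simp [push]

theorem push_add {φ : G →+ H} {X Y : G → M} (hX : FibreFinite φ X) (hY : FibreFinite φ Y) :
    push φ (X + Y) = push φ X + push φ Y :=
  funext fun h => finsum_mem_add_distrib' (hX h) (hY h)

theorem push_smul {φ : G →+ H} {X : G → M} (hX : FibreFinite φ X) (c : F) :
    push φ (c • X) = c • push φ X := by
  funext h
  exact ((DistribSMul.toAddMonoidHom M c).map_finsum_mem' (hX h)).symm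

theorem fibreFinite_monomial {φ : G →+ H} {X : G → M} (hX : FibreFinite φ X) (d : G) (c : F) :
    FibreFinite φ (convMul (AddMonoidAlgebra.single d c) X) := by
  intro h
  refine ((hX (h - φ d)).image (· + d)).subset ?_
  rintro n ⟨hn, hn'⟩
  refine ⟨n - d, ⟨by simpa using congrArg (· - φ d) hn, ?_⟩, by simp⟩
  rw [Function.mem_support, single_convMul] at hn'
  exact fun h0 => hn' (by rw [h0, smul_zero])

theorem push_monomial {φ : G →+ H} {X : G → M} (hX : FibreFinite φ X) (d : G) (c : F) :
    push φ (convMul (AddMonoidAlgebra.single d c) X)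
      = convMul (AddMonoidAlgebra.single (φ d) c) (push φ X) := by
  funext h
  rw [single_convMul]
  change _ = (c • push φ X) (h - φ d)
  rw [← push_smul hX]
  simp only [push]
  refine finsum_mem_eq_of_bijOn (· - d) ⟨?_, ?_, ?_⟩ ?_
  · intro n hn
    simpa using congrArg (· - φ d) hn
  · intro a _ b _ hab
    simpa using hab
  · intro n hn
    refine ⟨n + d, ?_, by simp⟩
    have : φ n = h - φ d := hn
    simp [this]
  · intro n _
    rw [single_convMul]
    rfl

theorem FibreFinite.convMul {φ : G →+ H} {X : G → M} (hX : FibreFinite φ X)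
    (P : AddMonoidAlgebra F G) : FibreFinite φ (convMul P X) := by
  induction P using AddMonoidAlgebra.induction_linear with
  | zero => rw [zero_convMul]; exact FibreFinite.zero φ
  | add P Q hP hQ => rw [add_convMul]; exact hP.add hQ
  | single d c => exact fibreFinite_monomial hX d c

/-- Substitution of variables is compatible with the action of Laurent polynomials. -/
theorem push_convMul {φ : G →+ H} {X : G → M} (hX : FibreFinite φ X) (P : AddMonoidAlgebra F G) :
    push φ (convMul P X) = convMul (AddMonoidAlgebra.mapDomain φ P) (push φ X) := by
  induction P using AddMonoidAlgebra.induction_linear with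
  | zero => simp [push_zero]
  | add P Q hP hQ =>
    rw [add_convMul, push_add (hX.convMul P) (hX.convMul Q), hP, hQ,
      AddMonoidAlgebra.mapDomain_add, add_convMul]
  | single d c => rw [push_monomial hX, AddMonoidAlgebra.mapDomain_single]

theorem push_push {φ : G →+ H} {ψ : H →+ K} {X : G → M} (hX : FibreFinite (ψ.comp φ) X) :
    push ψ (push φ X) = push (ψ.comp φ) X := by
  classical
  funext k
  set s : Finset G := (hX k).toFinset
  have hs : ∀ n, n ∈ s ↔ ψ (φ n) = k ∧ X n ≠ 0 := fun n => by
    simp only [s, Set.Finite.mem_toFinset]; rfl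
  have h1 : push (ψ.comp φ) X k = ∑ n ∈ s, X n := by
    refine finsum_mem_eq_sum_of_inter_support_eq X ?_
    ext n
    simp [hs]
  have h2 : ∀ h ∈ s.image φ, push φ X h = ∑ n ∈ s with φ n = h, X n := by
    intro h hh
    refine finsum_mem_eq_sum_of_inter_support_eq X ?_
    obtain ⟨m, hm, rfl⟩ := Finset.mem_image.1 hh
    have := ((hs m).1 hm).1
    ext n
    simp only [Set.mem_inter_iff, Set.mem_preimage, Set.mem_singleton_iff, Function.mem_support,
      Finset.coe_filter, hs, Set.mem_ofPred_eq]
    constructor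
    · rintro ⟨h3, h4⟩
      exact ⟨⟨⟨by rw [h3, this], h4⟩, h3⟩, h4⟩
    · rintro ⟨⟨⟨_, h4⟩, h3⟩, _⟩
      exact ⟨h3, h4⟩
  have h3 : push ψ (push φ X) k = ∑ h ∈ s.image φ, push φ X h := by
    refine finsum_mem_eq_sum_of_inter_support_eq _ ?_
    ext h
    simp only [Set.mem_inter_iff, Set.mem_preimage, Set.mem_singleton_iff, Function.mem_support,
      Finset.coe_image, Set.mem_image, SetLike.mem_coe]
    refine and_congr_left fun hne => ⟨fun hh => ?_, ?_⟩
    · obtain ⟨n, hn, hn'⟩ := exists_ne_zero_of_finsum_mem_ne_zero hne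
      have h4 : φ n = h := hn
      exact ⟨n, (hs n).2 ⟨by rw [h4, hh], hn'⟩, h4⟩
    · rintro ⟨n, hn, rfl⟩
      exact ((hs n).1 hn).1
  rw [h1, h3, Finset.sum_congr rfl h2]
  exact Finset.sum_fiberwise_of_maps_to (fun n hn => Finset.mem_image_of_mem _ hn) _

end Convolution

/-! ### Laurent series and substitutions of variables -/

section Variables

variable {F : Type*} [Field F] {M : Type*} [AddCommGroup M] [Module F M] {m m' : ℕ}

/-- The map on exponents of the substitution `z_i ↦ w_{φ i}`. -/
def varMap (φ : Fin m → Fin m') : (Fin m → ℤ) →+ (Fin m' → ℤ) where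
  toFun n k := ∑ i with φ i = k, n i
  map_zero' := by ext; simp
  map_add' n n' := by ext; simp [Finset.sum_add_distrib]

theorem varMap_apply (φ : Fin m → Fin m') (n : Fin m → ℤ) (k : Fin m') :
    varMap φ n k = ∑ i with φ i = k, n i := rfl

/-- The map on exponents of the substitution `z_i ↦ z` of one variable for all. -/
def total (m : ℕ) : (Fin m → ℤ) →+ ℤ where
  toFun n := ∑ i, n i
  map_zero' := by simp
  map_add' n n' := by simp [Finset.sum_add_distrib]

theorem total_apply (n : Fin m → ℤ) : total m n = ∑ i, n i := rfl

theorem total_comp_varMap (φ : Fin m → Fin m') : (total m').comp (varMap φ) = total m := by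
  refine AddMonoidHom.ext fun n => ?_
  exact Finset.sum_fiberwise Finset.univ φ n

theorem varMap_single (φ : Fin m → Fin m') (i : Fin m) (c : ℤ) :
    varMap φ (Pi.single i c) = Pi.single (φ i) c := by
  ext k
  rw [varMap_apply, Finset.sum_filter]
  simp only [Pi.single_apply]
  rw [Finset.sum_eq_single i (by intro b _ hb; simp [hb]) (by simp)]
  simp [eq_comm]

/-- `X` involves only exponents of `z_i` bounded below. -/
def BoundedBelowIn (i : Fin m) (X : (Fin m → ℤ) → M) : Prop := ∃ N : ℤ, ∀ n, n i < N → X n = 0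

/-- `X` lies in `M((z_1, …, z_m))`. -/
def Laurent (X : (Fin m → ℤ) → M) : Prop := ∃ N : ℤ, ∀ n : Fin m → ℤ, (∃ i, n i < N) → X n = 0

theorem laurent_iff {X : (Fin m → ℤ) → M} : Laurent X ↔ ∀ i, BoundedBelowIn i X := by
  constructor
  · rintro ⟨N, hN⟩ i
    exact ⟨N, fun n hn => hN n ⟨i, hn⟩⟩
  · intro h
    choose N hN using h
    rcases isEmpty_or_nonempty (Fin m) with hm | hm
    · exact ⟨0, fun n ⟨i, _⟩ => (hm.false i).elim⟩
    · refine ⟨Finset.univ.inf' Finset.univ_nonempty N, fun n ⟨i, hi⟩ => hN i n ?_⟩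
      exact hi.trans_le (Finset.inf'_le _ (Finset.mem_univ i))

theorem BoundedBelowIn.add {i : Fin m} {X Y : (Fin m → ℤ) → M} (hX : BoundedBelowIn i X)
    (hY : BoundedBelowIn i Y) : BoundedBelowIn i (X + Y) := by
  obtain ⟨N, hN⟩ := hX
  obtain ⟨N', hN'⟩ := hY
  refine ⟨min N N', fun n hn => ?_⟩
  simp [hN n (lt_of_lt_of_le hn (min_le_left _ _)), hN' n (lt_of_lt_of_le hn (min_le_right _ _))]

theorem BoundedBelowIn.convMul {i : Fin m} {X : (Fin m → ℤ) → M} (hX : BoundedBelowIn i X)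
    (P : AddMonoidAlgebra F (Fin m → ℤ)) : BoundedBelowIn i (convMul P X) := by
  induction P using AddMonoidAlgebra.induction_linear with
  | zero => exact ⟨0, fun n _ => by simp⟩
  | add P Q hP hQ => rw [add_convMul]; exact hP.add hQ
  | single d c =>
    obtain ⟨N, hN⟩ := hX
    refine ⟨N + d i, fun n hn => ?_⟩
    rw [single_convMul, hN, smul_zero]
    simpa [sub_lt_iff_lt_add] using hn

theorem Laurent.add {X Y : (Fin m → ℤ) → M} (hX : Laurent X) (hY : Laurent Y) :
    Laurent (X + Y) :=
  laurent_iff.2 fun i => (laurent_iff.1 hX i).add (laurent_iff.1 hY i)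

theorem Laurent.convMul {X : (Fin m → ℤ) → M} (hX : Laurent X)
    (P : AddMonoidAlgebra F (Fin m → ℤ)) : Laurent (convMul P X) :=
  laurent_iff.2 fun i => (laurent_iff.1 hX i).convMul P

theorem Laurent.zero : Laurent (0 : (Fin m → ℤ) → M) := ⟨0, fun _ _ => rfl⟩

theorem Laurent.smul {X : (Fin m → ℤ) → M} (hX : Laurent X) (c : (Fin m → ℤ) → F) :
    Laurent (fun n => c n • X n) := by
  obtain ⟨N, hN⟩ := hX
  exact ⟨N, fun n hn => by simp only [hN n hn, smul_zero]⟩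

theorem Laurent.translate {X : (Fin m → ℤ) → M} (hX : Laurent X) (d : Fin m → ℤ) :
    Laurent (fun n => X (n + d)) := by
  refine laurent_iff.2 fun i => ?_
  obtain ⟨N, hN⟩ := laurent_iff.1 hX i
  refine ⟨N - d i, fun n hn => hN _ ?_⟩
  simpa [lt_sub_iff_add_lt] using hn

theorem Laurent.fibreFinite {X : (Fin m → ℤ) → M} (hX : Laurent X) :
    FibreFinite (total m) X := by
  obtain ⟨N, hN⟩ := hX
  intro h
  refine (Set.finite_Icc (fun _ : Fin m => N) fun _ => h - (m - 1) * N).subset ?_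
  rintro n ⟨hn, hn'⟩
  have h1 : ∀ i, N ≤ n i := fun i => by
    by_contra hc
    exact hn' (hN n ⟨i, not_le.1 hc⟩)
  refine ⟨h1, fun i => ?_⟩
  have h2 : n i + ∑ j ∈ Finset.univ.erase i, n j = h := by
    rw [Finset.add_sum_erase _ _ (Finset.mem_univ i)]
    exact hn
  have h3 : (Finset.univ.erase i).card • N ≤ ∑ j ∈ Finset.univ.erase i, n j :=
    Finset.card_nsmul_le_sum _ _ _ fun j _ => h1 j
  rw [Finset.card_erase_of_mem (Finset.mem_univ i), Finset.card_univ, Fintype.card_fin,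
    nsmul_eq_mul, Nat.cast_sub (Fin.pos i)] at h3
  push_cast at h3
  change n i ≤ h - (m - 1) * N
  linarith

theorem Laurent.push {X : (Fin m → ℤ) → M} (hX : Laurent X) (φ : Fin m → Fin m') :
    Laurent (push (varMap φ) X) := by
  obtain ⟨N, hN⟩ := hX
  refine ⟨m * min N 0, fun n' ⟨k, hk⟩ => finsum_mem_of_eqOn_zero fun n hn => hN n ?_⟩
  by_contra! hc
  have h1 : n' k = ∑ i with φ i = k, n i := by
    have : varMap φ n = n' := hn
    rw [← this, varMap_apply]
  have h2 : (Finset.univ.filter fun i => φ i = k).card • min N 0 ≤ ∑ i with φ i = k, n i :=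
    Finset.card_nsmul_le_sum _ _ _ fun j _ => (min_le_left _ _).trans (hc j)
  have h3 : (Finset.univ.filter fun i => φ i = k).card ≤ m := by
    simpa using Finset.card_filter_le (Finset.univ : Finset (Fin m)) fun i => φ i = k
  rw [nsmul_eq_mul] at h2
  have h4 : (m : ℤ) * min N 0 ≤ ((Finset.univ.filter fun i => φ i = k).card : ℤ) * min N 0 :=
    mul_le_mul_of_nonpos_right (by exact_mod_cast h3) (min_le_right _ _)
  linarith

/-! ### Regularizing Laurent polynomials -/

theorem ratioPoly_convMul (p : Polynomial F) (i j : Fin m) (X : (Fin m → ℤ) → M)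
    (n : Fin m → ℤ) :
    convMul (ratioPoly F p i j) X n
      = p.sum fun k c => c • X (n - k • (Pi.single j (1 : ℤ) - Pi.single i (1 : ℤ))) :=
  aeval_single_convMul p _ X n

theorem ratioPoly_mul (p p' : Polynomial F) (i j : Fin m) :
    ratioPoly F (p * p') i j = ratioPoly F p i j * ratioPoly F p' i j := map_mul _ _ _

theorem ratioPoly_self (p : Polynomial F) (i : Fin m) :
    ratioPoly F p i i = algebraMap _ _ (p.eval 1) := by
  rw [ratioPoly, sub_self]
  change Polynomial.aeval (1 : AddMonoidAlgebra F (Fin m → ℤ)) p = _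
  rw [← map_one (algebraMap F (AddMonoidAlgebra F (Fin m → ℤ))), Polynomial.aeval_algebraMap_apply]
  simp

theorem mapDomain_ratioPoly (φ : Fin m → Fin m') (p : Polynomial F) (i j : Fin m) :
    AddMonoidAlgebra.mapDomain (varMap φ) (ratioPoly F p i j) = ratioPoly F p (φ i) (φ j) := by
  have h : AddMonoidAlgebra.mapDomainAlgHom F F (varMap φ)
      (AddMonoidAlgebra.single (Pi.single j (1 : ℤ) - Pi.single i (1 : ℤ) : Fin m → ℤ) (1 : F))
      = AddMonoidAlgebra.single (Pi.single (φ j) 1 - Pi.single (φ i) 1) 1 := by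
    change AddMonoidAlgebra.mapDomain (varMap φ) _ = _
    rw [AddMonoidAlgebra.mapDomain_single, map_sub, varMap_single, varMap_single]
  change AddMonoidAlgebra.mapDomainAlgHom F F (varMap φ) (Polynomial.aeval _ p) = _
  rw [← Polynomial.aeval_algHom_apply, h, ratioPoly]

variable (F m) in
/-- The value of a Laurent polynomial at `(1, …, 1)`. -/
def augmentation : AddMonoidAlgebra F (Fin m → ℤ) →ₐ[F] F := AddMonoidAlgebra.lift F _ _ 1

theorem augmentation_single (d : Fin m → ℤ) (c : F) :
    augmentation F m (AddMonoidAlgebra.single d c) = c := by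
  simp [augmentation]

theorem augmentation_mapDomain (φ : Fin m → Fin m') (P : AddMonoidAlgebra F (Fin m → ℤ)) :
    augmentation F m' (AddMonoidAlgebra.mapDomain (varMap φ) P) = augmentation F m P := by
  induction P using AddMonoidAlgebra.induction_linear with
  | zero => simp
  | add P Q hP hQ => simp [AddMonoidAlgebra.mapDomain_add, hP, hQ]
  | single d c => simp [AddMonoidAlgebra.mapDomain_single, augmentation_single]

theorem augmentation_ratioPoly (p : Polynomial F) (i j : Fin m) :
    augmentation F m (ratioPoly F p i j) = p.eval 1 := by
  rw [ratioPoly, ← Polynomial.aeval_algHom_apply, augmentation_single]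
  simp

/-- The monoid of Laurent polynomials generated by the `p(z_j / z_i)`, `i ≤ j`, where `p` does not
vanish at `1, q, q², …`. The case `i = j` contributes the nonzero constants. -/
def regularizers (q : F) (m : ℕ) : Submonoid (AddMonoidAlgebra F (Fin m → ℤ)) :=
  Submonoid.closure {P | ∃ (p : Polynomial F) (i j : Fin m), i ≤ j ∧ (∀ n : ℕ, p.eval (q ^ n) ≠ 0) ∧
    P = ratioPoly F p i j}

theorem ratioPoly_mem_regularizers {q : F} {p : Polynomial F} (hp : ∀ n : ℕ, p.eval (q ^ n) ≠ 0)
    {i j : Fin m} (hij : i ≤ j) : ratioPoly F p i j ∈ regularizers q m :=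
  Submonoid.subset_closure ⟨p, i, j, hij, hp, rfl⟩

theorem mapDomain_mem_regularizers {q : F} {φ : Fin m → Fin m'} (hφ : Monotone φ)
    {P : AddMonoidAlgebra F (Fin m → ℤ)} (hP : P ∈ regularizers q m) :
    AddMonoidAlgebra.mapDomain (varMap φ) P ∈ regularizers q m' := by
  induction hP using Submonoid.closure_induction with
  | mem P hP =>
    obtain ⟨p, i, j, hij, hp, rfl⟩ := hP
    rw [mapDomain_ratioPoly]
    exact ratioPoly_mem_regularizers hp (hφ hij)
  | one => rw [AddMonoidAlgebra.mapDomain_one]; exact one_mem _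
  | mul P Q _ _ hP hQ => rw [AddMonoidAlgebra.mapDomain_mul]; exact mul_mem hP hQ

theorem augmentation_ne_zero {q : F} {P : AddMonoidAlgebra F (Fin m → ℤ)}
    (hP : P ∈ regularizers q m) : augmentation F m P ≠ 0 := by
  induction hP using Submonoid.closure_induction with
  | mem P hP =>
    obtain ⟨p, i, j, hij, hp, rfl⟩ := hP
    rw [augmentation_ratioPoly]
    simpa using hp 0
  | one => simp
  | mul P Q _ _ hP hQ => rw [map_mul]; exact mul_ne_zero hP hQ

/-- Regularizers are homogeneous of degree `0`, so they become constants when all variables are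
identified. -/
theorem mapDomain_total {q : F} {P : AddMonoidAlgebra F (Fin m → ℤ)}
    (hP : P ∈ regularizers q m) :
    AddMonoidAlgebra.mapDomain (total m) P = AddMonoidAlgebra.single 0 (augmentation F m P) := by
  induction hP using Submonoid.closure_induction with
  | mem P hP =>
    obtain ⟨p, i, j, hij, hp, rfl⟩ := hP
    rw [augmentation_ratioPoly]
    change AddMonoidAlgebra.mapDomainAlgHom F F (total m) (Polynomial.aeval _ p) = _
    rw [← Polynomial.aeval_algHom_apply]
    have : AddMonoidAlgebra.mapDomainAlgHom F F (total m)
        (AddMonoidAlgebra.single (Pi.single j (1 : ℤ) - Pi.single i (1 : ℤ) : Fin m → ℤ) (1 : F))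
        = algebraMap F (AddMonoidAlgebra F ℤ) 1 := by
      change AddMonoidAlgebra.mapDomain (total m) _ = _
      rw [AddMonoidAlgebra.mapDomain_single, map_one, AddMonoidAlgebra.one_def]
      simp only [map_sub, total_apply, Finset.sum_pi_single', Finset.mem_univ, if_true, sub_self]
    rw [this, Polynomial.aeval_algebraMap_apply]
    simp
  | one => rw [AddMonoidAlgebra.mapDomain_one, map_one]; rfl
  | mul P Q _ _ hP hQ =>
    rw [AddMonoidAlgebra.mapDomain_mul, hP, hQ, AddMonoidAlgebra.single_mul_single, add_zero,
      map_mul]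

theorem push_total_convMul {q : F} {P : AddMonoidAlgebra F (Fin m → ℤ)}
    (hP : P ∈ regularizers q m) {X : (Fin m → ℤ) → M} (hX : FibreFinite (total m) X) :
    push (total m) (convMul P X) = augmentation F m P • push (total m) X := by
  rw [push_convMul hX, mapDomain_total hP]
  funext n
  rw [single_convMul, sub_zero]
  rfl

/-! ### Values of regularized distributions on the diagonal -/

/-- `f(z)` is the value at `z_1 = ⋯ = z_m = z` of `X(z_1, …, z_m)`, in the sense that
`P(z, …, z) f(z) = (P X)(z, …, z)` for some regularizer `P` with `P X` a Laurent series. -/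
def HasDiagonal (q : F) (X : (Fin m → ℤ) → M) (f : ℤ → M) : Prop :=
  ∃ P ∈ regularizers q m, Laurent (convMul P X) ∧
    push (total m) (convMul P X) = augmentation F m P • f

theorem HasDiagonal.unique {q : F} {X : (Fin m → ℤ) → M} {f g : ℤ → M} (hf : HasDiagonal q X f)
    (hg : HasDiagonal q X g) : f = g := by
  obtain ⟨P, hP, hL, hPf⟩ := hf
  obtain ⟨Q, hQ, hL', hQg⟩ := hg
  have h1 := push_total_convMul hQ hL.fibreFinite
  have h2 := push_total_convMul hP hL'.fibreFinite
  rw [hPf, ← convMul_mul, smul_smul] at h1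
  rw [hQg, ← convMul_mul, mul_comm, h1, smul_smul, mul_comm] at h2
  exact smul_right_injective _ (mul_ne_zero (augmentation_ne_zero hP) (augmentation_ne_zero hQ)) h2

theorem Laurent.exists_hasDiagonal {q : F} {P : AddMonoidAlgebra F (Fin m → ℤ)}
    (hP : P ∈ regularizers q m) {X : (Fin m → ℤ) → M} (hX : Laurent (QVA.convMul P X)) :
    ∃ f, HasDiagonal q X f :=
  ⟨(augmentation F m P)⁻¹ • QVA.push (total m) (QVA.convMul P X), P, hP, hX, by
    rw [smul_inv_smul₀ (augmentation_ne_zero hP)]⟩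

theorem HasDiagonal.zero (q : F) : HasDiagonal q (0 : (Fin m → ℤ) → M) 0 :=
  ⟨1, one_mem _, by rw [convMul_zero]; exact Laurent.zero, by simp [push_zero]⟩

theorem HasDiagonal.add {q : F} {X Y : (Fin m → ℤ) → M} {f g : ℤ → M} (hf : HasDiagonal q X f)
    (hg : HasDiagonal q Y g) : HasDiagonal q (X + Y) (f + g) := by
  obtain ⟨P, hP, hL, hPf⟩ := hf
  obtain ⟨Q, hQ, hL', hQg⟩ := hg
  have h1 : convMul (P * Q) (X + Y) = convMul Q (convMul P X) + convMul P (convMul Q Y) := by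
    rw [convMul_add, convMul_mul, convMul_mul, convMul_comm P Q X]
  refine ⟨P * Q, mul_mem hP hQ, ?_, ?_⟩
  · rw [h1]
    exact (hL.convMul Q).add (hL'.convMul P)
  · rw [h1, push_add (hL.convMul Q).fibreFinite (hL'.convMul P).fibreFinite,
      push_total_convMul hQ hL.fibreFinite, push_total_convMul hP hL'.fibreFinite, hPf, hQg,
      map_mul, smul_smul, smul_smul, smul_add, mul_comm]

theorem HasDiagonal.smul {q : F} {X : (Fin m → ℤ) → M} {f : ℤ → M} (hf : HasDiagonal q X f)
    (c : F) : HasDiagonal q (c • X) (c • f) := by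
  obtain ⟨P, hP, hL, hPf⟩ := hf
  refine ⟨P, hP, ?_, ?_⟩
  · rw [convMul_smul]
    exact hL.smul fun _ => c
  · rw [convMul_smul, push_smul hL.fibreFinite, hPf, smul_comm]

theorem HasDiagonal.sum {q : F} {ι : Type*} (s : Finset ι) {X : ι → (Fin m → ℤ) → M}
    {f : ι → ℤ → M} (h : ∀ i ∈ s, HasDiagonal q (X i) (f i)) :
    HasDiagonal q (∑ i ∈ s, X i) (∑ i ∈ s, f i) := by
  classical
  induction s using Finset.induction_on with
  | empty => exact HasDiagonal.zero q
  | insert i s hi ih =>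
    rw [Finset.sum_insert hi, Finset.sum_insert hi]
    exact (h i (Finset.mem_insert_self i s)).add
      (ih fun j hj => h j (Finset.mem_insert_of_mem hj))

theorem push_translate {G H : Type*} [AddCommGroup G] [AddCommGroup H] (φ : G →+ H) (X : G → M)
    (d : G) :
    push φ (fun n => X (n + d)) = fun n => push φ X (n + φ d) := by
  funext h
  simp only [push]
  refine finsum_mem_eq_of_bijOn (· + d) ⟨?_, ?_, ?_⟩ fun _ _ => rfl
  · intro n hn
    simpa using congrArg (· + φ d) hn
  · intro a _ b _ hab
    simpa using hab
  · intro n hn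
    refine ⟨n - d, ?_, by simp⟩
    have : φ n = h + φ d := hn
    simp [this]

theorem HasDiagonal.translate {q : F} {X : (Fin m → ℤ) → M} {f : ℤ → M}
    (hf : HasDiagonal q X f) (d : Fin m → ℤ) :
    HasDiagonal q (fun n => X (n + d)) (fun n => f (n + total m d)) := by
  obtain ⟨P, hP, hL, hPf⟩ := hf
  refine ⟨P, hP, ?_, ?_⟩
  · rw [convMul_translate]
    exact hL.translate d
  · rw [convMul_translate, push_translate, hPf]
    rfl

/-- Substitutions respect regularity: if the substitution `φ` takes the regularized distribution
`P X` to `φ(P) Y`, then a regularizer of `X` gives one of `Y`. -/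
theorem laurent_of_push {φ : Fin m → Fin m'} {P Q : AddMonoidAlgebra F (Fin m → ℤ)}
    {X : (Fin m → ℤ) → M} {Y : (Fin m' → ℤ) → M} (hQ : Laurent (convMul Q X))
    (hfin : FibreFinite (varMap φ) (convMul P X))
    (hXY : push (varMap φ) (convMul P X) = convMul (AddMonoidAlgebra.mapDomain (varMap φ) P) Y) :
    convMul (AddMonoidAlgebra.mapDomain (varMap φ) (Q * P)) Y
        = push (varMap φ) (convMul (P * Q) X) ∧
      Laurent (convMul (AddMonoidAlgebra.mapDomain (varMap φ) (Q * P)) Y) := by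
  have h : convMul (AddMonoidAlgebra.mapDomain (varMap φ) (Q * P)) Y
      = push (varMap φ) (convMul (P * Q) X) := by
    rw [AddMonoidAlgebra.mapDomain_mul, convMul_mul, ← hXY, ← push_convMul hfin, mul_comm,
      convMul_mul]
  refine ⟨h, ?_⟩
  rw [h, convMul_mul]
  exact (hQ.convMul P).push φ

/-- Substitutions respect diagonal values. -/
theorem HasDiagonal.of_push {q : F} {φ : Fin m → Fin m'} (hφ : Monotone φ)
    {P : AddMonoidAlgebra F (Fin m → ℤ)} (hP : P ∈ regularizers q m)
    {X : (Fin m → ℤ) → M} {Y : (Fin m' → ℤ) → M}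
    (hfin : FibreFinite (varMap φ) (convMul P X))
    (hXY : push (varMap φ) (convMul P X) = convMul (AddMonoidAlgebra.mapDomain (varMap φ) P) Y)
    {f : ℤ → M} (hf : HasDiagonal q X f) : HasDiagonal q Y f := by
  obtain ⟨Q, hQ, hL, hQf⟩ := hf
  obtain ⟨h1, h2⟩ := laurent_of_push hL hfin hXY
  refine ⟨_, mapDomain_mem_regularizers hφ (mul_mem hQ hP), h2, ?_⟩
  have h3 : Laurent (QVA.convMul (P * Q) X) := by rw [convMul_mul]; exact hL.convMul P
  rw [h1, push_push (by rw [total_comp_varMap]; exact h3.fibreFinite), total_comp_varMap,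
    convMul_mul, push_total_convMul hP hL.fibreFinite, hQf, augmentation_mapDomain, map_mul,
    smul_smul, mul_comm]

end Variables

/-! ### Ordered products of operators -/

section OrderedProducts

variable {R : Type*} [Monoid R] {m : ℕ}

/-- An ordered product depends on its `j`-th factor through a two-sided multiplication. -/
theorem exists_prod_ofFn_update (g : Fin m → R) (j : Fin m) :
    ∃ A B : R, ∀ x, (List.ofFn (Function.update g j x)).prod = A * x * B := by
  refine ⟨((List.ofFn g).take j).prod, ((List.ofFn g).drop (j + 1)).prod, fun x => ?_⟩
  have : List.ofFn (Function.update g j x) = (List.ofFn g).set j x := by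
    refine List.ext_getElem (by simp) fun i h1 h2 => ?_
    simp only [List.getElem_ofFn, List.getElem_set, Function.update_apply, Fin.ext_iff,
      eq_comm (a := (j : ℕ))]
  rw [this, List.prod_set, if_pos (by simp)]

theorem prod_ofFn_merge (f : Fin (m + 2) → R) (j : Fin (m + 1)) :
    (List.ofFn f).prod = (List.ofFn (Function.update (fun k => f (j.castSucc.succAbove k)) j
      (f j.castSucc * f j.succ))).prod := by
  induction m with
  | zero =>
    have : j = 0 := Fin.fin_one_eq_zero j
    subst this
    simp [List.ofFn_succ]
  | succ m ih =>
    refine Fin.cases ?_ (fun j => ?_) j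
    · rw [List.ofFn_succ, List.ofFn_succ, List.ofFn_succ (f := Function.update _ _ _)]
      simp [mul_assoc]
    · rw [List.ofFn_succ, List.prod_cons, ih (fun i => f i.succ) j,
        List.ofFn_succ (f := Function.update (fun k => f (j.succ.castSucc.succAbove k)) _ _),
        List.prod_cons]
      congr 1
      congr 2
      funext k
      by_cases h : k = j
      · subst h
        simp
      · rw [Function.update_of_ne h, Function.update_of_ne (by simpa using h)]
        rw [Fin.castSucc_succ, Fin.succ_succAbove_succ]

theorem prod_ofFn_succAbove (f : Fin (m + 1) → R) (j : Fin (m + 1)) (hj : f j = 1) :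
    (List.ofFn f).prod = (List.ofFn fun k => f (j.succAbove k)).prod := by
  induction m with
  | zero =>
    have : j = 0 := Fin.fin_one_eq_zero j
    subst this
    simp [hj]
  | succ m ih =>
    revert hj
    refine Fin.cases (fun hj => ?_) (fun j hj => ?_) j
    · rw [List.ofFn_succ, List.prod_cons, hj, one_mul]
      rfl
    · rw [List.ofFn_succ, List.prod_cons, ih (fun i => f i.succ) j hj,
        List.ofFn_succ (f := fun k => f (j.succ.succAbove k)), List.prod_cons]
      simp

end OrderedProducts

section Operators

variable {F : Type*} [Field F] {L : Type*} [AddCommGroup L] [Module F L] {m : ℕ}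

theorem laurentMul_apply (P : AddMonoidAlgebra F (Fin m → ℤ)) (A : Distribution F L m)
    (n : Fin m → ℤ) (v : L) : laurentMul P A n v = convMul P (fun k => A k v) n :=
  map_convMul (LinearMap.applyₗ v : Module.End F L →ₗ[F] L) P A n

theorem mulDist_apply (b : Fin m → ℤ → Module.End F L) (n : Fin m → ℤ) :
    mulDist b n = MultilinearMap.mkPiAlgebraFin F m (Module.End F L) fun k => b k (n k) := by
  rw [MultilinearMap.mkPiAlgebraFin_apply]
  rfl

theorem mulDist_update (b : Fin m → ℤ → Module.End F L) (j : Fin m) (x : ℤ → Module.End F L)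
    (n : Fin m → ℤ) :
    mulDist (Function.update b j x) n = MultilinearMap.mkPiAlgebraFin F m (Module.End F L)
      (Function.update (fun k => b k (n k)) j (x (n j))) := by
  rw [mulDist_apply]
  congr 1
  funext k
  by_cases h : k = j
  · subst h; simp
  · simp [h]

theorem mulDist_pair (a b : ℤ → Module.End F L) (n : Fin 2 → ℤ) :
    mulDist ![a, b] n = a (n 0) * b (n 1) := by
  simp [mulDist, List.ofFn_succ]

/-! ### Regular distributions -/

/-- `A` becomes a Laurent series, with operator coefficients, after multiplication by some
regularizer. -/
def Regular (q : F) (A : Distribution F L m) : Prop :=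
  ∃ P ∈ regularizers q m, ∀ v, Laurent (convMul P fun n => A n v)

theorem Regular.zero (q : F) : Regular q (0 : Distribution F L m) :=
  ⟨1, one_mem _, fun v => by rw [one_convMul]; exact Laurent.zero⟩

theorem Regular.add {q : F} {A B : Distribution F L m} (hA : Regular q A) (hB : Regular q B) :
    Regular q (A + B) := by
  obtain ⟨P, hP, hA⟩ := hA
  obtain ⟨Q, hQ, hB⟩ := hB
  refine ⟨P * Q, mul_mem hP hQ, fun v => ?_⟩
  have : (fun n => (A + B) n v) = (fun n => A n v) + fun n => B n v := rfl
  rw [this, convMul_add, convMul_mul, convMul_mul, convMul_comm P Q]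
  exact ((hA v).convMul Q).add ((hB v).convMul P)

theorem Regular.smul {q : F} {A : Distribution F L m} (hA : Regular q A) (c : F) :
    Regular q (c • A) := by
  obtain ⟨P, hP, hA⟩ := hA
  refine ⟨P, hP, fun v => ?_⟩
  have : (fun n => (c • A) n v) = c • fun n => A n v := rfl
  rw [this, convMul_smul]
  exact (hA v).smul fun _ => c

theorem Regular.translate {q : F} {A : Distribution F L m} (hA : Regular q A) (d : Fin m → ℤ) :
    Regular q (fun n => A (n + d)) := by
  obtain ⟨P, hP, hA⟩ := hA
  refine ⟨P, hP, fun v => ?_⟩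
  rw [convMul_translate P (fun n => A n v)]
  exact (hA v).translate d

theorem Regular.exists_hasDiagonal {q : F} {A : Distribution F L m} (hA : Regular q A) (v : L) :
    ∃ f, HasDiagonal q (fun n => A n v) f := by
  obtain ⟨P, hP, hA⟩ := hA
  exact (hA v).exists_hasDiagonal hP

/-- Every regularizer divides one of the form `∏_{i<j} p(z_j/z_i)` with `p` in `F[z]_0`. -/
theorem exists_dvd_of_mem_regularizers {q : F} {P : AddMonoidAlgebra F (Fin m → ℤ)}
    (hP : P ∈ regularizers q m) : ∃ p, IsAdmissible q p ∧
      P ∣ ∏ ij : Fin m × Fin m with ij.1 < ij.2, ratioPoly F p ij.1 ij.2 := by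
  induction hP using Submonoid.closure_induction with
  | mem P hP =>
    obtain ⟨p, i, j, hij, hp, rfl⟩ := hP
    have h1 : p.eval 1 ≠ 0 := by simpa using hp 0
    rcases hij.lt_or_eq with hlt | rfl
    · refine ⟨Polynomial.C (p.eval 1)⁻¹ * p, ⟨?_, fun n => ?_⟩, ?_⟩
      · simp [h1]
      · simp [h1, hp n]
      · refine dvd_trans ?_ (Finset.dvd_prod_of_mem _
          (Finset.mem_filter.2 ⟨Finset.mem_univ (i, j), hlt⟩))
        rw [ratioPoly_mul]
        exact dvd_mul_left _ _
    · refine ⟨1, ⟨by simp, by simp⟩, ?_⟩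
      rw [ratioPoly_self]
      exact (((isUnit_iff_ne_zero.2 h1).map (algebraMap F _)).dvd)
  | one => exact ⟨1, ⟨by simp, by simp⟩, one_dvd _⟩
  | mul P Q _ _ hP hQ =>
    obtain ⟨p, hp, hPp⟩ := hP
    obtain ⟨p', hp', hPp'⟩ := hQ
    refine ⟨p * p', ⟨by simp [hp.1, hp'.1], fun n => ?_⟩, ?_⟩
    · rw [Polynomial.eval_mul]
      exact mul_ne_zero (hp.2 n) (hp'.2 n)
    · simp only [ratioPoly_mul, Finset.prod_mul_distrib]
      exact mul_dvd_mul hPp hPp'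

theorem Regular.exists_admissible {q : F} {A : Distribution F L m} (hA : Regular q A) :
    ∃ p, IsAdmissible q p ∧ IsLaurent (laurentMul
      (∏ ij : Fin m × Fin m with ij.1 < ij.2, ratioPoly F p ij.1 ij.2) A) := by
  obtain ⟨P, hP, hA⟩ := hA
  obtain ⟨p, hp, R, hR⟩ := exists_dvd_of_mem_regularizers hP
  refine ⟨p, hp, fun v => ?_⟩
  have : (fun n => laurentMul (∏ ij : Fin m × Fin m with ij.1 < ij.2, ratioPoly F p ij.1 ij.2) A n v)
      = convMul R (convMul P fun n => A n v) := by
    funext n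
    rw [laurentMul_apply, hR, mul_comm, convMul_mul]
  change Laurent fun n => laurentMul _ A n v
  rw [this]
  exact (hA v).convMul R

theorem Regular.exists_admissible_pair {q : F} {A : Distribution F L 2} (hA : Regular q A) :
    ∃ p, IsAdmissible q p ∧ IsLaurent (laurentMul (ratioPoly F p 0 1) A) := by
  obtain ⟨p, hp, h⟩ := hA.exists_admissible
  refine ⟨p, hp, ?_⟩
  have : (Finset.univ.filter fun ij : Fin 2 × Fin 2 => ij.1 < ij.2) = {(0, 1)} := by decide
  rwa [this, Finset.prod_singleton] at h

/-! ### Merging two adjacent variables, and inserting a constant factor -/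

theorem varMap_predAbove (j : Fin (m + 1)) (n : Fin (m + 2) → ℤ) (k : Fin (m + 1)) :
    varMap (j.predAbove) n k
      = (if k = j then n j.castSucc else 0) + n (j.castSucc.succAbove k) := by
  rw [varMap_apply, Finset.sum_filter, Fin.sum_univ_succAbove _ j.castSucc]
  simp only [Fin.predAbove_castSucc_self, Fin.predAbove_succAbove, Finset.sum_ite_eq',
    Finset.mem_univ, if_true, eq_comm (a := j)]

/-- Setting `z_j = z_{j+1}` in the regularized product of `m + 2` fields gives the product of
`m + 1` fields in which the factors `j` and `j + 1` are replaced by their regularized product on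
the diagonal. -/
theorem push_merge {b : Fin (m + 2) → ℤ → Module.End F L} {b' : Fin (m + 1) → ℤ → Module.End F L}
    {j : Fin (m + 1)} (hb : ∀ k, k ≠ j → b' k = b (j.castSucc.succAbove k)) {p : Polynomial F}
    (hL : IsLaurent (laurentMul (ratioPoly F p 0 1) (mulDist ![b j.castSucc, b j.succ])))
    (hj : ∀ n v, b' j n v = ∑ᶠ i : ℤ,
      laurentMul (ratioPoly F p 0 1) (mulDist ![b j.castSucc, b j.succ]) ![i, n - i] v) (v : L) :
    FibreFinite (varMap j.predAbove)
      (convMul (ratioPoly F p j.castSucc j.succ) fun n => mulDist b n v) ∧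
    push (varMap j.predAbove) (convMul (ratioPoly F p j.castSucc j.succ) fun n => mulDist b n v)
      = fun n => mulDist b' n v := by
  set X := laurentMul (ratioPoly F p 0 1) (mulDist ![b j.castSucc, b j.succ]) with hX
  -- On the fibre over `n'`, only the `j`-th factor varies.
  have key : ∀ n' : Fin (m + 1) → ℤ, ∃ A B : Module.End F L,
      mulDist b' n' = A * b' j (n' j) * B ∧ ∀ n, varMap j.predAbove n = n' →
        convMul (ratioPoly F p j.castSucc j.succ) (fun n => mulDist b n v) n
          = A (X ![n j.castSucc, n' j - n j.castSucc] (B v)) := by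
    intro n'
    obtain ⟨A, B, hAB⟩ := exists_prod_ofFn_update (fun k => b' k (n' k)) j
    have hm : ∀ n, varMap j.predAbove n = n' →
        mulDist b n = A * (b j.castSucc (n j.castSucc) * b j.succ (n' j - n j.castSucc)) * B := by
      intro n hn
      have hs : n j.succ = n' j - n j.castSucc := by
        have := congrFun hn j
        rw [varMap_predAbove, if_pos rfl, Fin.succAbove_castSucc_self] at this
        omega
      rw [← hAB, ← hs]
      change (List.ofFn fun k => b k (n k)).prod = _
      rw [prod_ofFn_merge _ j]
      congr 2
      funext k
      by_cases h : k = j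
      · subst h; simp
      · rw [Function.update_of_ne h, Function.update_of_ne h, hb k h]
        have := congrFun hn k
        rw [varMap_predAbove, if_neg h, zero_add] at this
        rw [this]
    refine ⟨A, B, ?_, fun n hn => ?_⟩
    · rw [← hAB, Function.update_eq_self]
      rfl
    · rw [hX, laurentMul_apply, ratioPoly_convMul, ratioPoly_convMul, Polynomial.sum,
        Polynomial.sum, map_sum]
      refine Finset.sum_congr rfl fun d _ => ?_
      rw [map_smul]
      congr 1
      have h1 : varMap j.predAbove
          (n - d • (Pi.single j.succ (1 : ℤ) - Pi.single j.castSucc (1 : ℤ))) = n' := by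
        rw [map_sub, map_nsmul, map_sub, varMap_single, varMap_single, hn]
        simp
      rw [hm _ h1, mulDist_pair]
      have h2 : j.castSucc ≠ j.succ := (Fin.castSucc_lt_succ).ne
      have h3 : n j.castSucc - d • ((0 : ℤ) - 1) + (n' j - n j.castSucc - d • ((1 : ℤ) - 0))
          = n' j := by simp
      simp only [Pi.sub_apply, Pi.smul_apply, Pi.single_eq_same, Pi.single_eq_of_ne h2,
        Matrix.cons_val_zero, Matrix.cons_val_one, ne_eq, zero_ne_one,
        one_ne_zero, not_false_eq_true, Pi.single_eq_of_ne, Module.End.mul_apply]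
      rw [← sub_eq_iff_eq_add'.2 h3.symm]
  set ι : (Fin (m + 1) → ℤ) → ℤ → Fin (m + 2) → ℤ := fun n' i =>
    Fin.insertNth (α := fun _ => ℤ) j.castSucc i (Function.update n' j (n' j - i)) with hι
  have hι1 : ∀ n' i, ι n' i j.castSucc = i := fun n' i => by
    simp only [hι, Fin.insertNth_apply_same]
  have hι2 : ∀ n' i, varMap j.predAbove (ι n' i) = n' := by
    intro n' i
    funext k
    rw [varMap_predAbove, hι1]
    by_cases h : k = j
    · subst h; simp only [hι, Fin.insertNth_apply_succAbove, Function.update_self, if_true]; ring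
    · simp only [hι, Fin.insertNth_apply_succAbove, Function.update_of_ne h, if_neg h, zero_add]
  have hι3 : ∀ n' n, varMap j.predAbove n = n' → n = ι n' (n j.castSucc) := by
    intro n' n hn
    subst hn
    refine funext fun k => ?_
    refine Fin.succAboveCases j.castSucc ?_ (fun k => ?_) k
    · rw [hι1]
    · simp only [hι, Fin.insertNth_apply_succAbove]
      by_cases h : k = j
      · subst h
        simp [varMap_predAbove]
      · simp [h, varMap_predAbove]
  refine ⟨fun n' => ?_, funext fun n' => ?_⟩
  · obtain ⟨A, B, -, hAB⟩ := key n'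
    refine ((finite_antidiagonal_support hL (n' j) (B v)).image (ι n')).subset ?_
    rintro n ⟨hn, hn'⟩
    refine ⟨n j.castSucc, ?_, (hι3 n' n hn).symm⟩
    intro h0
    rw [Function.mem_support, hAB n hn] at hn'
    exact hn' ((congrArg A h0).trans (map_zero A))
  · obtain ⟨A, B, hb', hAB⟩ := key n'
    rw [hb', Module.End.mul_apply, Module.End.mul_apply, hj,
      ← LinearMap.toAddMonoidHom_coe, AddMonoidHom.map_finsum _
        (finite_antidiagonal_support hL (n' j) (B v))]
    have hr : (varMap j.predAbove) ⁻¹' {n'} = Set.range (ι n') := by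
      ext n
      constructor
      · intro hn
        exact ⟨_, (hι3 n' n hn).symm⟩
      · rintro ⟨i, rfl⟩
        exact hι2 n' i
    rw [push, hr, finsum_mem_range fun i i' h => by rw [← hι1 n' i, h, hι1]]
    refine finsum_congr fun i => ?_
    rw [hAB _ (hι2 n' i), hι1]
    rfl

theorem varMap_succAbove (j : Fin (m + 1)) (n : Fin m → ℤ) :
    varMap j.succAbove n = Fin.insertNth (α := fun _ => ℤ) j 0 n := by
  funext k
  rw [varMap_apply, Finset.sum_filter]
  refine Fin.succAboveCases j ?_ (fun k => ?_) k
  · simp [Fin.succAbove_ne]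
  · simp

/-- Inserting the identity field as `j`-th factor amounts to adding a variable `z_j` which does not
occur. -/
theorem push_insert_one {b : Fin (m + 1) → ℤ → Module.End F L} {j : Fin (m + 1)}
    (hj : b j = (oneField F L).1) (v : L) :
    FibreFinite (varMap j.succAbove) (fun n => mulDist (fun k => b (j.succAbove k)) n v) ∧
    push (varMap j.succAbove) (fun n => mulDist (fun k => b (j.succAbove k)) n v)
      = fun n => mulDist b n v := by
  have hfib : ∀ n', (varMap j.succAbove) ⁻¹' {n'}
      = if n' j = 0 then {fun k => n' (j.succAbove k)} else ∅ := by
    intro n'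
    ext n
    have : n ∈ (varMap j.succAbove) ⁻¹' {n'} ↔ n' j = 0 ∧ n = fun k => n' (j.succAbove k) := by
      rw [Set.mem_preimage, Set.mem_singleton_iff, varMap_succAbove]
      constructor
      · rintro rfl
        exact ⟨by simp, by simp⟩
      · rintro ⟨h1, rfl⟩
        rw [← h1]
        exact Fin.insertNth_self_removeNth j n'
    rw [this]
    split_ifs with h <;> simp [h]
  have hfin : ∀ n', ((varMap j.succAbove) ⁻¹' {n'}).Finite := fun n' => by
    rw [hfib]
    split_ifs
    exacts [Set.finite_singleton _, Set.finite_empty]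
  refine ⟨fun n' => (hfin n').subset Set.inter_subset_left, funext fun n' => ?_⟩
  rw [push, hfib]
  by_cases h : n' j = 0
  · rw [if_pos h, finsum_mem_singleton]
    congr 1
    exact (prod_ofFn_succAbove (fun k => b k (n' k)) j (by simp [hj, h, oneField])).symm
  · rw [if_neg h, finsum_mem_empty, mulDist_apply]
    rw [MultilinearMap.map_coord_zero _ j (by simp [hj, h, oneField])]
    rfl

end Operators

/-! ### Quasi-commutative sequences of fields -/

section QuasiCommutativity

variable {F : Type*} [Field F] {L : Type*} [AddCommGroup L] [Module F L] {m : ℕ}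

theorem opSeries_ext {a b : OpSeries F L} (h : ∀ n v, a.1 n v = b.1 n v) : a = b :=
  Subtype.ext (funext fun n => LinearMap.ext fun v => h n v)

/-- `a(z) ↦ a(cz)` on `ℰ(L)`. -/
def OpSeries.rescale (c : F) (a : OpSeries F L) : OpSeries F L where
  val := QVA.rescale c a.1
  property := by
    intro v
    obtain ⟨N, hN⟩ := a.2 v
    refine ⟨N, fun n hn => ?_⟩
    simp [QVA.rescale, hN n hn]

/-- `a(z) ↦ z^{-d} a(z)` on `ℰ(L)`. -/
def OpSeries.shift (d : ℤ) (a : OpSeries F L) : OpSeries F L where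
  val := fun n => a.1 (n + d)
  property := by
    intro v
    obtain ⟨N, hN⟩ := a.2 v
    exact ⟨N - d, fun n hn => hN _ (by omega)⟩

theorem rescale_rescale (c c' : F) (a : ℤ → Module.End F L) :
    rescale c (rescale c' a) = rescale (c * c') a := by
  funext n
  simp [rescale, smul_smul, mul_zpow]

@[simp] theorem rescale_one (a : ℤ → Module.End F L) : rescale 1 a = a := by
  funext n
  simp [rescale]

theorem rescale_oneField (c : F) : rescale c (oneField F L).1 = (oneField F L).1 := by
  funext n
  by_cases h : n = 0 <;> simp [rescale, oneField, h]

/-- The scaling exponents `E` increase at least as fast as the partial sums of the weights `α`. -/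
def Compatible (E : Fin m → ℤ) (α : Fin m → ℕ) : Prop :=
  ∀ k k' : Fin m, (k' : ℕ) = k + 1 → E k + α k ≤ E k'

/-- Quasi-commutativity of `(a_1(z) ⊗ t^{α_1}, …, a_m(z) ⊗ t^{α_m})`, in a form which does not refer
to the partial sums of the weights: `a_1(z_1 q^{E_1}) ⋯ a_m(z_m q^{E_m})` is regular for all
exponents with `E_{k+1} ≥ E_k + α_k`. Polynomials in `F[z]_0` do not vanish at nonnegative powers
of `q`, which is why it is harmless to enlarge the gaps between the exponents. -/
def QuasiComm (q : F) (a : Fin m → OpSeries F L) (α : Fin m → ℕ) : Prop :=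
  ∀ E, Compatible E α → Regular q (mulDist fun k => rescale (q ^ E k) (a k).1)

theorem QuasiComm.isQuasiCommHom {q : F} {a : Fin m → OpSeries F L} {α : Fin m → ℕ}
    (h : QuasiComm q a α) : IsQuasiCommHom q a α := by
  have hE : Compatible (fun k => ((∑ i : Fin m with i < k, α i : ℕ) : ℤ)) α := by
    intro k k' hk
    have : (Finset.univ.filter fun i => i < k') = insert k (Finset.univ.filter fun i => i < k) := by
      ext i
      simp only [Finset.mem_filter, Finset.mem_univ, true_and, Finset.mem_insert, Fin.lt_def,
        Fin.ext_iff]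
      omega
    change ((∑ i : Fin m with i < k, α i : ℕ) : ℤ) + α k ≤ ((∑ i : Fin m with i < k', α i : ℕ) : ℤ)
    rw [this, Finset.sum_insert (by simp)]
    push_cast
    linarith
  obtain ⟨p, hp, hL⟩ := (h _ hE).exists_admissible
  refine ⟨p, hp, ?_⟩
  simpa only [zpow_natCast] using hL

theorem rescale_update (c : Fin m → F) (a : Fin m → OpSeries F L) (j : Fin m) (x : OpSeries F L) :
    (fun k => rescale (c k) (Function.update a j x k).1)
      = Function.update (fun k => rescale (c k) (a k).1) j (rescale (c j) x.1) := by
  funext k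
  by_cases h : k = j
  · subst h; simp
  · simp [h]

theorem QuasiComm.update_zero (q : F) (a : Fin m → OpSeries F L) (α : Fin m → ℕ) (j : Fin m) :
    QuasiComm q (Function.update a j 0) α := by
  intro E _
  have : (mulDist fun k => rescale (q ^ E k) (Function.update a j 0 k).1) = 0 := by
    funext n
    rw [rescale_update, mulDist_update]
    refine MultilinearMap.map_coord_zero _ j ?_
    rw [Function.update_self]
    exact smul_zero _
  rw [this]
  exact Regular.zero q

theorem QuasiComm.update_add {q : F} {a : Fin m → OpSeries F L} {α : Fin m → ℕ} {j : Fin m}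
    {x y : OpSeries F L} (hx : QuasiComm q (Function.update a j x) α)
    (hy : QuasiComm q (Function.update a j y) α) :
    QuasiComm q (Function.update a j (x + y)) α := by
  intro E hE
  have : (mulDist fun k => rescale (q ^ E k) (Function.update a j (x + y) k).1)
      = (mulDist fun k => rescale (q ^ E k) (Function.update a j x k).1)
        + mulDist fun k => rescale (q ^ E k) (Function.update a j y k).1 := by
    funext n
    rw [Pi.add_apply]
    simp only [rescale_update, mulDist_update]
    rw [← MultilinearMap.map_update_add]
    congr 2
    exact smul_add _ _ _
  rw [this]
  exact (hx E hE).add (hy E hE)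

theorem QuasiComm.update_smul {q : F} {a : Fin m → OpSeries F L} {α : Fin m → ℕ} {j : Fin m}
    {x : OpSeries F L} (hx : QuasiComm q (Function.update a j x) α) (c : F) :
    QuasiComm q (Function.update a j (c • x)) α := by
  intro E hE
  have : (mulDist fun k => rescale (q ^ E k) (Function.update a j (c • x) k).1)
      = c • mulDist fun k => rescale (q ^ E k) (Function.update a j x k).1 := by
    funext n
    rw [Pi.smul_apply]
    simp only [rescale_update, mulDist_update]
    rw [← MultilinearMap.map_update_smul]
    congr 2
    exact smul_comm (_ : F) c (_ : Module.End F L)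
  rw [this]
  exact (hx E hE).smul c

theorem QuasiComm.update_shift {q : F} (hq : q ≠ 0) {a : Fin m → OpSeries F L} {α : Fin m → ℕ}
    (h : QuasiComm q a α) (j : Fin m) (d : ℤ) :
    QuasiComm q (Function.update a j ((a j).shift d)) α := by
  intro E hE
  have : (mulDist fun k => rescale (q ^ E k) (Function.update a j ((a j).shift d) k).1)
      = ((q ^ E j) ^ d)⁻¹ • fun n =>
        mulDist (fun k => rescale (q ^ E k) (a k).1) (n + Pi.single j d) := by
    funext n
    have h1 : (fun k => rescale (q ^ E k) (a k).1 ((n + Pi.single j d : Fin m → ℤ) k))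
        = Function.update (fun k => rescale (q ^ E k) (a k).1 (n k)) j
          (rescale (q ^ E j) (a j).1 (n j + d)) := by
      funext k
      by_cases hk : k = j
      · subst hk; simp
      · simp [hk]
    rw [Pi.smul_apply, rescale_update, mulDist_update, mulDist_apply, h1,
      ← MultilinearMap.map_update_smul]
    congr 2
    change (q ^ E j) ^ n j • (a j).1 (n j + d)
      = ((q ^ E j) ^ d)⁻¹ • (q ^ E j) ^ (n j + d) • (a j).1 (n j + d)
    rw [smul_smul, zpow_add₀ (zpow_ne_zero _ hq), mul_comm, mul_assoc,
      mul_inv_cancel₀ (zpow_ne_zero _ (zpow_ne_zero _ hq)), mul_one]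
  rw [this]
  exact ((h E hE).translate _).smul _

theorem QuasiComm.update_rescale {q : F} (hq : q ≠ 0) {a : Fin m → OpSeries F L} {α : Fin m → ℕ}
    (h : QuasiComm q a α) (j : Fin m) {k r : ℕ} (hkr : k ≤ r) :
    QuasiComm q (Function.update a j ((a j).rescale (q ^ k))) (Function.update α j (α j + r)) := by
  intro E hE
  have hE' : Compatible (Function.update E j (E j + k)) α := by
    intro i i' hi
    have h1 := hE i i' hi
    by_cases h2 : i = j
    · have h3 : i' ≠ j := fun h3 => by subst h2; subst h3; omega
      subst h2
      rw [Function.update_self] at h1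
      rw [Function.update_self, Function.update_of_ne h3]
      push_cast at h1
      omega
    · rw [Function.update_of_ne h2] at h1
      rw [Function.update_of_ne h2]
      by_cases h3 : i' = j
      · subst h3; rw [Function.update_self]; omega
      · rwa [Function.update_of_ne h3]
  have := h _ hE'
  convert this using 3 with i
  by_cases h2 : i = j
  · subst h2
    simp only [Function.update_self]
    change rescale _ (rescale _ _) = _
    rw [rescale_rescale, ← zpow_natCast, ← zpow_add₀ hq]
  · simp only [Function.update_of_ne h2]

theorem QuasiComm.raise {q : F} (hq : q ≠ 0) {a : Fin m → OpSeries F L} {α : Fin m → ℕ}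
    (h : QuasiComm q a α) (j : Fin m) (r : ℕ) :
    QuasiComm q a (Function.update α j (α j + r)) := by
  have := h.update_rescale hq j (Nat.zero_le r)
  rwa [show (a j).rescale (q ^ 0) = a j from Subtype.ext (by
    change rescale _ _ = _
    rw [pow_zero, rescale_one]), Function.update_eq_self] at this

theorem QuasiComm.insert_one {q : F} {a : Fin (m + 1) → OpSeries F L} {α : Fin (m + 1) → ℕ}
    {j : Fin (m + 1)} (ha : a j = oneField F L) (hα : α j = 0)
    (h : QuasiComm q (fun k => a (j.succAbove k)) fun k => α (j.succAbove k)) :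
    QuasiComm q a α := by
  intro E hE
  have hE' : Compatible (fun k => E (j.succAbove k)) fun k => α (j.succAbove k) := by
    intro k k' hk
    rcases lt_trichotomy (k' : ℕ) j with h1 | h1 | h1
    · refine hE _ _ ?_
      rw [Fin.succAbove_of_castSucc_lt j k' (by simpa [Fin.lt_def] using h1),
        Fin.succAbove_of_castSucc_lt j k (by simp [Fin.lt_def]; omega)]
      simpa using hk
    · -- The new variable lies between the two old ones, and has weight `0`.
      refine (hE _ j ?_).trans ?_
      · rw [Fin.succAbove_of_castSucc_lt j k (by simp [Fin.lt_def]; omega), Fin.val_castSucc]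
        omega
      · have := hE j (j.succAbove k') (by
          rw [Fin.succAbove_of_le_castSucc j k' (by simp [Fin.le_def]; omega), Fin.val_succ]
          omega)
        rw [hα] at this
        simpa using this
    · refine hE _ _ ?_
      rw [Fin.succAbove_of_le_castSucc j k' (by simp [Fin.le_def]; omega),
        Fin.succAbove_of_le_castSucc j k (by simp [Fin.le_def]; omega)]
      simpa using hk
  obtain ⟨P, hP, hL⟩ := h _ hE'
  refine ⟨_, mapDomain_mem_regularizers (j.strictMono_succAbove.monotone) (mul_mem hP (one_mem _)),
    fun v => ?_⟩
  obtain ⟨h1, h2⟩ := push_insert_one (b := fun k => rescale (q ^ E k) (a k).1) (j := j)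
    (by simp only [ha, rescale_oneField]) v
  exact (laurent_of_push (hL v) (by rw [one_convMul]; exact h1)
    (by rw [one_convMul, h2, AddMonoidAlgebra.mapDomain_one, one_convMul])).2

end QuasiCommutativity

section Products

variable {F : Type*} [Field F] {L : Type*} [AddCommGroup L] [Module F L] {m : ℕ} {q : F}

theorem push_total_two {M : Type*} [AddCommGroup M] (X : (Fin 2 → ℤ) → M) (n : ℤ) :
    push (total 2) X n = ∑ᶠ i : ℤ, X ![i, n - i] := by
  have hr : (total 2) ⁻¹' {n} = Set.range fun i : ℤ => ![i, n - i] := by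
    ext k
    simp only [Set.mem_preimage, Set.mem_singleton_iff, total_apply, Fin.sum_univ_two,
      Set.mem_range]
    constructor
    · intro h
      refine ⟨k 0, funext fun i => ?_⟩
      fin_cases i
      · rfl
      · change n - k 0 = k 1
        omega
    · rintro ⟨i, rfl⟩
      simp
  rw [push, hr, finsum_mem_range fun i i' h => by simpa using congrFun h 0]

theorem exists_homProduct_eq {r α : ℕ} {a b : OpSeries F L}
    (h : ∃ p, IsAdmissible q p ∧ IsLaurent (productDist q r α p a b)) :
    ∃ p, IsAdmissible q p ∧ ∃ hL : IsLaurent (productDist q r α p a b),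
      homProduct q r α a b = (qFactorial q r)⁻¹ • limDiag _ hL := by
  refine ⟨h.choose, h.choose_spec.1, h.choose_spec.2, ?_⟩
  rw [homProduct, dif_pos h]

/-! ### The `q`-derivation -/

/-- The polynomial `∏_{k<r} (q^{-k} S - 1)`, which for `S : a(z) ↦ a(qz)` gives the `r`-th power of
the `q`-derivation up to the factor `((q - 1) z)^r`. -/
def diffPoly (q : F) (r : ℕ) : Polynomial F :=
  ∏ k ∈ Finset.range r, (Polynomial.C (q ^ k)⁻¹ * Polynomial.X - 1)

theorem natDegree_diffPoly_lt (q : F) (r : ℕ) : (diffPoly q r).natDegree < r + 1 := by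
  refine Nat.lt_succ_of_le ((Polynomial.natDegree_prod_le _ _).trans ?_)
  refine (Finset.sum_le_card_nsmul _ _ 1 fun k _ => ?_).trans (by simp)
  refine (Polynomial.natDegree_sub_le _ _).trans ?_
  simp only [Polynomial.natDegree_one, zero_le, sup_of_le_left]
  exact (Polynomial.natDegree_C_mul_le _ _).trans Polynomial.natDegree_X_le

theorem qDeriv_iterate (hq : q ≠ 0) (r : ℕ) (a : ℤ → Module.End F L) (n : ℤ) :
    (qDeriv q)^[r] a n
      = (((q - 1) ^ r)⁻¹ * (diffPoly q r).eval (q ^ (n + r))) • a (n + r) := by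
  induction r generalizing n with
  | zero => simp [diffPoly]
  | succ r ih =>
    have h1 : (q ^ r)⁻¹ * q ^ (n + 1 + r) = q ^ (n + 1) := by
      rw [zpow_add₀ hq (n + 1) r, zpow_natCast, mul_comm, mul_assoc,
        mul_inv_cancel₀ (pow_ne_zero _ hq), mul_one]
    have h2 : (n + 1 + r : ℤ) = n + (r + 1 : ℕ) := by push_cast; ring
    rw [Function.iterate_succ_apply']
    simp only [qDeriv, rescale]
    have h3 : ∀ (c : F) (Z : Module.End F L), c • Z - Z = (c - 1) • Z := fun c Z => by
      rw [sub_smul, one_smul]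
    rw [ih, h3, smul_smul, smul_smul, ← h2]
    congr 1
    rw [diffPoly, diffPoly, Finset.prod_range_succ, Polynomial.eval_mul, pow_succ, mul_inv]
    simp only [Polynomial.eval_sub, Polynomial.eval_mul, Polynomial.eval_C, Polynomial.eval_X,
      Polynomial.eval_one, h1]
    ring

/-- `(q - 1)^r z^r a^{[r]}(z)` is a linear combination of `a(z), a(qz), …, a(q^r z)`. -/
theorem qDeriv_iterate_eq_sum (hq : q ≠ 0) (r : ℕ) (a : ℤ → Module.End F L) (n : ℤ) :
    (qDeriv q)^[r] a n
      = ((q - 1) ^ r)⁻¹ • ∑ k ∈ Finset.range (r + 1),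
          (diffPoly q r).coeff k • rescale (q ^ k) a (n + r) := by
  rw [qDeriv_iterate hq, Polynomial.eval_eq_sum_range' (natDegree_diffPoly_lt q r), mul_smul,
    Finset.sum_smul]
  congr 1
  refine Finset.sum_congr rfl fun k _ => ?_
  rw [rescale, smul_smul]
  congr 2
  rw [← zpow_natCast, ← zpow_natCast, ← zpow_mul, ← zpow_mul, mul_comm]

theorem mulDist_qDeriv (hq : q ≠ 0) (r : ℕ) (a b : ℤ → Module.End F L) :
    mulDist ![(qDeriv q)^[r] a, b]
      = ((q - 1) ^ r)⁻¹ • ∑ k ∈ Finset.range (r + 1), (diffPoly q r).coeff k •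
          fun n : Fin 2 → ℤ => mulDist ![rescale (q ^ k) a, b] (n + Pi.single 0 (r : ℤ)) := by
  funext n
  rw [mulDist_pair, qDeriv_iterate_eq_sum hq, Pi.smul_apply, Finset.sum_apply, smul_mul_assoc,
    Finset.sum_mul]
  congr 1
  refine Finset.sum_congr rfl fun k _ => ?_
  rw [Pi.smul_apply, mulDist_pair, smul_mul_assoc]
  simp

/-! ### Products of quasi-commutative pairs -/

theorem rescale_pair (c d : F) (a b : OpSeries F L) :
    (fun k : Fin 2 => rescale (![c, d] k) ((![a, b] : Fin 2 → OpSeries F L) k).1)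
      = ![rescale c a.1, rescale d b.1] := by
  funext k
  fin_cases k <;> rfl

theorem QuasiComm.regular_pair {a b : OpSeries F L} {α β : ℕ}
    (h : QuasiComm q ![a, b] ![α, β]) {k e : ℕ} (hk : k + α ≤ e) :
    Regular q (mulDist ![rescale (q ^ k) a.1, rescale (q ^ e) b.1]) := by
  have := h ![(k : ℤ), e] (by
    intro i i' hi
    fin_cases i <;> fin_cases i' <;> simp at hi ⊢
    exact_mod_cast hk)
  rw [← rescale_pair]
  convert this using 3 with i
  fin_cases i <;> simp

theorem QuasiComm.regular_qDeriv (hq : q ≠ 0) {a b : OpSeries F L} {α β : ℕ}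
    (h : QuasiComm q ![a, b] ![α, β]) (r : ℕ) :
    Regular q (mulDist ![(qDeriv q)^[r] a.1, rescale (q ^ (α + r)) b.1]) := by
  rw [mulDist_qDeriv hq]
  refine Regular.smul ?_ _
  refine Finset.sum_induction _ (Regular q) (fun _ _ => Regular.add) (Regular.zero q) ?_
  intro k hk
  have hk' : k ≤ r := Nat.lt_succ_iff.1 (Finset.mem_range.1 hk)
  exact ((h.regular_pair (by omega)).translate _).smul _

theorem QuasiComm.exists_productDist (hq : q ≠ 0) {a b : OpSeries F L} {α β : ℕ}
    (h : QuasiComm q ![a, b] ![α, β]) (r : ℕ) :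
    ∃ p, IsAdmissible q p ∧ IsLaurent (productDist q r α p a b) :=
  (h.regular_qDeriv hq r).exists_admissible_pair

/-- The defining property of the product, independent of the choice of the polynomial `p`. -/
theorem hasDiagonal_homProduct {r α : ℕ} {a b : OpSeries F L} (hr : qFactorial q r ≠ 0)
    (h : ∃ p, IsAdmissible q p ∧ IsLaurent (productDist q r α p a b)) (v : L) :
    HasDiagonal q (fun n => mulDist ![(qDeriv q)^[r] a.1, rescale (q ^ (α + r)) b.1] n v)
      (fun n => qFactorial q r • (homProduct q r α a b).1 n v) := by
  obtain ⟨p, hp, hL, he⟩ := exists_homProduct_eq h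
  have h1 : (fun n => laurentMul (ratioPoly F p 0 1)
        (mulDist ![(qDeriv q)^[r] a.1, rescale (q ^ (α + r)) b.1]) n v)
      = convMul (ratioPoly F p 0 1)
        fun n => mulDist ![(qDeriv q)^[r] a.1, rescale (q ^ (α + r)) b.1] n v :=
    funext fun n => laurentMul_apply _ _ _ _
  refine ⟨ratioPoly F p 0 1, ratioPoly_mem_regularizers hp.2 (by simp), ?_, ?_⟩
  · rw [← h1]
    exact hL v
  · rw [augmentation_ratioPoly, hp.1, one_smul, ← h1]
    funext n
    rw [push_total_two, he]
    change _ = qFactorial q r • (qFactorial q r)⁻¹ • (limDiag _ hL).1 n v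
    rw [smul_inv_smul₀ hr]
    rfl

theorem qFactorial_zero (q : F) : qFactorial q 0 = 1 := by simp [qFactorial]

/-- Adjacent fields in a product can be replaced by their product: the general form of the merging
of variables, with the scalings which occur for fields `a(z) ⊗ t^α`. -/
theorem push_homProduct (hq : q ≠ 0) {a : Fin (m + 2) → OpSeries F L}
    {a' : Fin (m + 1) → OpSeries F L} {E : Fin (m + 2) → ℤ} {E' : Fin (m + 1) → ℤ}
    {j : Fin (m + 1)} {e : ℕ} (ha : ∀ k, k ≠ j → a' k = a (j.castSucc.succAbove k))
    (hE : ∀ k, k ≠ j → E' k = E (j.castSucc.succAbove k)) (hEj : E j.castSucc = E' j)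
    (hEj' : E j.succ = E' j + e)
    (haj : a' j = homProduct q 0 e (a j.castSucc) (a j.succ))
    (h : ∃ p, IsAdmissible q p ∧ IsLaurent (productDist q 0 e p (a j.castSucc) (a j.succ))) :
    ∃ P ∈ regularizers q (m + 2), AddMonoidAlgebra.mapDomain (varMap j.predAbove) P = 1 ∧ ∀ v,
      FibreFinite (varMap j.predAbove)
        (convMul P fun n => mulDist (fun k => rescale (q ^ E k) (a k).1) n v) ∧
      push (varMap j.predAbove)
        (convMul P fun n => mulDist (fun k => rescale (q ^ E k) (a k).1) n v)
        = fun n => mulDist (fun k => rescale (q ^ E' k) (a' k).1) n v := by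
  obtain ⟨p, hp, hL, he⟩ := exists_homProduct_eq h
  set c := q ^ E' j with hc
  have hc0 : c ≠ 0 := zpow_ne_zero _ hq
  -- Both factors are scaled by `c`, apart from the factor `q^e` in the definition of the product.
  have hs : laurentMul (ratioPoly F p 0 1)
      (mulDist ![rescale (q ^ E j.castSucc) (a j.castSucc).1, rescale (q ^ E j.succ) (a j.succ).1])
      = fun n => c ^ (n 0 + n 1) • productDist q 0 e p (a j.castSucc) (a j.succ) n := by
    funext n
    refine LinearMap.ext fun v => ?_
    rw [LinearMap.smul_apply, productDist, laurentMul_apply, laurentMul_apply, ratioPoly_convMul,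
      ratioPoly_convMul, Polynomial.sum, Polynomial.sum, Finset.smul_sum]
    refine Finset.sum_congr rfl fun d _ => ?_
    rw [smul_comm (c ^ _)]
    congr 1
    rw [mulDist_pair, mulDist_pair, hEj, hEj', zpow_add₀ hq, zpow_natCast, ← rescale_rescale,
      Function.iterate_zero, id, Nat.add_zero e]
    set n' := n - d • ((Pi.single 1 1 : Fin 2 → ℤ) - Pi.single 0 1) with hn'
    have : n 0 + n 1 = n' 0 + n' 1 := by
      rw [hn']
      simp
    rw [this, zpow_add₀ hc0, rescale, ← hc, rescale, smul_mul_smul_comm]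
    rfl
  refine ⟨ratioPoly F p j.castSucc j.succ,
    ratioPoly_mem_regularizers hp.2 (Fin.castSucc_lt_succ).le, ?_, ?_⟩
  · rw [mapDomain_ratioPoly, Fin.predAbove_castSucc_self, Fin.predAbove_succ_self, ratioPoly_self,
      hp.1, map_one]
  · refine push_merge (fun k hk => by rw [ha k hk, hE k hk]) ?_ ?_
    · rw [hs]
      intro v
      exact Laurent.smul (X := fun n => productDist q 0 e p (a j.castSucc) (a j.succ) n v) (hL v) _
    · intro n v
      rw [hs]
      simp only [haj, he, ← hc, qFactorial_zero, inv_one, one_smul]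
      change c ^ n • (∑ᶠ i : ℤ,
        productDist q 0 e p (a j.castSucc) (a j.succ) ![i, n - i] v) = _
      rw [smul_finsum' _ (finite_antidiagonal_support hL n v)]
      refine finsum_congr fun i => ?_
      simp

theorem QuasiComm.merge_zero (hq : q ≠ 0) {a : Fin (m + 2) → OpSeries F L}
    {a' : Fin (m + 1) → OpSeries F L} {α : Fin (m + 2) → ℕ} {α' : Fin (m + 1) → ℕ}
    {j : Fin (m + 1)} (ha : ∀ k, k ≠ j → a' k = a (j.castSucc.succAbove k))
    (hα : ∀ k, k ≠ j → α' k = α (j.castSucc.succAbove k))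
    (haj : a' j = homProduct q 0 (α j.castSucc) (a j.castSucc) (a j.succ))
    (hαj : α' j = α j.castSucc + α j.succ)
    (hp : QuasiComm q ![a j.castSucc, a j.succ] ![α j.castSucc, α j.succ])
    (h : QuasiComm q a α) : QuasiComm q a' α' := by
  intro E' hE'
  set E : Fin (m + 2) → ℤ := fun i => E' (j.predAbove i) + if i = j.succ then α j.castSucc else 0
  obtain ⟨P, hP, hP1, hPv⟩ := push_homProduct hq (E := E) (E' := E') ha
    (fun k hk => by
      have : j.castSucc.succAbove k ≠ j.succ := fun h => hk (by
        rw [← Fin.succAbove_castSucc_self] at h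
        exact Fin.succAbove_right_injective h)
      simp [E, this])
    (by simp [E, Fin.castSucc_lt_succ.ne])
    (by simp [E]) haj (hp.exists_productDist hq 0)
  have hE : Compatible E α := by
    intro k k' hk
    rcases lt_or_ge (j : ℕ) k with h1 | h1
    · have hk1 : j.predAbove k = k.pred (by rintro rfl; simp at h1) :=
        Fin.predAbove_of_castSucc_lt j k (by simpa [Fin.lt_def] using h1)
      have hk2 : j.predAbove k' = k'.pred (by rintro rfl; simp at hk) :=
        Fin.predAbove_of_castSucc_lt j k' (by simp [Fin.lt_def]; omega)
      have h2 := hE' (j.predAbove k) (j.predAbove k') (by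
        rw [hk1, hk2, Fin.val_pred, Fin.val_pred]; omega)
      have h3 : k' ≠ j.succ := fun h3 => by rw [h3, Fin.val_succ] at hk; omega
      by_cases h4 : k = j.succ
      · subst h4
        rw [Fin.predAbove_succ_self, hαj] at h2
        simp only [E, h3, Fin.predAbove_succ_self, if_true, if_false]
        push_cast at h2
        linarith
      · have h5 : α' (j.predAbove k) = α k := by
          have h6 : (k : ℕ) ≠ j + 1 := fun h6 => h4 (Fin.ext (by simpa using h6))
          rw [hα _ (fun h7 => by
            rw [hk1, Fin.ext_iff, Fin.val_pred] at h7; omega), hk1,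
            Fin.succAbove_of_le_castSucc _ _ (by simp [Fin.le_def]; omega), Fin.succ_pred]
        rw [h5] at h2
        simpa only [E, h3, h4, if_false, add_zero, Nat.cast_zero] using h2
    · have hk1 : j.predAbove k = k.castPred (by rintro rfl; simp at h1; omega) :=
        Fin.predAbove_of_le_castSucc j k (by simpa [Fin.le_def] using h1)
      have h4 : k ≠ j.succ := fun h3 => by rw [h3, Fin.val_succ] at h1; omega
      rcases h1.lt_or_eq with h1 | h1
      · have hk2 : j.predAbove k' = k'.castPred (by rintro rfl; simp at hk; omega) :=
          Fin.predAbove_of_le_castSucc j k' (by simp [Fin.le_def]; omega)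
        have h3 : k' ≠ j.succ := fun h3 => by rw [h3, Fin.val_succ] at hk; omega
        have h2 := hE' (j.predAbove k) (j.predAbove k') (by
          rw [hk1, hk2, Fin.coe_castPred, Fin.coe_castPred]; omega)
        have h5 : α' (j.predAbove k) = α k := by
          rw [hα _ (fun h7 => by
            rw [hk1, Fin.ext_iff, Fin.coe_castPred] at h7; omega), hk1,
            Fin.succAbove_of_castSucc_lt _ _ (by simp [Fin.lt_def]; omega), Fin.castSucc_castPred]
        rw [h5] at h2
        simpa only [E, h3, h4, if_false, add_zero, Nat.cast_zero] using h2
      · have h5 : k = j.castSucc := Fin.ext (by simpa using h1)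
        have h6 : k' = j.succ := Fin.ext (by rw [Fin.val_succ, hk, h1])
        subst h5 h6
        simp [E, Fin.castSucc_lt_succ.ne]
  obtain ⟨Q, hQ, hL⟩ := h E hE
  refine ⟨_, mapDomain_mem_regularizers (Fin.predAbove_right_monotone j) (mul_mem hQ hP),
    fun v => ?_⟩
  exact (laurent_of_push (hL v) (hPv v).1 (by rw [(hPv v).2, hP1, one_convMul])).2

end Products

/-! ### Identities for `q`-numbers -/

section QuantumIdentities

variable {F : Type*} [Field F] {q : F}

theorem qInt_zero (q : F) : qInt q 0 = 0 := by simp [qInt]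

theorem qInt_natCast_ne_zero (hq1 : ∀ n : ℕ, 0 < n → q ^ n ≠ 1) {n : ℕ} (hn : 0 < n) :
    qInt q n ≠ 0 := by
  rw [qInt, zpow_natCast]
  exact div_ne_zero (sub_ne_zero.2 (hq1 n hn)) (sub_ne_zero.2 (by simpa using hq1 1 one_pos))

theorem qInt_add (hq1 : q ≠ 1) (l k : ℕ) : qInt q ((l + k : ℕ) : ℤ) = qInt q l + q ^ l * qInt q k := by
  have : q - 1 ≠ 0 := sub_ne_zero.2 hq1
  simp only [qInt, zpow_natCast]
  field_simp
  ring

theorem qFactorial_succ (q : F) (l : ℕ) :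
    qFactorial q (l + 1) = qFactorial q l * qInt q ((l + 1 : ℕ) : ℤ) := by
  rw [qFactorial, Finset.prod_range_succ]
  push_cast
  rfl

theorem qFactorial_ne_zero (hq1 : ∀ n : ℕ, 0 < n → q ^ n ≠ 1) (l : ℕ) : qFactorial q l ≠ 0 :=
  Finset.prod_ne_zero_iff.2 fun k _ => by exact_mod_cast qInt_natCast_ne_zero hq1 k.succ_pos

theorem qInt_mul_inv_qFactorial (hq1 : ∀ n : ℕ, 0 < n → q ^ n ≠ 1) (l : ℕ) :
    qInt q ((l + 1 : ℕ) : ℤ) * (qFactorial q (l + 1))⁻¹ = (qFactorial q l)⁻¹ := by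
  have := qInt_natCast_ne_zero hq1 l.succ_pos
  rw [qFactorial_succ, mul_inv, mul_comm, mul_assoc, inv_mul_cancel₀ this, mul_one]

theorem qBinom_mul (hq1 : ∀ n : ℕ, 0 < n → q ^ n ≠ 1) (i l : ℕ) :
    qBinom q ((i : ℤ) + l) l * (qFactorial q (i + l))⁻¹
      = (qFactorial q i)⁻¹ * (qFactorial q l)⁻¹ := by
  have h : qFactorial q (i + l) = qFactorial q i * ∏ k ∈ Finset.range l, qInt q ((i : ℤ) + l - k) := by
    rw [qFactorial, Finset.prod_range_add, ← qFactorial, ← Finset.prod_range_reflect]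
    congr 1
    refine Finset.prod_congr rfl fun k hk => ?_
    have := Finset.mem_range.1 hk
    congr 1
    omega
  have h1 := qFactorial_ne_zero hq1 (i + l)
  rw [h] at h1
  rw [qBinom, h, mul_inv, div_eq_mul_inv]
  have h2 := right_ne_zero_of_mul h1
  field_simp

theorem aeval_diffPoly_succ {R : Type*} [CommRing R] [Algebra F R] (x : R) (r : ℕ) :
    Polynomial.aeval x (diffPoly q (r + 1))
      = Polynomial.aeval x (diffPoly q r) * ((q ^ r)⁻¹ • x - 1) := by
  rw [diffPoly, Finset.prod_range_succ, map_mul, ← diffPoly]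
  simp [Algebra.smul_def]

theorem aeval_diffPoly_add {R : Type*} [CommRing R] [Algebra F R] (x : R) (i l : ℕ) :
    Polynomial.aeval x (diffPoly q (i + l))
      = Polynomial.aeval x (diffPoly q i) * Polynomial.aeval ((q ^ i)⁻¹ • x) (diffPoly q l) := by
  induction l with
  | zero => simp [diffPoly]
  | succ l ih =>
    rw [← add_assoc, aeval_diffPoly_succ, ih, aeval_diffPoly_succ, smul_smul, mul_assoc, pow_add,
      mul_inv, mul_comm (q ^ l)⁻¹]

/-- The `q`-Leibniz rule in polynomial form: `x` and `y` stand for the scalings of the two factors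
of a product, so that `x y` is the scaling of the product. -/
theorem aeval_mul_diffPoly (hq : q ≠ 0) (hq1 : ∀ n : ℕ, 0 < n → q ^ n ≠ 1) {R : Type*} [CommRing R]
    [Algebra F R] (x y : R) (j : ℕ) :
    (qFactorial q j)⁻¹ • Polynomial.aeval (x * y) (diffPoly q j)
      = ∑ lk ∈ Finset.HasAntidiagonal.antidiagonal j,
          ((qFactorial q lk.1)⁻¹ * (qFactorial q lk.2)⁻¹ * (q ^ (lk.1 * lk.2))⁻¹) •
            (Polynomial.aeval x (diffPoly q lk.1) * y ^ lk.1
              * Polynomial.aeval y (diffPoly q lk.2)) := by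
  induction j with
  | zero => simp [diffPoly, qFactorial_zero]
  | succ j ih =>
    have hj := qInt_natCast_ne_zero hq1 j.succ_pos
    refine smul_right_injective R hj ?_
    change qInt q ((j + 1 : ℕ) : ℤ) • _ = qInt q ((j + 1 : ℕ) : ℤ) • _
    rw [smul_smul, qInt_mul_inv_qFactorial hq1, aeval_diffPoly_succ, ← smul_mul_assoc, ih,
      Finset.smul_sum]
    set G : ℕ → ℕ → R := fun l k => Polynomial.aeval x (diffPoly q l) * y ^ l
      * Polynomial.aeval y (diffPoly q k) with hG
    -- Split `[j + 1] = [l] + q^l [k]` for `l + k = j + 1`.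
    have h1 : ∑ lk ∈ Finset.HasAntidiagonal.antidiagonal (j + 1), qInt q ((j + 1 : ℕ) : ℤ) •
          ((qFactorial q lk.1)⁻¹ * (qFactorial q lk.2)⁻¹ * (q ^ (lk.1 * lk.2))⁻¹) • G lk.1 lk.2
        = ∑ lk ∈ Finset.HasAntidiagonal.antidiagonal (j + 1), (qInt q lk.1 *
            ((qFactorial q lk.1)⁻¹ * (qFactorial q lk.2)⁻¹ * (q ^ (lk.1 * lk.2))⁻¹)) • G lk.1 lk.2
          + ∑ lk ∈ Finset.HasAntidiagonal.antidiagonal (j + 1), (q ^ lk.1 * qInt q lk.2 *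
            ((qFactorial q lk.1)⁻¹ * (qFactorial q lk.2)⁻¹ * (q ^ (lk.1 * lk.2))⁻¹)) •
              G lk.1 lk.2 := by
      rw [← Finset.sum_add_distrib]
      refine Finset.sum_congr rfl fun lk hlk => ?_
      rw [← add_smul, ← add_mul, ← qInt_add (by simpa using hq1 1 one_pos),
        Finset.HasAntidiagonal.mem_antidiagonal.1 hlk, smul_smul]
    rw [h1, Finset.Nat.sum_antidiagonal_succ, Finset.Nat.sum_antidiagonal_succ', Nat.cast_zero,
      qInt_zero, zero_mul, zero_smul, zero_add, mul_zero, zero_mul, zero_smul, zero_add,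
      ← Finset.sum_add_distrib, Finset.sum_mul]
    refine Finset.sum_congr rfl fun lk hlk => ?_
    obtain ⟨l, k⟩ := lk
    have hlk : l + k = j := Finset.HasAntidiagonal.mem_antidiagonal.1 hlk
    subst hlk
    dsimp only
    have h2 : G l k * ((q ^ (l + k))⁻¹ • (x * y) - 1)
        = (q ^ k)⁻¹ • G (l + 1) k + G l (k + 1) := by
      simp only [hG]
      rw [aeval_diffPoly_succ, aeval_diffPoly_succ, pow_add, mul_inv]
      simp only [Algebra.smul_def, map_mul]
      ring
    rw [smul_mul_assoc, h2, smul_add, smul_smul]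
    have h3 := qInt_mul_inv_qFactorial hq1 l
    have h4 := qInt_mul_inv_qFactorial hq1 k
    congr 2
    · rw [← h3]
      field_simp
      ring
    · rw [← h4]
      field_simp
      ring

/-- The linear map taking the monomial `s_1^{k_1} s_2^{k_2}` to `T k_1 k_2`. -/
def monomialEval {M : Type*} [AddCommGroup M] [Module F M] (T : ℕ → ℕ → M) :
    AddMonoidAlgebra F (ℕ × ℕ) →ₗ[F] M :=
  (Finsupp.linearCombination F fun k : ℕ × ℕ => T k.1 k.2).comp
    (AddMonoidAlgebra.coeffLinearEquiv F).toLinearMap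

theorem monomialEval_single {M : Type*} [AddCommGroup M] [Module F M] (T : ℕ → ℕ → M)
    (k l : ℕ) (c : F) : monomialEval T (AddMonoidAlgebra.single (k, l) c) = c • T k l :=
  Finsupp.linearCombination_single F c (k, l)

/-- The identity behind the associativity of the products: the left side describes
`(a_{-i-1} b)_{-j-1} c`, the right side the `a_{-i-l-1} (b_{-k-1} c)`, where `T k₁ k₂` stands for
the product of `a`, `b` and `c` with additional scalings `q^{k₁}` of `a` and `q^{k₂}` of `b`. -/
theorem sum_diffPoly_assoc (hq : q ≠ 0) (hq1 : ∀ n : ℕ, 0 < n → q ^ n ≠ 1) {M : Type*}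
    [AddCommGroup M] [Module F M] (T : ℕ → ℕ → M) (i j : ℕ) :
    (qFactorial q j)⁻¹ • ∑ k ∈ Finset.range (j + 1), ∑ k' ∈ Finset.range (i + 1),
        ((diffPoly q j).coeff k * ((q ^ (k * i))⁻¹ * (diffPoly q i).coeff k')) • T (k + k') k
      = ∑ lk ∈ Finset.HasAntidiagonal.antidiagonal j,
          ((qFactorial q lk.1)⁻¹ * (qFactorial q lk.2)⁻¹ * (q ^ (lk.1 * lk.2))⁻¹) •
            ∑ k ∈ Finset.range (i + lk.1 + 1), ∑ k' ∈ Finset.range (lk.2 + 1),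
              ((diffPoly q (i + lk.1)).coeff k * (diffPoly q lk.2).coeff k') • T k (lk.1 + k') := by
  set s₁ : AddMonoidAlgebra F (ℕ × ℕ) := AddMonoidAlgebra.single (1, 0) 1 with hs₁
  set s₂ : AddMonoidAlgebra F (ℕ × ℕ) := AddMonoidAlgebra.single (0, 1) 1 with hs₂
  have hs : ∀ k l : ℕ, s₁ ^ k * s₂ ^ l = AddMonoidAlgebra.single (k, l) 1 := fun k l => by
    simp [hs₁, hs₂, AddMonoidAlgebra.single_pow, AddMonoidAlgebra.single_mul_single]
  have haeval : ∀ (r : ℕ) (s : AddMonoidAlgebra F (ℕ × ℕ)), Polynomial.aeval s (diffPoly q r)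
      = ∑ k ∈ Finset.range (r + 1), (diffPoly q r).coeff k • s ^ k := fun r s =>
    Polynomial.aeval_eq_sum_range' (natDegree_diffPoly_lt q r) s
  have key := aeval_mul_diffPoly hq hq1 ((q ^ i)⁻¹ • s₁) s₂ j
  replace key := congrArg (fun P => monomialEval T (Polynomial.aeval s₁ (diffPoly q i) * P)) key
  simp only [mul_smul_comm, map_smul, Finset.mul_sum, map_sum] at key
  convert key using 2 with lk hlk
  · rw [haeval, haeval, mul_comm, Finset.sum_mul, map_sum]
    refine Finset.sum_congr rfl fun k _ => ?_
    rw [Finset.mul_sum, map_sum]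
    refine Finset.sum_congr rfl fun k' _ => ?_
    rw [smul_mul_assoc, mul_pow, smul_pow, smul_mul_assoc, smul_mul_assoc, mul_smul_comm,
      show s₁ ^ k * s₂ ^ k * s₁ ^ k' = s₁ ^ (k + k') * s₂ ^ k by ring, hs, map_smul, map_smul,
      map_smul, monomialEval_single, one_smul, smul_smul, smul_smul, inv_pow, ← pow_mul,
      mul_comm i k, mul_assoc]
  · rw [show ∀ A B C D : AddMonoidAlgebra F (ℕ × ℕ), A * (B * C * D) = A * B * (C * D) from
      fun A B C D => by ring, ← aeval_diffPoly_add, haeval, haeval, Finset.sum_mul, map_sum]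
    congr 1
    refine Finset.sum_congr rfl fun k _ => ?_
    rw [Finset.mul_sum, Finset.mul_sum, map_sum]
    refine Finset.sum_congr rfl fun k' _ => ?_
    rw [mul_smul_comm, smul_mul_smul_comm, ← pow_add, hs, map_smul, monomialEval_single, one_smul]

end QuantumIdentities

/-! ### Products of fields as diagonal values -/

section Associativity

variable {F : Type*} [Field F] {L : Type*} [AddCommGroup L] [Module F L] {m : ℕ} {q : F}

/-- The coefficient of `z^n` of a field, applied to a vector. -/
def OpSeries.eval (n : ℤ) (v : L) : OpSeries F L →ₗ[F] L where
  toFun a := a.1 n v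
  map_add' _ _ := rfl
  map_smul' _ _ := rfl

theorem OpSeries.eval_apply (n : ℤ) (v : L) (a : OpSeries F L) : a.1 n v = OpSeries.eval n v a :=
  rfl

theorem mulDist_pair_apply (a b : ℤ → Module.End F L) (v : L) (n : Fin 2 → ℤ) :
    mulDist ![a, b] n v = a (n 0) (b (n 1) v) := by
  rw [mulDist_pair]; rfl

/-- The product `(a ⊗ t^α)_{-r-1} (b ⊗ t^β)` in terms of the products without derivatives:
`g k` is the product of `a(q^k z)` and `b(q^{α+r} z)`. -/
theorem homProduct_apply (hq : q ≠ 0) (hq1 : ∀ n : ℕ, 0 < n → q ^ n ≠ 1) {a b : OpSeries F L}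
    {α β r : ℕ} (h : QuasiComm q ![a, b] ![α, β]) {v : L} {g : ℕ → ℤ → L}
    (hg : ∀ k ≤ r, HasDiagonal q
      (fun n => mulDist ![rescale (q ^ k) a.1, rescale (q ^ (α + r)) b.1] n v) (g k)) (n : ℤ) :
    (homProduct q r α a b).1 n v = ((qFactorial q r)⁻¹ * ((q - 1) ^ r)⁻¹) •
      ∑ k ∈ Finset.range (r + 1), (diffPoly q r).coeff k • g k (n + r) := by
  have hr := qFactorial_ne_zero hq1 r
  have h1 := hasDiagonal_homProduct hr (h.exists_productDist hq r) v
  have h2 : HasDiagonal q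
      (((q - 1) ^ r)⁻¹ • ∑ k ∈ Finset.range (r + 1), (diffPoly q r).coeff k •
        fun n : Fin 2 → ℤ => mulDist ![rescale (q ^ k) a.1, rescale (q ^ (α + r)) b.1]
          (n + Pi.single 0 (r : ℤ)) v)
      (((q - 1) ^ r)⁻¹ • ∑ k ∈ Finset.range (r + 1), (diffPoly q r).coeff k •
        fun n => g k (n + total 2 (Pi.single 0 (r : ℤ)))) :=
    (HasDiagonal.sum _ fun k hk =>
      ((hg k (Nat.lt_succ_iff.1 (Finset.mem_range.1 hk))).translate _).smul _).smul _
  rw [mulDist_qDeriv hq] at h1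
  have h3 := h1.unique (by
    convert h2 using 1
    funext n
    simp only [Pi.smul_apply, Finset.sum_apply, LinearMap.smul_apply, LinearMap.sum_apply])
  have h4 := congrFun h3 n
  rw [mul_smul, ← inv_smul_smul₀ hr ((homProduct q r α a b).1 n v)]
  congr 1
  refine h4.trans ?_
  simp [total_apply]

theorem hasDiagonal_single (c : OpSeries F L) (v : L) :
    HasDiagonal q (fun n : Fin 1 → ℤ => mulDist (fun _ => c.1) n v) (fun n => c.1 n v) := by
  have h : (fun n : Fin 1 → ℤ => mulDist (fun _ => c.1) n v) = fun n => c.1 (n 0) v := by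
    funext n
    simp [mulDist]
  rw [h]
  refine ⟨1, one_mem _, ?_, ?_⟩
  · rw [one_convMul]
    obtain ⟨N, hN⟩ := c.2 v
    refine ⟨N, fun n ⟨i, hi⟩ => ?_⟩
    rw [Fin.fin_one_eq_zero i] at hi
    have := hN _ hi
    exact this
  · rw [one_convMul, map_one, one_smul]
    funext n
    have : (total 1) ⁻¹' {n} = {fun _ => n} := by
      ext k
      simp only [Set.mem_preimage, Set.mem_singleton_iff, total_apply, Fin.sum_univ_one]
      constructor
      · rintro rfl
        funext i
        rw [Fin.fin_one_eq_zero i]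
      · rintro rfl
        rfl
    rw [push, this, finsum_mem_singleton]

/-- Transfer of diagonal values along the replacement of two adjacent fields by their product. -/
theorem HasDiagonal.merge (hq : q ≠ 0) {a : Fin (m + 2) → OpSeries F L}
    {a' : Fin (m + 1) → OpSeries F L} {E : Fin (m + 2) → ℤ} {E' : Fin (m + 1) → ℤ}
    (j : Fin (m + 1)) {e : ℕ} (ha : ∀ k, k ≠ j → a' k = a (j.castSucc.succAbove k))
    (hE : ∀ k, k ≠ j → E' k = E (j.castSucc.succAbove k)) (hEj : E j.castSucc = E' j)
    (hEj' : E j.succ = E' j + e)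
    (haj : a' j = homProduct q 0 e (a j.castSucc) (a j.succ))
    (h : ∃ p, IsAdmissible q p ∧ IsLaurent (productDist q 0 e p (a j.castSucc) (a j.succ)))
    {v : L} {f : ℤ → L}
    (hf : HasDiagonal q (fun n => mulDist (fun k => rescale (q ^ E k) (a k).1) n v) f) :
    HasDiagonal q (fun n => mulDist (fun k => rescale (q ^ E' k) (a' k).1) n v) f := by
  obtain ⟨P, hP, hP1, hPv⟩ := push_homProduct hq ha hE hEj hEj' haj h
  exact hf.of_push (Fin.predAbove_right_monotone j) hP (hPv v).1
    (by rw [(hPv v).2, hP1, one_convMul])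

/-- Raising the weight of the first field of a pair preserves quasi-commutativity. -/
theorem QuasiComm.exists_productDist_zero (hq : q ≠ 0) {a b : OpSeries F L} {α β : ℕ}
    (h : QuasiComm q ![a, b] ![α, β]) (s : ℕ) :
    ∃ p, IsAdmissible q p ∧ IsLaurent (productDist q 0 (α + s) p a b) := by
  have := h.raise hq 0 s
  rw [show Function.update ![α, β] 0 ((![α, β] : Fin 2 → ℕ) 0 + s) = ![α + s, β] by
    funext i; fin_cases i <;> simp] at this
  exact this.exists_productDist hq 0

/-- Every product is a combination of products without derivatives. -/
theorem homProduct_eq_sum (hq : q ≠ 0) (hq1 : ∀ n : ℕ, 0 < n → q ^ n ≠ 1) {a b : OpSeries F L}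
    {α β : ℕ} (h : QuasiComm q ![a, b] ![α, β]) (r : ℕ) :
    homProduct q r α a b = ((qFactorial q r)⁻¹ * ((q - 1) ^ r)⁻¹) •
      ∑ k ∈ Finset.range (r + 1), (diffPoly q r).coeff k •
        ((homProduct q 0 (α + (r - k)) a b).rescale (q ^ k)).shift r := by
  refine opSeries_ext fun n v => ?_
  rw [homProduct_apply hq hq1 h
    (g := fun k n => ((homProduct q 0 (α + (r - k)) a b).rescale (q ^ k)).1 n v) (fun k hk => ?_)]
  · rw [OpSeries.eval_apply n v (_ • _), map_smul, map_sum]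
    simp only [map_smul]
    rfl
  · obtain ⟨f, hf⟩ := (h.regular_pair (k := k) (e := α + r) (by omega)).exists_hasDiagonal v
    rw [← rescale_pair] at hf
    have h1 := HasDiagonal.merge hq (m := 0) (a := ![a, b]) (E := ![(k : ℤ), (α + r : ℕ)])
      (a' := ![homProduct q 0 (α + (r - k)) a b]) (E' := ![(k : ℤ)]) 0
      (e := α + (r - k)) (fun i hi => (hi (Fin.fin_one_eq_zero i)).elim)
      (fun i hi => (hi (Fin.fin_one_eq_zero i)).elim) rfl
      (by simp; omega) rfl (h.exists_productDist_zero hq (r - k)) (v := v) (f := f)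
      (by
        convert hf using 5 with n i
        fin_cases i
        exacts [congrArg (rescale · _) (zpow_natCast _ _), congrArg (rescale · _) (zpow_natCast _ _)])
    have h2 := hasDiagonal_single (q := q) ((homProduct q 0 (α + (r - k)) a b).rescale (q ^ k)) v
    have h3 := h1.unique (g := fun n => ((homProduct q 0 (α + (r - k)) a b).rescale (q ^ k)).1 n v)
      (by
        convert h2 using 4 with n
        funext i
        rw [Fin.fin_one_eq_zero i]
        exact congrArg (rescale · _) (zpow_natCast _ _))
    rw [← h3, ← rescale_pair]
    exact hf

end Associativity

/-! ### Associativity of the products -/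

section Associativity

variable {F : Type*} [Field F] {L : Type*} [AddCommGroup L] [Module F L] {q : F}

theorem rescale_combination (hq : q ≠ 0) {x : OpSeries F L} {y : ℕ → OpSeries F L} {C : F}
    {d : ℕ → F} {i : ℕ} (hx : x = C • ∑ k ∈ Finset.range (i + 1),
      d k • ((y k).rescale (q ^ k)).shift i) (s : ℕ) (n : ℤ) :
    rescale (q ^ s) x.1 n = C • ∑ k ∈ Finset.range (i + 1),
      (d k * (q ^ (s * i))⁻¹) • rescale (q ^ (s + k)) (y k).1 (n + i) := by
  refine LinearMap.ext fun v => ?_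
  have h1 : rescale (q ^ s) x.1 n v = (q ^ s) ^ n • OpSeries.eval n v x := rfl
  rw [h1, hx, map_smul, map_sum, smul_comm, LinearMap.smul_apply, LinearMap.sum_apply,
    Finset.smul_sum]
  congr 1
  refine Finset.sum_congr rfl fun k _ => ?_
  rw [map_smul, LinearMap.smul_apply]
  change (q ^ s) ^ n • d k • (q ^ k) ^ (n + i) • (y k).1 (n + i) v
    = (d k * (q ^ (s * i))⁻¹) • (q ^ (s + k)) ^ (n + i) • (y k).1 (n + i) v
  simp only [smul_smul]
  congr 1
  have h2 : (q ^ s) ^ n = (q ^ (s * i))⁻¹ * (q ^ s) ^ (n + i) := by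
    rw [zpow_add₀ (pow_ne_zero _ hq), zpow_natCast, ← pow_mul, mul_comm ((q ^ s) ^ n), ← mul_assoc,
      inv_mul_cancel₀ (pow_ne_zero _ hq), one_mul]
  rw [h2, pow_add, mul_zpow]
  ring

theorem HasDiagonal.pair_left (hq : q ≠ 0) {x : OpSeries F L} {y : ℕ → OpSeries F L} {C : F}
    {d : ℕ → F} {i : ℕ} (hx : x = C • ∑ k ∈ Finset.range (i + 1),
      d k • ((y k).rescale (q ^ k)).shift i) {s : ℕ} {w : ℤ → Module.End F L} {v : L}
    {g : ℕ → ℤ → L} (hg : ∀ k ≤ i, HasDiagonal q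
      (fun n => mulDist ![rescale (q ^ (s + k)) (y k).1, w] n v) (g k)) :
    HasDiagonal q (fun n => mulDist ![rescale (q ^ s) x.1, w] n v)
      (fun n => C • ∑ k ∈ Finset.range (i + 1), (d k * (q ^ (s * i))⁻¹) • g k (n + i)) := by
  have h := (HasDiagonal.sum (Finset.range (i + 1)) fun k hk =>
    ((hg k (Nat.lt_succ_iff.1 (Finset.mem_range.1 hk))).translate (Pi.single 0 (i : ℤ))).smul
      (d k * (q ^ (s * i))⁻¹)).smul C
  convert h using 1
  · funext n
    rw [mulDist_pair_apply, rescale_combination hq hx]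
    simp only [Pi.smul_apply, Finset.sum_apply, LinearMap.smul_apply, LinearMap.sum_apply,
      mulDist_pair_apply]
    simp
  · funext n
    simp [total_apply]

theorem HasDiagonal.pair_right (hq : q ≠ 0) {x : OpSeries F L} {y : ℕ → OpSeries F L} {C : F}
    {d : ℕ → F} {i : ℕ} (hx : x = C • ∑ k ∈ Finset.range (i + 1),
      d k • ((y k).rescale (q ^ k)).shift i) {s : ℕ} {w : ℤ → Module.End F L} {v : L}
    {g : ℕ → ℤ → L} (hg : ∀ k ≤ i, HasDiagonal q
      (fun n => mulDist ![w, rescale (q ^ (s + k)) (y k).1] n v) (g k)) :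
    HasDiagonal q (fun n => mulDist ![w, rescale (q ^ s) x.1] n v)
      (fun n => C • ∑ k ∈ Finset.range (i + 1), (d k * (q ^ (s * i))⁻¹) • g k (n + i)) := by
  have h := (HasDiagonal.sum (Finset.range (i + 1)) fun k hk =>
    ((hg k (Nat.lt_succ_iff.1 (Finset.mem_range.1 hk))).translate (Pi.single 1 (i : ℤ))).smul
      (d k * (q ^ (s * i))⁻¹)).smul C
  convert h using 1
  · funext n
    rw [mulDist_pair_apply, rescale_combination hq hx]
    simp only [Pi.smul_apply, Finset.sum_apply, LinearMap.smul_apply, LinearMap.sum_apply,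
      mulDist_pair_apply, map_smul, map_sum]
    simp
  · funext n
    simp [total_apply]

theorem rescale_pair_zpow (e e' : ℕ) (a b : OpSeries F L) :
    (fun k : Fin 2 => rescale (q ^ (![(e : ℤ), e'] k)) ((![a, b] : Fin 2 → OpSeries F L) k).1)
      = ![rescale (q ^ e) a.1, rescale (q ^ e') b.1] := by
  rw [← rescale_pair]
  funext k
  fin_cases k
  exacts [congrArg (rescale · _) (zpow_natCast _ _), congrArg (rescale · _) (zpow_natCast _ _)]

/-- Replacing the first two of three fields by their product. -/
theorem HasDiagonal.merge_left (hq : q ≠ 0) {a b c : OpSeries F L} {e₁ e₂ e₃ : ℤ} {e : ℕ}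
    (he : e₂ = e₁ + e) (h : ∃ p, IsAdmissible q p ∧ IsLaurent (productDist q 0 e p a b))
    {v : L} {f : ℤ → L} (hf : HasDiagonal q (fun n => mulDist (fun s : Fin 3 => rescale
      (q ^ (![e₁, e₂, e₃] s)) ((![a, b, c] : Fin 3 → OpSeries F L) s).1) n v) f) :
    HasDiagonal q (fun n => mulDist (fun s : Fin 2 => rescale (q ^ (![e₁, e₃] s))
      ((![homProduct q 0 e a b, c] : Fin 2 → OpSeries F L) s).1) n v) f := by
  refine HasDiagonal.merge hq (m := 1) (a := ![a, b, c]) (E := ![e₁, e₂, e₃])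
    (a' := ![homProduct q 0 e a b, c]) (E' := ![e₁, e₃]) 0 ?_ ?_ rfl he rfl h hf
  · intro s hs; fin_cases s; exacts [(hs rfl).elim, rfl]
  · intro s hs; fin_cases s; exacts [(hs rfl).elim, rfl]

/-- Replacing the last two of three fields by their product. -/
theorem HasDiagonal.merge_right (hq : q ≠ 0) {a b c : OpSeries F L} {e₁ e₂ e₃ : ℤ} {e : ℕ}
    (he : e₃ = e₂ + e) (h : ∃ p, IsAdmissible q p ∧ IsLaurent (productDist q 0 e p b c))
    {v : L} {f : ℤ → L} (hf : HasDiagonal q (fun n => mulDist (fun s : Fin 3 => rescale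
      (q ^ (![e₁, e₂, e₃] s)) ((![a, b, c] : Fin 3 → OpSeries F L) s).1) n v) f) :
    HasDiagonal q (fun n => mulDist (fun s : Fin 2 => rescale (q ^ (![e₁, e₂] s))
      ((![a, homProduct q 0 e b c] : Fin 2 → OpSeries F L) s).1) n v) f := by
  refine HasDiagonal.merge hq (m := 1) (a := ![a, b, c]) (E := ![e₁, e₂, e₃])
    (a' := ![a, homProduct q 0 e b c]) (E' := ![e₁, e₂]) 1 ?_ ?_ rfl he rfl h hf
  · intro s hs; fin_cases s; exacts [rfl, (hs rfl).elim]
  · intro s hs; fin_cases s; exacts [rfl, (hs rfl).elim]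

/-- `(a_{-i-1} b)_{-j-1} c` in terms of products without derivatives. -/
theorem homProduct_homProduct_left (hq : q ≠ 0) (hq1 : ∀ n : ℕ, 0 < n → q ^ n ≠ 1)
    {a b c : OpSeries F L} {α β γ i j : ℕ} (hab : QuasiComm q ![a, b] ![α, β])
    (hx : QuasiComm q ![homProduct q i α a b, c] ![α + β + i, γ]) {v : L} {T : ℕ → ℕ → ℤ → L}
    (hT : ∀ k₁ k₂ : ℕ, k₁ ≤ i + k₂ → k₂ ≤ j → HasDiagonal q
      (fun n => mulDist (fun s : Fin 3 => rescale
        (q ^ (![(k₁ : ℤ), (α + i + k₂ : ℕ), (α + β + i + j : ℕ)] s))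
          ((![a, b, c] : Fin 3 → OpSeries F L) s).1) n v) (T k₁ k₂)) (n : ℤ) :
    (homProduct q j (α + β + i) (homProduct q i α a b) c).1 n v
      = ((qFactorial q j)⁻¹ * ((q - 1) ^ j)⁻¹) • ∑ k ∈ Finset.range (j + 1),
          (diffPoly q j).coeff k • ((qFactorial q i)⁻¹ * ((q - 1) ^ i)⁻¹) •
            ∑ k' ∈ Finset.range (i + 1), ((diffPoly q i).coeff k' * (q ^ (k * i))⁻¹) •
              T (k + k') k (n + j + i) := by
  refine homProduct_apply hq hq1 hx (g := fun k n => ((qFactorial q i)⁻¹ * ((q - 1) ^ i)⁻¹) •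
    ∑ k' ∈ Finset.range (i + 1), ((diffPoly q i).coeff k' * (q ^ (k * i))⁻¹) •
      T (k + k') k (n + i)) (fun k hk => ?_) n
  refine HasDiagonal.pair_left hq (homProduct_eq_sum hq hq1 hab i) (g := fun k' => T (k + k') k)
    fun k' hk' => ?_
  rw [← rescale_pair_zpow]
  exact HasDiagonal.merge_left hq (by omega) (hab.exists_productDist_zero hq (i - k'))
    (hT (k + k') k (by omega) hk)

/-- `a_{-i-l-1} (b_{-k-1} c)` in terms of products without derivatives. -/
theorem homProduct_homProduct_right (hq : q ≠ 0) (hq1 : ∀ n : ℕ, 0 < n → q ^ n ≠ 1)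
    {a b c : OpSeries F L} {α β γ i j l k : ℕ} (hlk : l + k = j)
    (hbc : QuasiComm q ![b, c] ![β, γ])
    (hu : QuasiComm q ![a, homProduct q k β b c] ![α, β + γ + k]) {v : L} {T : ℕ → ℕ → ℤ → L}
    (hT : ∀ k₁ k₂ : ℕ, k₁ ≤ i + k₂ → k₂ ≤ j → HasDiagonal q
      (fun n => mulDist (fun s : Fin 3 => rescale
        (q ^ (![(k₁ : ℤ), (α + i + k₂ : ℕ), (α + β + i + j : ℕ)] s))
          ((![a, b, c] : Fin 3 → OpSeries F L) s).1) n v) (T k₁ k₂)) (n : ℤ) :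
    (homProduct q (i + l) α a (homProduct q k β b c)).1 n v
      = ((qFactorial q (i + l))⁻¹ * ((q - 1) ^ (i + l))⁻¹) • ∑ k₁ ∈ Finset.range (i + l + 1),
          (diffPoly q (i + l)).coeff k₁ • ((qFactorial q k)⁻¹ * ((q - 1) ^ k)⁻¹) •
            ∑ k' ∈ Finset.range (k + 1),
              ((diffPoly q k).coeff k' * (q ^ ((α + (i + l)) * k))⁻¹) •
                T k₁ (l + k') (n + ((i + l : ℕ) : ℤ) + k) := by
  refine homProduct_apply hq hq1 hu (g := fun k₁ n => ((qFactorial q k)⁻¹ * ((q - 1) ^ k)⁻¹) •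
    ∑ k' ∈ Finset.range (k + 1), ((diffPoly q k).coeff k' * (q ^ ((α + (i + l)) * k))⁻¹) •
      T k₁ (l + k') (n + k)) (fun k₁ hk₁ => ?_) n
  refine HasDiagonal.pair_right hq (homProduct_eq_sum hq hq1 hbc k)
    (g := fun k' => T k₁ (l + k')) fun k' hk' => ?_
  rw [← rescale_pair_zpow]
  have h1 := hT k₁ (l + k') (by omega) (by omega)
  rw [show α + i + (l + k') = α + (i + l) + k' by omega] at h1
  exact HasDiagonal.merge_right hq (by omega) (hbc.exists_productDist_zero hq (k - k')) h1

/-- Associativity of the products of a quasi-commutative triple. Both sides are combinations of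
diagonal values of `a(q^{k₁} z) b(q^{α+i+k₂} z) c(q^{α+β+i+j} z)`, and the coefficients are compared
by the `q`-Leibniz rule. -/
theorem homProduct_assoc (hq : q ≠ 0) (hq1 : ∀ n : ℕ, 0 < n → q ^ n ≠ 1) {a b c : OpSeries F L}
    {α β γ : ℕ} (i j : ℕ) (habc : QuasiComm q ![a, b, c] ![α, β, γ])
    (hab : QuasiComm q ![a, b] ![α, β]) (hbc : QuasiComm q ![b, c] ![β, γ])
    (hx : QuasiComm q ![homProduct q i α a b, c] ![α + β + i, γ])
    (hu : ∀ k, QuasiComm q ![a, homProduct q k β b c] ![α, β + γ + k]) :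
    homProduct q j (α + β + i) (homProduct q i α a b) c
      = ∑ lk ∈ Finset.HasAntidiagonal.antidiagonal j,
          ((q ^ α) ^ lk.2 * qBinom q ((i : ℤ) + lk.1) lk.1 * q ^ (lk.2 * i)) •
            homProduct q (i + lk.1) α a (homProduct q lk.2 β b c) := by
  refine opSeries_ext fun n v => ?_
  have hT : ∀ k₁ k₂ : ℕ, ∃ t : ℤ → L, k₁ ≤ i + k₂ → k₂ ≤ j → HasDiagonal q
      (fun n => mulDist (fun s : Fin 3 => rescale
        (q ^ (![(k₁ : ℤ), (α + i + k₂ : ℕ), (α + β + i + j : ℕ)] s))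
          ((![a, b, c] : Fin 3 → OpSeries F L) s).1) n v) t := by
    intro k₁ k₂
    by_cases h : k₁ ≤ i + k₂ ∧ k₂ ≤ j
    · have hE : Compatible ![(k₁ : ℤ), (α + i + k₂ : ℕ), (α + β + i + j : ℕ)] ![α, β, γ] := by
        intro s s' hs
        fin_cases s <;> fin_cases s' <;> simp at hs ⊢ <;> omega
      obtain ⟨t, ht⟩ := (habc _ hE).exists_hasDiagonal v
      exact ⟨t, fun _ _ => ht⟩
    · exact ⟨0, fun h1 h2 => (h ⟨h1, h2⟩).elim⟩
  choose T hT using hT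
  rw [homProduct_homProduct_left hq hq1 hab hx hT, OpSeries.eval_apply n v (∑ lk ∈ _, _), map_sum]
  have key := congrArg (fun x => (((q - 1) ^ i)⁻¹ * ((q - 1) ^ j)⁻¹ * (qFactorial q i)⁻¹) • x)
    (sum_diffPoly_assoc hq hq1 (fun k₁ k₂ => T k₁ k₂ (n + i + j)) i j)
  refine Eq.trans ?_ (key.trans ?_)
  · simp only [Finset.smul_sum, smul_smul]
    refine Finset.sum_congr rfl fun k _ => Finset.sum_congr rfl fun k' _ => ?_
    rw [add_right_comm n (j : ℤ) (i : ℤ)]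
    congr 1
    ring
  · rw [Finset.smul_sum]
    refine Finset.sum_congr rfl fun lk hlk => ?_
    have hlk' := Finset.HasAntidiagonal.mem_antidiagonal.1 hlk
    have hn : n + ((i + lk.1 : ℕ) : ℤ) + lk.2 = n + i + j := by
      rw [← hlk']; push_cast; ring
    rw [map_smul, ← OpSeries.eval_apply,
      homProduct_homProduct_right hq hq1 hlk' hbc (hu lk.2) hT]
    simp only [Finset.smul_sum, smul_smul]
    refine Finset.sum_congr rfl fun k _ => Finset.sum_congr rfl fun k' _ => ?_
    rw [hn]
    congr 1
    have h1 := qBinom_mul hq1 i lk.1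
    have h2 : (q ^ α) ^ lk.2 * q ^ (lk.2 * i) * (q ^ ((α + (i + lk.1)) * lk.2))⁻¹
        = (q ^ (lk.1 * lk.2))⁻¹ := by
      have : q ^ ((α + (i + lk.1)) * lk.2) = (q ^ α) ^ lk.2 * q ^ (lk.2 * i) * q ^ (lk.1 * lk.2) := by
        rw [← pow_mul, ← pow_add, ← pow_add]
        congr 1
        ring
      rw [this, mul_inv, ← mul_assoc, mul_inv_cancel₀, one_mul]
      exact mul_ne_zero (pow_ne_zero _ (pow_ne_zero _ hq)) (pow_ne_zero _ hq)
    rw [← h2, ← hlk', pow_add (q - 1) lk.1, pow_add (q - 1) i, mul_inv, mul_inv]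
    linear_combination (-(((q - 1) ^ i)⁻¹ * (((q - 1) ^ lk.1)⁻¹ * ((q - 1) ^ lk.2)⁻¹)
      * (qFactorial q lk.2)⁻¹ * ((q ^ α) ^ lk.2 * q ^ (lk.2 * i)
      * (q ^ ((α + (i + lk.1)) * lk.2))⁻¹) * ((diffPoly q (i + lk.1)).coeff k
      * (diffPoly q lk.2).coeff k'))) * h1

end Associativity

/-! ### Bilinearity and products with the identity field -/

section Bilinearity

variable {F : Type*} [Field F] {L : Type*} [AddCommGroup L] [Module F L] {q : F}

theorem update_pair_zero {A : Type*} (a b x : A) :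
    Function.update (![a, b] : Fin 2 → A) 0 x = ![x, b] := by
  funext i; fin_cases i <;> rfl

theorem update_pair_one {A : Type*} (a b x : A) :
    Function.update (![a, b] : Fin 2 → A) 1 x = ![a, x] := by
  funext i; fin_cases i <;> rfl

theorem homProduct_unique (hq : q ≠ 0) (hq1 : ∀ n : ℕ, 0 < n → q ^ n ≠ 1) {r α β : ℕ}
    {a b c : OpSeries F L} (h : QuasiComm q ![a, b] ![α, β])
    (hc : ∀ v, HasDiagonal q
      (fun n => mulDist ![(qDeriv q)^[r] a.1, rescale (q ^ (α + r)) b.1] n v)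
      (fun n => qFactorial q r • c.1 n v)) : homProduct q r α a b = c := by
  have hr := qFactorial_ne_zero hq1 r
  refine opSeries_ext fun n v => ?_
  exact smul_right_injective L hr (congrFun
    ((hasDiagonal_homProduct hr (h.exists_productDist hq r) v).unique (hc v)) n)

theorem homProduct_add_left (hq : q ≠ 0) (hq1 : ∀ n : ℕ, 0 < n → q ^ n ≠ 1) {r α β : ℕ}
    {a a' b : OpSeries F L} (h : QuasiComm q ![a, b] ![α, β]) (h' : QuasiComm q ![a', b] ![α, β]) :
    homProduct q r α (a + a') b = homProduct q r α a b + homProduct q r α a' b := by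
  have hr := qFactorial_ne_zero hq1 r
  have hs : QuasiComm q ![a + a', b] ![α, β] := by
    rw [← update_pair_zero a b] at h h' ⊢
    exact h.update_add h'
  refine homProduct_unique hq hq1 hs fun v => ?_
  convert (hasDiagonal_homProduct hr (h.exists_productDist hq r) v).add
    (hasDiagonal_homProduct hr (h'.exists_productDist hq r) v) using 1
  · funext n
    simp only [Pi.add_apply, mulDist_pair_apply, qDeriv_iterate hq]
    rw [← LinearMap.add_apply, ← smul_add]
    rfl
  · funext n
    exact smul_add _ _ _

theorem homProduct_smul_left (hq : q ≠ 0) (hq1 : ∀ n : ℕ, 0 < n → q ^ n ≠ 1) {r α β : ℕ}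
    {a b : OpSeries F L} (h : QuasiComm q ![a, b] ![α, β]) (x : F) :
    homProduct q r α (x • a) b = x • homProduct q r α a b := by
  have hr := qFactorial_ne_zero hq1 r
  have hs : QuasiComm q ![x • a, b] ![α, β] := by
    rw [← update_pair_zero a b] at h ⊢
    exact h.update_smul x
  refine homProduct_unique hq hq1 hs fun v => ?_
  convert (hasDiagonal_homProduct hr (h.exists_productDist hq r) v).smul x using 1
  · funext n
    simp only [Pi.smul_apply, mulDist_pair_apply, qDeriv_iterate hq]
    rw [← LinearMap.smul_apply, smul_comm x]
    rfl
  · funext n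
    exact smul_comm (_ : F) x (_ : L)

theorem homProduct_add_right (hq : q ≠ 0) (hq1 : ∀ n : ℕ, 0 < n → q ^ n ≠ 1) {r α β : ℕ}
    {a b b' : OpSeries F L} (h : QuasiComm q ![a, b] ![α, β]) (h' : QuasiComm q ![a, b'] ![α, β]) :
    homProduct q r α a (b + b') = homProduct q r α a b + homProduct q r α a b' := by
  have hr := qFactorial_ne_zero hq1 r
  have hs : QuasiComm q ![a, b + b'] ![α, β] := by
    rw [← update_pair_one a b] at h h' ⊢
    exact h.update_add h'
  refine homProduct_unique hq hq1 hs fun v => ?_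
  convert (hasDiagonal_homProduct hr (h.exists_productDist hq r) v).add
    (hasDiagonal_homProduct hr (h'.exists_productDist hq r) v) using 1
  · funext n
    simp only [Pi.add_apply, mulDist_pair_apply]
    rw [← map_add, ← LinearMap.add_apply]
    congr 2
    exact smul_add _ _ _
  · funext n
    exact smul_add _ _ _

theorem homProduct_smul_right (hq : q ≠ 0) (hq1 : ∀ n : ℕ, 0 < n → q ^ n ≠ 1) {r α β : ℕ}
    {a b : OpSeries F L} (h : QuasiComm q ![a, b] ![α, β]) (x : F) :
    homProduct q r α a (x • b) = x • homProduct q r α a b := by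
  have hr := qFactorial_ne_zero hq1 r
  have hs : QuasiComm q ![a, x • b] ![α, β] := by
    rw [← update_pair_one a b] at h ⊢
    exact h.update_smul x
  refine homProduct_unique hq hq1 hs fun v => ?_
  convert (hasDiagonal_homProduct hr (h.exists_productDist hq r) v).smul x using 1
  · funext n
    simp only [Pi.smul_apply, mulDist_pair_apply]
    rw [← map_smul, ← LinearMap.smul_apply]
    congr 2
    exact smul_comm (_ : F) x (_ : Module.End F L)
  · funext n
    exact smul_comm (_ : F) x (_ : L)

theorem homProduct_zero_left (hq : q ≠ 0) (hq1 : ∀ n : ℕ, 0 < n → q ^ n ≠ 1) (r α : ℕ)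
    (b : OpSeries F L) : homProduct q r α 0 b = 0 := by
  have h : QuasiComm q ![0, b] ![α, 0] := by
    rw [← update_pair_zero 0 b]
    exact QuasiComm.update_zero q _ _ 0
  have := homProduct_smul_left hq hq1 (r := r) h 0
  rwa [zero_smul, zero_smul] at this

theorem homProduct_zero_right (hq : q ≠ 0) (hq1 : ∀ n : ℕ, 0 < n → q ^ n ≠ 1) (r α : ℕ)
    (a : OpSeries F L) : homProduct q r α a 0 = 0 := by
  have h : QuasiComm q ![a, 0] ![α, 0] := by
    rw [← update_pair_one a 0]
    exact QuasiComm.update_zero q _ _ 1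
  have := homProduct_smul_right hq hq1 (r := r) h 0
  rwa [zero_smul, zero_smul] at this

theorem qDeriv_oneField (q : F) : qDeriv q (oneField F L).1 = 0 := by
  funext n
  rw [qDeriv, rescale_oneField, sub_self, smul_zero]
  rfl

theorem homProduct_one_left_succ (hq : q ≠ 0) (hq1 : ∀ n : ℕ, 0 < n → q ^ n ≠ 1) (r : ℕ) {β : ℕ}
    {b : OpSeries F L} (h : QuasiComm q ![oneField F L, b] ![0, β]) :
    homProduct q (r + 1) 0 (oneField F L) b = 0 := by
  refine homProduct_unique hq hq1 h fun v => ?_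
  have h0 : (qDeriv q)^[r + 1] (oneField F L).1 = 0 := by
    rw [Function.iterate_succ_apply, qDeriv_oneField]
    funext n
    rw [qDeriv_iterate hq]
    exact smul_zero _
  convert HasDiagonal.zero (m := 2) (M := L) q using 1
  · funext n
    rw [h0, mulDist_pair_apply]
    rfl
  · funext n
    exact smul_zero _

theorem hasDiagonal_of_bounded {X : (Fin 2 → ℤ) → L} (hX : Laurent X) :
    HasDiagonal q X (fun n => ∑ᶠ i : ℤ, X ![i, n - i]) :=
  ⟨1, one_mem _, by rwa [one_convMul], by
    rw [one_convMul, map_one, one_smul]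
    exact funext fun n => push_total_two X n⟩

theorem homProduct_one_left (hq : q ≠ 0) (hq1 : ∀ n : ℕ, 0 < n → q ^ n ≠ 1) {β : ℕ}
    {b : OpSeries F L} (h : QuasiComm q ![oneField F L, b] ![0, β]) :
    homProduct q 0 0 (oneField F L) b = b := by
  refine homProduct_unique hq hq1 h fun v => ?_
  have hX : ∀ n : Fin 2 → ℤ,
      mulDist ![(qDeriv q)^[0] (oneField F L).1, rescale (q ^ (0 + 0)) b.1] n v
        = if n 0 = 0 then b.1 (n 1) v else 0 := by
    intro n
    rw [mulDist_pair_apply, Nat.add_zero, pow_zero, rescale_one, Function.iterate_zero, id]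
    by_cases hn : n 0 = 0 <;> simp [oneField, hn]
  simp only [hX, qFactorial_zero, one_smul]
  convert hasDiagonal_of_bounded (q := q) (X := fun n => if n 0 = 0 then b.1 (n 1) v else 0) ?_
    using 1
  · funext n
    rw [finsum_eq_single _ 0 (fun i hi => by simp [hi])]
    simp
  · obtain ⟨N, hN⟩ := b.2 v
    refine ⟨min N 0, fun n ⟨i, hi⟩ => ?_⟩
    fin_cases i
    · have : n 0 ≠ 0 := (lt_of_lt_of_le hi (min_le_right _ _)).ne
      simp [this]
    · have h1 : b.1 (n 1) v = 0 := hN _ (lt_of_lt_of_le hi (min_le_left _ _))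
      simp [h1]

theorem homProduct_one_right (hq : q ≠ 0) (hq1 : ∀ n : ℕ, 0 < n → q ^ n ≠ 1) {α : ℕ}
    {a : OpSeries F L} (h : QuasiComm q ![a, oneField F L] ![α, 0]) :
    homProduct q 0 α a (oneField F L) = a := by
  refine homProduct_unique hq hq1 h fun v => ?_
  have hX : ∀ n : Fin 2 → ℤ,
      mulDist ![(qDeriv q)^[0] a.1, rescale (q ^ (α + 0)) (oneField F L).1] n v
        = if n 1 = 0 then a.1 (n 0) v else 0 := by
    intro n
    rw [mulDist_pair_apply, rescale_oneField, Function.iterate_zero, id]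
    by_cases hn : n 1 = 0 <;> simp [oneField, hn]
  simp only [hX, qFactorial_zero, one_smul]
  convert hasDiagonal_of_bounded (q := q) (X := fun n => if n 1 = 0 then a.1 (n 0) v else 0) ?_
    using 1
  · funext n
    rw [finsum_eq_single _ n (fun i hi => by simp [sub_eq_zero, hi.symm])]
    simp
  · obtain ⟨N, hN⟩ := a.2 v
    refine ⟨min N 0, fun n ⟨i, hi⟩ => ?_⟩
    fin_cases i
    · have h1 : a.1 (n 0) v = 0 := hN _ (lt_of_lt_of_le hi (min_le_left _ _))
      simp [h1]
    · have : n 1 ≠ 0 := (lt_of_lt_of_le hi (min_le_right _ _)).ne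
      simp [this]

end Bilinearity

/-! ### Lists of fields -/

section Lists

variable {F : Type*} [Field F] {L : Type*} [AddCommGroup L] [Module F L] {q : F}

/-- Quasi-commutativity of a list of fields with weights. -/
def QuasiCommList (q : F) (l : List (OpSeries F L × ℕ)) : Prop :=
  QuasiComm q (fun k : Fin l.length => (l[k]).1) (fun k : Fin l.length => (l[k]).2)

theorem quasiCommList_iff {m : ℕ} {l : List (OpSeries F L × ℕ)} {a : Fin m → OpSeries F L}
    {α : Fin m → ℕ} (h : l.length = m) (ha : ∀ k : Fin m, l[k]'(h ▸ k.2) = (a k, α k)) :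
    QuasiCommList q l ↔ QuasiComm q a α := by
  subst h
  have h1 : a = fun k : Fin l.length => (l[k]).1 := funext fun k => by
    have := ha k
    exact (congrArg Prod.fst this).symm
  have h2 : α = fun k : Fin l.length => (l[k]).2 := funext fun k => by
    have := ha k
    exact (congrArg Prod.snd this).symm
  rw [h1, h2, QuasiCommList]

theorem quasiCommList_ofFn {m : ℕ} (a : Fin m → OpSeries F L) (α : Fin m → ℕ) :
    QuasiCommList q (List.ofFn fun k => (a k, α k)) ↔ QuasiComm q a α :=
  quasiCommList_iff (by simp) fun k => by simp

theorem quasiCommList_pair {a b : OpSeries F L} {α β : ℕ} :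
    QuasiCommList q [(a, α), (b, β)] ↔ QuasiComm q ![a, b] ![α, β] :=
  quasiCommList_iff rfl fun k => by fin_cases k <;> rfl

theorem quasiCommList_triple {a b c : OpSeries F L} {α β γ : ℕ} :
    QuasiCommList q [(a, α), (b, β), (c, γ)] ↔ QuasiComm q ![a, b, c] ![α, β, γ] :=
  quasiCommList_iff rfl fun k => by fin_cases k <;> rfl

/-- Changing one entry of a list, in terms of `Function.update`. -/
theorem quasiCommList_slot (l₁ l₂ : List (OpSeries F L × ℕ)) :
    ∃ (m : ℕ) (j : Fin m) (a : Fin m → OpSeries F L) (α : Fin m → ℕ), ∀ x β,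
      QuasiCommList q (l₁ ++ (x, β) :: l₂) ↔
        QuasiComm q (Function.update a j x) (Function.update α j β) := by
  refine ⟨l₁.length + (l₂.length + 1), ⟨l₁.length, by omega⟩,
    fun k => ((l₁ ++ (0, 0) :: l₂)[k]'(by simp)).1,
    fun k => ((l₁ ++ (0, 0) :: l₂)[k]'(by simp)).2, fun x β => quasiCommList_iff (by simp) ?_⟩
  intro k
  by_cases hk : k = ⟨l₁.length, by omega⟩
  · subst hk
    simp
  · rw [Function.update_of_ne hk, Function.update_of_ne hk]
    have hk' : (k : ℕ) ≠ l₁.length := fun h => hk (Fin.ext h)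
    simp only [Fin.getElem_fin, List.getElem_append]
    split_ifs with h
    · rfl
    · obtain ⟨d, hd⟩ : ∃ d, (k : ℕ) - l₁.length = d + 1 := ⟨k - l₁.length - 1, by omega⟩
      simp only [hd, List.getElem_cons_succ]

variable {l₁ l₂ : List (OpSeries F L × ℕ)}

theorem QuasiCommList.zero (α : ℕ) : QuasiCommList q (l₁ ++ (0, α) :: l₂) := by
  obtain ⟨m, j, a, β, h⟩ := quasiCommList_slot (q := q) l₁ l₂
  rw [h]
  exact QuasiComm.update_zero q _ _ _

theorem QuasiCommList.add {x y : OpSeries F L} {α : ℕ} (hx : QuasiCommList q (l₁ ++ (x, α) :: l₂))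
    (hy : QuasiCommList q (l₁ ++ (y, α) :: l₂)) : QuasiCommList q (l₁ ++ (x + y, α) :: l₂) := by
  obtain ⟨m, j, a, β, h⟩ := quasiCommList_slot (q := q) l₁ l₂
  rw [h] at hx hy ⊢
  exact hx.update_add hy

theorem QuasiCommList.smul {x : OpSeries F L} {α : ℕ} (hx : QuasiCommList q (l₁ ++ (x, α) :: l₂))
    (c : F) : QuasiCommList q (l₁ ++ (c • x, α) :: l₂) := by
  obtain ⟨m, j, a, β, h⟩ := quasiCommList_slot (q := q) l₁ l₂
  rw [h] at hx ⊢
  exact hx.update_smul c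

theorem QuasiCommList.sum {ι : Type*} (s : Finset ι) {x : ι → OpSeries F L} {α : ℕ}
    (hx : ∀ i ∈ s, QuasiCommList q (l₁ ++ (x i, α) :: l₂)) :
    QuasiCommList q (l₁ ++ (∑ i ∈ s, x i, α) :: l₂) :=
  Finset.sum_induction x (fun y => QuasiCommList q (l₁ ++ (y, α) :: l₂))
    (fun _ _ h h' => h.add h') (QuasiCommList.zero α) hx

theorem QuasiCommList.shift (hq : q ≠ 0) {x : OpSeries F L} {α : ℕ}
    (hx : QuasiCommList q (l₁ ++ (x, α) :: l₂)) (d : ℤ) :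
    QuasiCommList q (l₁ ++ (x.shift d, α) :: l₂) := by
  obtain ⟨m, j, a, β, h⟩ := quasiCommList_slot (q := q) l₁ l₂
  rw [h] at hx ⊢
  simpa using hx.update_shift hq j d

theorem QuasiCommList.rescale (hq : q ≠ 0) {x : OpSeries F L} {α : ℕ}
    (hx : QuasiCommList q (l₁ ++ (x, α) :: l₂)) {k r : ℕ} (hkr : k ≤ r) :
    QuasiCommList q (l₁ ++ (x.rescale (q ^ k), α + r) :: l₂) := by
  obtain ⟨m, j, a, β, h⟩ := quasiCommList_slot (q := q) l₁ l₂
  rw [h] at hx ⊢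
  simpa using hx.update_rescale hq j hkr

theorem QuasiCommList.raise (hq : q ≠ 0) {x : OpSeries F L} {α : ℕ}
    (hx : QuasiCommList q (l₁ ++ (x, α) :: l₂)) (r : ℕ) :
    QuasiCommList q (l₁ ++ (x, α + r) :: l₂) := by
  obtain ⟨m, j, a, β, h⟩ := quasiCommList_slot (q := q) l₁ l₂
  rw [h] at hx ⊢
  simpa using hx.raise hq j r

theorem QuasiCommList.insert_one (h : QuasiCommList q (l₁ ++ l₂)) :
    QuasiCommList q (l₁ ++ (oneField F L, 0) :: l₂) := by
  set L' := l₁ ++ (oneField F L, 0) :: l₂ with hL'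
  set j : Fin (l₁.length + l₂.length + 1) := ⟨l₁.length, by omega⟩ with hj
  have hlen : L'.length = l₁.length + l₂.length + 1 := by simp [hL']; omega
  rw [quasiCommList_iff (a := fun k => (L'[k]'(k.2.trans_eq hlen.symm)).1)
    (α := fun k => (L'[k]'(k.2.trans_eq hlen.symm)).2) hlen fun k => rfl]
  refine QuasiComm.insert_one (j := j) (by simp [hL', hj]) (by simp [hL', hj]) ?_
  refine (quasiCommList_iff (by simp) fun k => ?_).1 h
  rcases lt_or_ge (k : ℕ) l₁.length with hk | hk
  · rw [Fin.succAbove_of_castSucc_lt j k (by simpa [Fin.lt_def, hj] using hk)]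
    simp only [hL', Fin.getElem_fin, List.getElem_append, Fin.val_castSucc, hk, dif_pos]
  · rw [Fin.succAbove_of_le_castSucc j k (by simpa [Fin.le_def, hj] using hk)]
    have h1 : ¬ (k : ℕ) + 1 < l₁.length := by omega
    have h2 : ¬ (k : ℕ) < l₁.length := by omega
    have h3 : (k : ℕ) + 1 - l₁.length = (k - l₁.length) + 1 := by omega
    simp only [hL', Fin.getElem_fin, List.getElem_append, Fin.val_succ, h1, h2, dif_neg,
      not_false_eq_true, h3, List.getElem_cons_succ]

theorem QuasiCommList.merge_zero (hq : q ≠ 0) {a b : OpSeries F L} {α β : ℕ}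
    (hp : QuasiComm q ![a, b] ![α, β])
    (h : QuasiCommList q (l₁ ++ (a, α) :: (b, β) :: l₂)) :
    QuasiCommList q (l₁ ++ (homProduct q 0 α a b, α + β) :: l₂) := by
  set K := l₁ ++ (a, α) :: (b, β) :: l₂ with hK
  set K' := l₁ ++ (homProduct q 0 α a b, α + β) :: l₂ with hK'
  set j : Fin (l₁.length + l₂.length + 1) := ⟨l₁.length, by omega⟩ with hj
  have hlen : K.length = l₁.length + l₂.length + 2 := by simp [hK]; omega
  have hlen' : K'.length = l₁.length + l₂.length + 1 := by simp [hK']; omega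
  have hk : ∀ k : Fin (l₁.length + l₂.length + 1), k ≠ j →
      K'[k]'(k.2.trans_eq hlen'.symm) = K[j.castSucc.succAbove k]'((j.castSucc.succAbove k).2.trans_eq hlen.symm) := by
    intro k hkj
    have hkj' : (k : ℕ) ≠ l₁.length := fun h => hkj (Fin.ext h)
    rcases lt_or_ge (k : ℕ) l₁.length with hk | hk
    · rw [show j.castSucc.succAbove k = k.castSucc from Fin.succAbove_of_castSucc_lt _ k
        (by simpa [Fin.lt_def, hj] using hk)]
      simp only [hK, hK', Fin.getElem_fin, List.getElem_append, Fin.val_castSucc, hk, dif_pos]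
    · rw [show j.castSucc.succAbove k = k.succ from Fin.succAbove_of_le_castSucc _ k
        (by simpa [Fin.le_def, hj] using hk)]
      have h1 : ¬ (k : ℕ) + 1 < l₁.length := by omega
      have h2 : ¬ (k : ℕ) < l₁.length := by omega
      obtain ⟨d, hd⟩ : ∃ d, (k : ℕ) - l₁.length = d + 1 := ⟨k - l₁.length - 1, by omega⟩
      have h3 : (k : ℕ) + 1 - l₁.length = d + 1 + 1 := by omega
      simp only [hK, hK', Fin.getElem_fin, List.getElem_append, Fin.val_succ, h1, h2, dif_neg,
        not_false_eq_true, h3, hd, List.getElem_cons_succ]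
  rw [quasiCommList_iff (a := fun k => (K[k]'(k.2.trans_eq hlen.symm)).1)
    (α := fun k => (K[k]'(k.2.trans_eq hlen.symm)).2) hlen fun k => rfl] at h
  rw [quasiCommList_iff (a := fun k => (K'[k]'(k.2.trans_eq hlen'.symm)).1)
    (α := fun k => (K'[k]'(k.2.trans_eq hlen'.symm)).2) hlen' fun k => rfl]
  have hKa : K[j.castSucc]'(j.castSucc.2.trans_eq hlen.symm) = (a, α) := by simp [hK, hj]
  have hKb : K[j.succ]'(j.succ.2.trans_eq hlen.symm) = (b, β) := by simp [hK, hj]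
  have hKj : K'[j]'(j.2.trans_eq hlen'.symm) = (homProduct q 0 α a b, α + β) := by simp [hK', hj]
  refine QuasiComm.merge_zero hq (j := j) (fun k hkj => by rw [hk k hkj])
    (fun k hkj => by rw [hk k hkj]) ?_ ?_ ?_ h
  · rw [hKa, hKb, hKj]
  · rw [hKa, hKb, hKj]
  · rw [hKa, hKb]
    exact hp

/-- Products of adjacent entries of a quasi-commutative list. -/
theorem QuasiCommList.merge (hq : q ≠ 0) (hq1 : ∀ n : ℕ, 0 < n → q ^ n ≠ 1) {a b : OpSeries F L}
    {α β : ℕ} (hp : QuasiComm q ![a, b] ![α, β])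
    (h : QuasiCommList q (l₁ ++ (a, α) :: (b, β) :: l₂)) (r : ℕ) :
    QuasiCommList q (l₁ ++ (homProduct q r α a b, α + β + r) :: l₂) := by
  rw [homProduct_eq_sum hq hq1 hp r]
  refine QuasiCommList.smul (QuasiCommList.sum _ fun k hk => ?_) _
  have hkr : k ≤ r := Nat.lt_succ_iff.1 (Finset.mem_range.1 hk)
  refine QuasiCommList.smul (QuasiCommList.shift hq ?_ _) _
  have hp' : QuasiComm q ![a, b] ![α + (r - k), β] :=
    quasiCommList_pair.1 (QuasiCommList.raise (l₁ := []) hq (quasiCommList_pair.2 hp) (r - k))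
  have := ((h.raise hq (r - k)).merge_zero hq hp').rescale hq (le_refl k)
  rwa [show α + (r - k) + β + k = α + β + r by omega] at this

end Lists

/-! ### Fields generated by a quasi-commutative set -/

section Generated

variable {F : Type*} [Field F] {L : Type*} [AddCommGroup L] [Module F L] {q : F}

/-- The fields of weight `α` obtained from the identity field and the generators in `S₀` (fields
with weights) by linear combinations and by products with a generator on the left. -/
inductive Generated (q : F) (S₀ : Set (OpSeries F L × ℕ)) : OpSeries F L → ℕ → Prop
  | one : Generated q S₀ (oneField F L) 0
  | zero (α : ℕ) : Generated q S₀ 0 α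
  | add {a b : OpSeries F L} {α : ℕ} (ha : Generated q S₀ a α) (hb : Generated q S₀ b α) :
      Generated q S₀ (a + b) α
  | smul (c : F) {a : OpSeries F L} {α : ℕ} (ha : Generated q S₀ a α) : Generated q S₀ (c • a) α
  | mul {a b : OpSeries F L} {α β : ℕ} (r : ℕ) (ha : (a, α) ∈ S₀) (hb : Generated q S₀ b β) :
      Generated q S₀ (homProduct q r α a b) (α + β + r)

variable {S₀ : Set (OpSeries F L × ℕ)}

theorem Generated.quasiCommList_cons (hq : q ≠ 0) (hq1 : ∀ n : ℕ, 0 < n → q ^ n ≠ 1)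
    (hS : ∀ l : List (OpSeries F L × ℕ), (∀ x ∈ l, x ∈ S₀) → QuasiCommList q l)
    {x : OpSeries F L} {α : ℕ} (hx : Generated q S₀ x α) :
    ∀ l : List (OpSeries F L × ℕ), (∀ pre : List (OpSeries F L × ℕ), (∀ x ∈ pre, x ∈ S₀) →
      QuasiCommList q (pre ++ l)) → ∀ pre : List (OpSeries F L × ℕ), (∀ x ∈ pre, x ∈ S₀) →
        QuasiCommList q (pre ++ (x, α) :: l) := by
  induction hx with
  | one => exact fun l hl pre hpre => (hl pre hpre).insert_one
  | zero α => exact fun l hl pre hpre => QuasiCommList.zero α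
  | add _ _ iha ihb => exact fun l hl pre hpre => (iha l hl pre hpre).add (ihb l hl pre hpre)
  | smul c _ iha => exact fun l hl pre hpre => (iha l hl pre hpre).smul c
  | @mul a b α β r ha _ ihb =>
    intro l hl pre hpre
    have hp : QuasiCommList q ([(a, α)] ++ [(b, β)]) :=
      ihb [] (fun pre hpre => by simpa using hS pre hpre) [(a, α)] (by simpa using ha)
    refine QuasiCommList.merge hq hq1 (quasiCommList_pair.1 hp) ?_ r
    have := ihb l hl (pre ++ [(a, α)]) (by
      intro x hx
      rcases List.mem_append.1 hx with h | h
      · exact hpre x h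
      · rw [List.mem_singleton.1 h]; exact ha)
    simpa using this

/-- Quasi-commutativity extends from the generators to everything generated by them. -/
theorem quasiCommList_of_generated (hq : q ≠ 0) (hq1 : ∀ n : ℕ, 0 < n → q ^ n ≠ 1)
    (hS : ∀ l : List (OpSeries F L × ℕ), (∀ x ∈ l, x ∈ S₀) → QuasiCommList q l)
    (l : List (OpSeries F L × ℕ)) (hl : ∀ x ∈ l, Generated q S₀ x.1 x.2) : QuasiCommList q l := by
  suffices h : ∀ pre : List (OpSeries F L × ℕ), (∀ x ∈ pre, x ∈ S₀) → QuasiCommList q (pre ++ l) by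
    simpa using h [] (by simp)
  induction l with
  | nil => exact fun pre hpre => by simpa using hS pre hpre
  | cons x l ih =>
    exact (hl x List.mem_cons_self).quasiCommList_cons hq hq1 hS l
      (ih fun y hy => hl y (List.mem_cons_of_mem _ hy))

theorem Generated.pair (hq : q ≠ 0) (hq1 : ∀ n : ℕ, 0 < n → q ^ n ≠ 1)
    (hS : ∀ l : List (OpSeries F L × ℕ), (∀ x ∈ l, x ∈ S₀) → QuasiCommList q l)
    {a b : OpSeries F L} {α β : ℕ} (ha : Generated q S₀ a α) (hb : Generated q S₀ b β) :
    QuasiComm q ![a, b] ![α, β] :=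
  quasiCommList_pair.1 (quasiCommList_of_generated hq hq1 hS _ (by simp [ha, hb]))

theorem Generated.of_mem (hq : q ≠ 0) (hq1 : ∀ n : ℕ, 0 < n → q ^ n ≠ 1)
    (hS : ∀ l : List (OpSeries F L × ℕ), (∀ x ∈ l, x ∈ S₀) → QuasiCommList q l)
    {a : OpSeries F L} {α : ℕ} (ha : (a, α) ∈ S₀) : Generated q S₀ a α := by
  have h1 : QuasiCommList q ([(a, α)] ++ [(oneField F L, 0)]) :=
    QuasiCommList.insert_one (hS _ (by simpa using ha))
  have := Generated.mul (q := q) 0 ha Generated.one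
  rwa [homProduct_one_right hq hq1 (quasiCommList_pair.1 h1)] at this

theorem Generated.sum {ι : Type*} (s : Finset ι) {x : ι → OpSeries F L} {α : ℕ}
    (hx : ∀ i ∈ s, Generated q S₀ (x i) α) : Generated q S₀ (∑ i ∈ s, x i) α :=
  Finset.sum_induction x (fun y => Generated q S₀ y α) (fun _ _ => Generated.add)
    (Generated.zero α) hx

theorem Generated.assoc (hq : q ≠ 0) (hq1 : ∀ n : ℕ, 0 < n → q ^ n ≠ 1)
    (hS : ∀ l : List (OpSeries F L × ℕ), (∀ x ∈ l, x ∈ S₀) → QuasiCommList q l)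
    {a b c : OpSeries F L} {α β γ : ℕ} (ha : Generated q S₀ a α) (hb : Generated q S₀ b β)
    (hc : Generated q S₀ c γ) (i j : ℕ)
    (hab : Generated q S₀ (homProduct q i α a b) (α + β + i))
    (hbc : ∀ k, Generated q S₀ (homProduct q k β b c) (β + γ + k)) :
    homProduct q j (α + β + i) (homProduct q i α a b) c
      = ∑ lk ∈ Finset.HasAntidiagonal.antidiagonal j,
          ((q ^ α) ^ lk.2 * qBinom q ((i : ℤ) + lk.1) lk.1 * q ^ (lk.2 * i)) •
            homProduct q (i + lk.1) α a (homProduct q lk.2 β b c) :=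
  homProduct_assoc hq hq1 i j
    (quasiCommList_triple.1 (quasiCommList_of_generated hq hq1 hS _ (by simp [ha, hb, hc])))
    (ha.pair hq hq1 hS hb) (hb.pair hq hq1 hS hc) (hab.pair hq hq1 hS hc)
    fun k => ha.pair hq hq1 hS (hbc k)

/-- By associativity, products of generated fields are generated. -/
theorem Generated.homProduct (hq : q ≠ 0) (hq1 : ∀ n : ℕ, 0 < n → q ^ n ≠ 1)
    (hS : ∀ l : List (OpSeries F L × ℕ), (∀ x ∈ l, x ∈ S₀) → QuasiCommList q l)
    {a b : OpSeries F L} {α β : ℕ} (ha : Generated q S₀ a α) (hb : Generated q S₀ b β) (r : ℕ) :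
    Generated q S₀ (QVA.homProduct q r α a b) (α + β + r) := by
  induction ha generalizing r with
  | one =>
    have hp := Generated.one.pair hq hq1 hS hb
    cases r with
    | zero =>
      rw [homProduct_one_left hq hq1 hp, zero_add, add_zero]
      exact hb
    | succ r =>
      rw [homProduct_one_left_succ hq hq1 r hp]
      exact Generated.zero _
  | zero α =>
    rw [homProduct_zero_left hq hq1]
    exact Generated.zero _
  | add ha ha' ih ih' =>
    rw [homProduct_add_left hq hq1 (ha.pair hq hq1 hS hb) (ha'.pair hq hq1 hS hb)]
    exact (ih r).add (ih' r)
  | smul c ha ih =>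
    rw [homProduct_smul_left hq hq1 (ha.pair hq hq1 hS hb)]
    exact (ih r).smul c
  | @mul a x α γ i ha hx ih =>
    rw [Generated.assoc hq hq1 hS (Generated.of_mem hq hq1 hS ha) hx hb i r (Generated.mul i ha hx)
      ih]
    refine Generated.sum _ fun lk hlk => ?_
    have h1 := Finset.HasAntidiagonal.mem_antidiagonal.1 hlk
    have h2 := Generated.mul (i + lk.1) ha (ih lk.2)
    rw [show α + (γ + β + lk.2) + (i + lk.1) = α + γ + i + β + r by omega] at h2
    exact h2.smul _

end Generated

/-! ### The vertex algebra generated by a quasi-commutative set -/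

section Products

variable {F : Type*} [Field F] {L : Type*} [AddCommGroup L] [Module F L] {q : F}

theorem product_of_nonneg {s : ℤ} (hs : 0 ≤ s) (a b : OpSeriesT F L) : product q s a b = 0 :=
  if_neg (not_lt.2 hs)

theorem product_eq_sum (hq : q ≠ 0) (hq1 : ∀ n : ℕ, 0 < n → q ^ n ≠ 1) (r : ℕ)
    {a b : OpSeriesT F L} {s t : Finset ℕ} (hs : a.support ⊆ s) (ht : b.support ⊆ t) :
    product q (-(r : ℤ) - 1) a b = ∑ α ∈ s, ∑ β ∈ t,
      Finsupp.single (α + β + r) (homProduct q r α (a α) (b β)) := by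
  have h1 : (-(-(r : ℤ) - 1) - 1).toNat = r := by omega
  rw [product, if_pos (by omega), h1, Finsupp.sum_of_support_subset a hs]
  · refine Finset.sum_congr rfl fun α _ => ?_
    refine Finsupp.sum_of_support_subset b ht _ fun β _ => ?_
    rw [homProduct_zero_right hq hq1, Finsupp.single_zero]
  · intro α _
    refine Finset.sum_eq_zero fun β _ => ?_
    beta_reduce
    rw [homProduct_zero_left hq hq1, Finsupp.single_zero]

theorem product_single_single (hq : q ≠ 0) (hq1 : ∀ n : ℕ, 0 < n → q ^ n ≠ 1) (r α β : ℕ)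
    (a b : OpSeries F L) :
    product q (-(r : ℤ) - 1) (Finsupp.single α a) (Finsupp.single β b)
      = Finsupp.single (α + β + r) (homProduct q r α a b) := by
  rw [product_eq_sum hq hq1 r Finsupp.support_single_subset Finsupp.support_single_subset]
  simp

end Products

section GeneratedSpace

variable {F : Type*} [Field F] {L : Type*} [AddCommGroup L] [Module F L] {q : F}
  {S₀ : Set (OpSeries F L × ℕ)}

/-- The subspace of `ℰ(L)_t` of all elements whose homogeneous components are generated by the
weighted fields in `S₀`. -/
def generatedSpace (q : F) (S₀ : Set (OpSeries F L × ℕ)) : Submodule F (OpSeriesT F L) where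
  carrier := {w | ∀ α, Generated q S₀ (w α) α}
  zero_mem' := fun α => Generated.zero α
  add_mem' := fun ha hb α => (ha α).add (hb α)
  smul_mem' := fun c _ ha α => (ha α).smul c

theorem single_mem_generatedSpace {a : OpSeries F L} {α : ℕ} (ha : Generated q S₀ a α) :
    Finsupp.single α a ∈ generatedSpace q S₀ := by
  intro β
  rw [Finsupp.single_apply]
  split_ifs with h
  · exact h ▸ ha
  · exact Generated.zero β

theorem generatedSpace_induction {p : generatedSpace q S₀ → Prop}
    (single : ∀ (α : ℕ) (a : OpSeries F L) (ha : Generated q S₀ a α),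
      p ⟨Finsupp.single α a, single_mem_generatedSpace ha⟩)
    (add : ∀ a b, p a → p b → p (a + b)) (a : generatedSpace q S₀) : p a := by
  have h : a = ∑ α ∈ a.1.support, ⟨Finsupp.single α (a.1 α), single_mem_generatedSpace (a.2 α)⟩ := by
    refine Subtype.ext ?_
    rw [AddSubmonoidClass.coe_finsetSum]
    exact (Finsupp.sum_single a.1).symm
  rw [h]
  refine Finset.sum_induction _ p add ?_ fun α _ => single α _ (a.2 α)
  have h0 : (0 : generatedSpace q S₀)
      = ⟨Finsupp.single 0 0, single_mem_generatedSpace (Generated.zero 0)⟩ :=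
    Subtype.ext (Finsupp.single_zero 0).symm
  rw [h0]
  exact single 0 0 (Generated.zero 0)

theorem product_mem_generatedSpace (hq : q ≠ 0) (hq1 : ∀ n : ℕ, 0 < n → q ^ n ≠ 1)
    (hS : ∀ l : List (OpSeries F L × ℕ), (∀ x ∈ l, x ∈ S₀) → QuasiCommList q l) (s : ℤ)
    {a b : OpSeriesT F L} (ha : a ∈ generatedSpace q S₀) (hb : b ∈ generatedSpace q S₀) :
    product q s a b ∈ generatedSpace q S₀ := by
  rcases le_or_gt 0 s with hs | hs
  · rw [product_of_nonneg hs]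
    exact zero_mem _
  · obtain ⟨r, rfl⟩ : ∃ r : ℕ, s = -(r : ℤ) - 1 := ⟨(-s - 1).toNat, by omega⟩
    rw [product_eq_sum hq hq1 r subset_rfl subset_rfl]
    exact Submodule.sum_mem _ fun α _ => Submodule.sum_mem _ fun β _ =>
      single_mem_generatedSpace ((ha α).homProduct hq hq1 hS (hb β) r)

theorem product_add_left (hq : q ≠ 0) (hq1 : ∀ n : ℕ, 0 < n → q ^ n ≠ 1)
    (hS : ∀ l : List (OpSeries F L × ℕ), (∀ x ∈ l, x ∈ S₀) → QuasiCommList q l) (s : ℤ)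
    {a a' b : OpSeriesT F L} (ha : a ∈ generatedSpace q S₀) (ha' : a' ∈ generatedSpace q S₀)
    (hb : b ∈ generatedSpace q S₀) :
    product q s (a + a') b = product q s a b + product q s a' b := by
  classical
  rcases le_or_gt 0 s with hs | hs
  · simp only [product_of_nonneg hs, add_zero]
  · obtain ⟨r, rfl⟩ : ∃ r : ℕ, s = -(r : ℤ) - 1 := ⟨(-s - 1).toNat, by omega⟩
    rw [product_eq_sum hq hq1 r (s := a.support ∪ a'.support) Finsupp.support_add subset_rfl,
      product_eq_sum hq hq1 r (s := a.support ∪ a'.support) Finset.subset_union_left subset_rfl,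
      product_eq_sum hq hq1 r (s := a.support ∪ a'.support) Finset.subset_union_right subset_rfl]
    simp only [← Finset.sum_add_distrib, ← Finsupp.single_add]
    refine Finset.sum_congr rfl fun α _ => Finset.sum_congr rfl fun β _ => ?_
    rw [Finsupp.add_apply,
      homProduct_add_left hq hq1 ((ha α).pair hq hq1 hS (hb β)) ((ha' α).pair hq hq1 hS (hb β))]

theorem product_smul_left (hq : q ≠ 0) (hq1 : ∀ n : ℕ, 0 < n → q ^ n ≠ 1)
    (hS : ∀ l : List (OpSeries F L × ℕ), (∀ x ∈ l, x ∈ S₀) → QuasiCommList q l) (s : ℤ) (x : F)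
    {a b : OpSeriesT F L} (ha : a ∈ generatedSpace q S₀) (hb : b ∈ generatedSpace q S₀) :
    product q s (x • a) b = x • product q s a b := by
  rcases le_or_gt 0 s with hs | hs
  · simp only [product_of_nonneg hs, smul_zero]
  · obtain ⟨r, rfl⟩ : ∃ r : ℕ, s = -(r : ℤ) - 1 := ⟨(-s - 1).toNat, by omega⟩
    rw [product_eq_sum hq hq1 r (s := a.support) Finsupp.support_smul subset_rfl,
      product_eq_sum hq hq1 r subset_rfl subset_rfl]
    simp only [Finset.smul_sum, Finsupp.smul_single]
    refine Finset.sum_congr rfl fun α _ => Finset.sum_congr rfl fun β _ => ?_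
    rw [Finsupp.smul_apply, homProduct_smul_left hq hq1 ((ha α).pair hq hq1 hS (hb β))]

theorem product_add_right (hq : q ≠ 0) (hq1 : ∀ n : ℕ, 0 < n → q ^ n ≠ 1)
    (hS : ∀ l : List (OpSeries F L × ℕ), (∀ x ∈ l, x ∈ S₀) → QuasiCommList q l) (s : ℤ)
    {a b b' : OpSeriesT F L} (ha : a ∈ generatedSpace q S₀) (hb : b ∈ generatedSpace q S₀)
    (hb' : b' ∈ generatedSpace q S₀) :
    product q s a (b + b') = product q s a b + product q s a b' := by
  classical
  rcases le_or_gt 0 s with hs | hs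
  · simp only [product_of_nonneg hs, add_zero]
  · obtain ⟨r, rfl⟩ : ∃ r : ℕ, s = -(r : ℤ) - 1 := ⟨(-s - 1).toNat, by omega⟩
    rw [product_eq_sum hq hq1 r (t := b.support ∪ b'.support) subset_rfl Finsupp.support_add,
      product_eq_sum hq hq1 r (t := b.support ∪ b'.support) subset_rfl Finset.subset_union_left,
      product_eq_sum hq hq1 r (t := b.support ∪ b'.support) subset_rfl Finset.subset_union_right]
    simp only [← Finset.sum_add_distrib, ← Finsupp.single_add]
    refine Finset.sum_congr rfl fun α _ => Finset.sum_congr rfl fun β _ => ?_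
    rw [Finsupp.add_apply,
      homProduct_add_right hq hq1 ((ha α).pair hq hq1 hS (hb β)) ((ha α).pair hq hq1 hS (hb' β))]

theorem product_smul_right (hq : q ≠ 0) (hq1 : ∀ n : ℕ, 0 < n → q ^ n ≠ 1)
    (hS : ∀ l : List (OpSeries F L × ℕ), (∀ x ∈ l, x ∈ S₀) → QuasiCommList q l) (s : ℤ) (x : F)
    {a b : OpSeriesT F L} (ha : a ∈ generatedSpace q S₀) (hb : b ∈ generatedSpace q S₀) :
    product q s a (x • b) = x • product q s a b := by
  rcases le_or_gt 0 s with hs | hs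
  · simp only [product_of_nonneg hs, smul_zero]
  · obtain ⟨r, rfl⟩ : ∃ r : ℕ, s = -(r : ℤ) - 1 := ⟨(-s - 1).toNat, by omega⟩
    rw [product_eq_sum hq hq1 r (t := b.support) subset_rfl Finsupp.support_smul,
      product_eq_sum hq hq1 r subset_rfl subset_rfl]
    simp only [Finset.smul_sum, Finsupp.smul_single]
    refine Finset.sum_congr rfl fun α _ => Finset.sum_congr rfl fun β _ => ?_
    rw [Finsupp.smul_apply, homProduct_smul_right hq hq1 ((ha α).pair hq hq1 hS (hb β))]

/-- The vertex operator map of the generated space, given by the products of `ℰ(L)_t`. -/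
def vertexOperator (hq : q ≠ 0) (hq1 : ∀ n : ℕ, 0 < n → q ^ n ≠ 1)
    (hS : ∀ l : List (OpSeries F L × ℕ), (∀ x ∈ l, x ∈ S₀) → QuasiCommList q l) :
    generatedSpace q S₀ →ₗ[F] (ℤ → Module.End F (generatedSpace q S₀)) :=
  LinearMap.pi fun s => LinearMap.mk₂ F
    (fun a b => ⟨product q s a.1 b.1, product_mem_generatedSpace hq hq1 hS s a.2 b.2⟩)
    (fun a a' b => Subtype.ext (product_add_left hq hq1 hS s a.2 a'.2 b.2))
    (fun x a b => Subtype.ext (product_smul_left hq hq1 hS s x a.2 b.2))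
    (fun a b b' => Subtype.ext (product_add_right hq hq1 hS s a.2 b.2 b'.2))
    (fun x a b => Subtype.ext (product_smul_right hq hq1 hS s x a.2 b.2))

theorem vertexOperator_of_nonneg (hq : q ≠ 0) (hq1 : ∀ n : ℕ, 0 < n → q ^ n ≠ 1)
    (hS : ∀ l : List (OpSeries F L × ℕ), (∀ x ∈ l, x ∈ S₀) → QuasiCommList q l)
    (a b : generatedSpace q S₀) {s : ℤ} (hs : 0 ≤ s) : vertexOperator hq hq1 hS a s b = 0 :=
  Subtype.ext (product_of_nonneg hs _ _)

theorem vertexOperator_single (hq : q ≠ 0) (hq1 : ∀ n : ℕ, 0 < n → q ^ n ≠ 1)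
    (hS : ∀ l : List (OpSeries F L × ℕ), (∀ x ∈ l, x ∈ S₀) → QuasiCommList q l)
    {a b : OpSeries F L} {α β : ℕ} (ha : Generated q S₀ a α) (hb : Generated q S₀ b β) {s : ℤ}
    (r : ℕ) (hs : s = -(r : ℤ) - 1) :
    vertexOperator hq hq1 hS ⟨Finsupp.single α a, single_mem_generatedSpace ha⟩ s
        ⟨Finsupp.single β b, single_mem_generatedSpace hb⟩
      = ⟨Finsupp.single (α + β + r) (homProduct q r α a b),
          single_mem_generatedSpace (ha.homProduct hq hq1 hS hb r)⟩ := by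
  subst hs
  exact Subtype.ext (product_single_single hq hq1 r α β a b)

/-- The weight spaces of a subspace of `ℰ(L)_t`. -/
def weightSpace (V : Submodule F (OpSeriesT F L)) (u : ℤ) : Submodule F V where
  carrier := {a | HasWeight u (a : OpSeriesT F L)}
  zero_mem' := fun _ _ => rfl
  add_mem' := fun {a b} ha hb α hα => by
    change (a : OpSeriesT F L) α + (b : OpSeriesT F L) α = 0
    rw [ha α hα, hb α hα, add_zero]
  smul_mem' := fun c a ha α hα => by
    change c • (a : OpSeriesT F L) α = 0
    rw [ha α hα, smul_zero]

theorem hasWeight_single (α : ℕ) (a : OpSeries F L) :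
    HasWeight (α : ℤ) (Finsupp.single α a : OpSeriesT F L) := fun β hβ =>
  Finsupp.single_eq_of_ne (by exact_mod_cast hβ)

/-- A homogeneous element is `0` or of the form `a(z) ⊗ t^α`. -/
theorem HasWeight.eq {u : ℤ} {a : OpSeriesT F L} (h : HasWeight u a) :
    a = 0 ∨ ∃ α : ℕ, (α : ℤ) = u ∧ a = Finsupp.single α (a α) := by
  rcases lt_or_ge u 0 with hu | hu
  · exact Or.inl (Finsupp.ext fun α => h α (by omega))
  · refine Or.inr ⟨u.toNat, by omega, Finsupp.ext fun β => ?_⟩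
    rw [Finsupp.single_apply]
    split_ifs with hβ
    · rw [hβ]
    · exact h β (by omega)

theorem weightSpace_isInternal (q : F) (S₀ : Set (OpSeries F L × ℕ)) :
    DirectSum.IsInternal (weightSpace (generatedSpace q S₀)) := by
  constructor
  · intro x y hxy
    refine DFinsupp.ext fun u => Subtype.ext (Subtype.ext (Finsupp.ext fun α => ?_))
    by_cases hα : (α : ℤ) = u
    · subst hα
      let ev : generatedSpace q S₀ →+ OpSeries F L :=
        (Finsupp.applyAddHom α).comp (generatedSpace q S₀).subtype.toAddMonoidHom
      have h : ev.comp (DirectSum.coeAddMonoidHom (weightSpace (generatedSpace q S₀)))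
          = (ev.comp (weightSpace (generatedSpace q S₀) α).subtype.toAddMonoidHom).comp
            (DFinsupp.evalAddMonoidHom (α : ℤ)) := by
        refine DirectSum.addHom_ext fun u y => ?_
        rw [AddMonoidHom.comp_apply, DirectSum.coeAddMonoidHom_of]
        change ev y = ev (DirectSum.of (fun u => weightSpace (generatedSpace q S₀) u) u y (α : ℤ))
        by_cases hu : (α : ℤ) = u
        · subst hu
          rw [DirectSum.of_eq_same]
        · rw [DirectSum.of_eq_of_ne _ _ _ hu]
          exact y.2 α hu
      have hx := DFunLike.congr_fun h x
      have hy := DFunLike.congr_fun h y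
      exact hx.symm.trans ((congrArg ev hxy).trans hy)
    · exact ((x u).2 α hα).trans ((y u).2 α hα).symm
  · intro a
    refine generatedSpace_induction (p := fun a => ∃ x, DirectSum.coeAddMonoidHom
      (weightSpace (generatedSpace q S₀)) x = a) (fun α a ha => ?_) (fun a b ha hb => ?_) a
    · exact ⟨DirectSum.of (fun u => weightSpace (generatedSpace q S₀) u) (α : ℤ)
        ⟨⟨Finsupp.single α a, single_mem_generatedSpace ha⟩, hasWeight_single α a⟩, by simp⟩
    · obtain ⟨x, rfl⟩ := ha
      obtain ⟨y, rfl⟩ := hb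
      exact ⟨x + y, map_add _ _ _⟩

theorem qBinom_eq_zero (q : F) {m : ℤ} {l : ℕ} (h0 : 0 ≤ m) (hl : m < l) : qBinom q m l = 0 := by
  rw [qBinom, Finset.prod_eq_zero (i := m.toNat) (Finset.mem_range.2 (by omega)), zero_div]
  rw [Int.toNat_of_nonneg h0, sub_self, qInt_zero]

/-- Associativity for homogeneous elements. -/
theorem vertexOperator_assoc_single (hq : q ≠ 0) (hq1 : ∀ n : ℕ, 0 < n → q ^ n ≠ 1)
    (hS : ∀ l : List (OpSeries F L × ℕ), (∀ x ∈ l, x ∈ S₀) → QuasiCommList q l)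
    {a b c : OpSeries F L} {α β γ : ℕ} (ha : Generated q S₀ a α) (hb : Generated q S₀ b β)
    (hc : Generated q S₀ c γ) (i j : ℕ) :
    ∑ l ∈ Finset.range (j + 1), ((q ^ α) ^ (j - l) * qBinom q ((i : ℤ) + l) l * q ^ ((j - l) * i)) •
        vertexOperator hq hq1 hS ⟨Finsupp.single α a, single_mem_generatedSpace ha⟩
          (-(i : ℤ) - l - 1) (vertexOperator hq hq1 hS
            ⟨Finsupp.single β b, single_mem_generatedSpace hb⟩ ((l : ℤ) - j - 1)
            ⟨Finsupp.single γ c, single_mem_generatedSpace hc⟩)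
      = vertexOperator hq hq1 hS (vertexOperator hq hq1 hS
          ⟨Finsupp.single α a, single_mem_generatedSpace ha⟩ (-(i : ℤ) - 1)
          ⟨Finsupp.single β b, single_mem_generatedSpace hb⟩) (-(j : ℤ) - 1)
          ⟨Finsupp.single γ c, single_mem_generatedSpace hc⟩ := by
  rw [vertexOperator_single hq hq1 hS ha hb i rfl,
    vertexOperator_single hq hq1 hS (ha.homProduct hq hq1 hS hb i) hc j rfl]
  refine Subtype.ext ?_
  rw [AddSubmonoidClass.coe_finsetSum]
  have hassoc := Generated.assoc hq hq1 hS ha hb hc (ha.homProduct hq hq1 hS hb i)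
    (fun k => hb.homProduct hq hq1 hS hc k) (i := i) (j := j)
  simp only [hassoc]
  rw [Finset.Nat.sum_antidiagonal_eq_sum_range_succ_mk, Finsupp.single_finsetSum]
  refine Finset.sum_congr rfl fun l hl => ?_
  have hlj : l ≤ j := Nat.lt_succ_iff.1 (Finset.mem_range.1 hl)
  rw [vertexOperator_single hq hq1 hS hb hc (j - l) (by omega),
    vertexOperator_single hq hq1 hS ha (hb.homProduct hq hq1 hS hc _) (i + l) (by push_cast; ring)]
  change _ • Finsupp.single _ _ = _
  rw [Finsupp.smul_single]
  congr 1
  omega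

theorem vertexOperator_assoc_nat (hq : q ≠ 0) (hq1 : ∀ n : ℕ, 0 < n → q ^ n ≠ 1)
    (hS : ∀ l : List (OpSeries F L × ℕ), (∀ x ∈ l, x ∈ S₀) → QuasiCommList q l)
    {a : OpSeries F L} {α : ℕ} (ha : Generated q S₀ a α) (b c : generatedSpace q S₀) (i j : ℕ) :
    ∑ l ∈ Finset.range (j + 1), ((q ^ α) ^ (j - l) * qBinom q ((i : ℤ) + l) l * q ^ ((j - l) * i)) •
        vertexOperator hq hq1 hS ⟨Finsupp.single α a, single_mem_generatedSpace ha⟩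
          (-(i : ℤ) - l - 1) (vertexOperator hq hq1 hS b ((l : ℤ) - j - 1) c)
      = vertexOperator hq hq1 hS (vertexOperator hq hq1 hS
          ⟨Finsupp.single α a, single_mem_generatedSpace ha⟩ (-(i : ℤ) - 1) b) (-(j : ℤ) - 1) c := by
  induction b using generatedSpace_induction with
  | add b b' hb hb' =>
    simp only [map_add, Pi.add_apply, LinearMap.add_apply, smul_add, Finset.sum_add_distrib, hb, hb']
  | single β b hb =>
    induction c using generatedSpace_induction with
    | add c c' hc hc' =>
      simp only [map_add, smul_add, Finset.sum_add_distrib, hc, hc']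
    | single γ c hc => exact vertexOperator_assoc_single hq hq1 hS ha hb hc i j

theorem vertexOperator_assoc (hq : q ≠ 0) (hq1 : ∀ n : ℕ, 0 < n → q ^ n ≠ 1)
    (hS : ∀ l : List (OpSeries F L × ℕ), (∀ x ∈ l, x ∈ S₀) → QuasiCommList q l) {u : ℤ}
    {a : generatedSpace q S₀} (ha : HasWeight u a.1) (b c : generatedSpace q S₀) (i j : ℤ) :
    assocLeft q (vertexOperator hq hq1 hS) u a b c i j
      = assocRight (vertexOperator hq hq1 hS) a b c i j := by
  have hY := fun a b s (hs : 0 ≤ s) => vertexOperator_of_nonneg hq hq1 hS a b (s := s) hs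
  set Y := vertexOperator hq hq1 hS with hYdef
  rw [assocLeft, assocRight]
  rcases lt_or_ge j 0 with hj | hj
  · rw [hY _ _ _ (by omega)]
    refine (finsum_congr fun l => ?_).trans finsum_zero
    rw [hY b c _ (by omega), map_zero, smul_zero]
  rcases lt_or_ge i 0 with hi | hi
  · rw [hY a b _ (by omega), map_zero]
    refine (finsum_congr fun l => ?_).trans finsum_zero
    rcases lt_or_ge (i + l) 0 with hl | hl
    · rw [hY a _ _ (by omega), smul_zero]
    · rw [qBinom_eq_zero q hl (by omega), mul_zero, zero_mul, zero_smul]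
  obtain ⟨i, rfl⟩ := Int.eq_ofNat_of_zero_le hi
  obtain ⟨j, rfl⟩ := Int.eq_ofNat_of_zero_le hj
  rcases ha.eq with h0 | ⟨α, rfl, h⟩
  · have : a = 0 := Subtype.ext h0
    subst this
    refine (finsum_congr fun l => ?_).trans (finsum_zero.trans ?_)
    · simp
    · simp
  have hgen : Generated q S₀ (a.1 α) α := a.2 α
  have haeq : a = ⟨Finsupp.single α (a.1 α), single_mem_generatedSpace hgen⟩ := Subtype.ext h
  rw [haeq]
  refine Eq.trans ?_ (vertexOperator_assoc_nat hq hq1 hS hgen b c i j)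
  rw [finsum_eq_sum_of_support_subset (s := Finset.range (j + 1))]
  · refine Finset.sum_congr rfl fun l hl => ?_
    have hlj : l ≤ j := Nat.lt_succ_iff.1 (Finset.mem_range.1 hl)
    have hc : ((j : ℤ) - l) = ((j - l : ℕ) : ℤ) := by omega
    rw [hc, zpow_natCast, zpow_natCast, ← Nat.cast_mul, zpow_natCast]
  · intro l hl
    by_contra hlr
    have hlj : j < l := by simpa using hlr
    refine hl ?_
    beta_reduce
    rw [hY b c _ (by omega), map_zero, smul_zero]

theorem vacuum_mem_generatedSpace : vacuum F L ∈ generatedSpace q S₀ :=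
  single_mem_generatedSpace Generated.one

/-- The graded nonlocal `q`-vertex algebra structure on the generated space. -/
def generatedVA (hq : q ≠ 0) (hq1 : ∀ n : ℕ, 0 < n → q ^ n ≠ 1)
    (hS : ∀ l : List (OpSeries F L × ℕ), (∀ x ∈ l, x ∈ S₀) → QuasiCommList q l) :
    GradedNonlocalVA F (generatedSpace q S₀) q where
  grading := weightSpace (generatedSpace q S₀)
  grading_internal := weightSpace_isInternal q S₀
  Y := vertexOperator hq hq1 hS
  one := ⟨vacuum F L, vacuum_mem_generatedSpace⟩
  truncation a b := ⟨0, fun _ hr => vertexOperator_of_nonneg hq hq1 hS a b hr⟩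
  vacuum_left r b := by
    rcases le_or_gt 0 r with hr | hr
    · rw [vertexOperator_of_nonneg hq hq1 hS _ _ hr, if_neg (by omega)]
    obtain ⟨k, rfl⟩ : ∃ k : ℕ, r = -(k : ℤ) - 1 := ⟨(-r - 1).toNat, by omega⟩
    induction b using generatedSpace_induction with
    | add b b' hb hb' =>
      rw [map_add, hb, hb']
      split_ifs
      · rfl
      · rw [add_zero]
    | single β b hb =>
      have hp := Generated.one.pair hq hq1 hS hb
      refine (vertexOperator_single hq hq1 hS Generated.one hb k rfl).trans (Subtype.ext ?_)
      cases k with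
      | zero =>
        change Finsupp.single _ _ = _
        rw [homProduct_one_left hq hq1 hp, if_pos (by simp), zero_add, add_zero]
      | succ k =>
        change Finsupp.single _ _ = _
        rw [homProduct_one_left_succ hq hq1 k hp, if_neg (by push_cast; omega), Finsupp.single_zero]
        rfl
  creation a := by
    refine ⟨fun r hr => vertexOperator_of_nonneg hq hq1 hS _ _ hr, ?_⟩
    induction a using generatedSpace_induction with
    | add a a' ha ha' =>
      rw [map_add, Pi.add_apply, LinearMap.add_apply, ha, ha']
    | single α a ha =>
      have hp := ha.pair hq hq1 hS Generated.one
      refine (vertexOperator_single hq hq1 hS ha Generated.one 0 (by simp)).trans (Subtype.ext ?_)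
      change Finsupp.single _ _ = Finsupp.single _ _
      rw [homProduct_one_right hq hq1 hp, add_zero, add_zero]
  grading_mul u s r a b ha hb := by
    rcases le_or_gt 0 r with hr | hr
    · rw [vertexOperator_of_nonneg hq hq1 hS _ _ hr]
      exact zero_mem _
    obtain ⟨k, rfl⟩ : ∃ k : ℕ, r = -(k : ℤ) - 1 := ⟨(-r - 1).toNat, by omega⟩
    rcases HasWeight.eq ha with h0 | ⟨α, rfl, h⟩
    · rw [show a = 0 from Subtype.ext h0]
      simp
    rcases HasWeight.eq hb with h0 | ⟨β, rfl, h'⟩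
    · rw [show b = 0 from Subtype.ext h0]
      simp
    change HasWeight _ (product q _ a.1 b.1)
    rw [h, h', product_single_single hq hq1]
    convert hasWeight_single _ _ using 1
    push_cast
    ring
  assoc u a b c ha i j := vertexOperator_assoc hq hq1 hS ha b c i j

theorem isQuasiCommSet_generatedSpace (hq : q ≠ 0) (hq1 : ∀ n : ℕ, 0 < n → q ^ n ≠ 1)
    (hS : ∀ l : List (OpSeries F L × ℕ), (∀ x ∈ l, x ∈ S₀) → QuasiCommList q l) :
    IsQuasiCommSet q (generatedSpace q S₀ : Set (OpSeriesT F L)) := by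
  intro m a ha α
  refine QuasiComm.isQuasiCommHom ((quasiCommList_ofFn _ _).1
    (quasiCommList_of_generated hq hq1 hS _ ?_))
  simp only [List.mem_ofFn]
  rintro x ⟨k, rfl⟩
  exact ha k (α k)

theorem isGradedNonlocalVA_generatedSpace (hq : q ≠ 0) (hq1 : ∀ n : ℕ, 0 < n → q ^ n ≠ 1)
    (hS : ∀ l : List (OpSeries F L × ℕ), (∀ x ∈ l, x ∈ S₀) → QuasiCommList q l) :
    IsGradedNonlocalVA q (generatedSpace q S₀) := by
  refine ⟨fun a ha b hb => isQuasiCommSet_generatedSpace hq hq1 hS 2 ![a, b] fun k => ?_,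
    generatedVA hq hq1 hS, fun a b s => rfl, rfl, fun u a => Iff.rfl⟩
  fin_cases k
  · exact ha
  · exact hb

/-- Every monomial lies in each graded nonlocal vertex algebra containing the generators. -/
theorem monomials_subset {V : Submodule F (OpSeriesT F L)} (hV : IsGradedNonlocalVA q V)
    {S : Set (OpSeriesT F L)} (hS : S ⊆ V) : monomials q S ⊆ V := by
  obtain ⟨-, W, hY, hone, -⟩ := hV
  rintro w ⟨l, hl, rfl⟩
  induction l with
  | nil => exact hone ▸ W.one.2
  | cons x l ih =>
    have h1 := hS (hl x List.mem_cons_self).1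
    have h2 := ih fun y hy => hl y (List.mem_cons_of_mem _ hy)
    rw [List.foldr_cons]
    have := hY ⟨x.1, h1⟩ ⟨_, h2⟩ x.2
    exact this ▸ Subtype.coe_prop _

theorem generatedSpace_eq_span (hq : q ≠ 0) (hq1 : ∀ n : ℕ, 0 < n → q ^ n ≠ 1)
    (hS : ∀ l : List (OpSeries F L × ℕ), (∀ x ∈ l, x ∈ S₀) → QuasiCommList q l) :
    generatedSpace q S₀
      = Submodule.span F (monomials q ((fun x => Finsupp.single x.2 x.1) '' S₀)) := by
  have hsub : (fun x : OpSeries F L × ℕ => (Finsupp.single x.2 x.1 : OpSeriesT F L)) '' S₀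
      ⊆ generatedSpace q S₀ := by
    rintro _ ⟨x, hx, rfl⟩
    exact single_mem_generatedSpace (Generated.of_mem hq hq1 hS hx)
  have hmono := monomials_subset (isGradedNonlocalVA_generatedSpace hq hq1 hS) hsub
  refine le_antisymm ?_ (Submodule.span_le.2 hmono)
  set T := Submodule.span F (monomials q
    ((fun x : OpSeries F L × ℕ => (Finsupp.single x.2 x.1 : OpSeriesT F L)) '' S₀)) with hT
  have key : ∀ (a : OpSeries F L) (α : ℕ), Generated q S₀ a α → Finsupp.single α a ∈ T := by
    intro a α ha
    induction ha with
    | one => exact Submodule.subset_span ⟨[], by simp, rfl⟩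
    | zero α =>
      rw [Finsupp.single_zero]
      exact zero_mem _
    | add _ _ h h' =>
      rw [Finsupp.single_add]
      exact add_mem h h'
    | smul c _ h =>
      rw [← Finsupp.smul_single]
      exact Submodule.smul_mem _ c h
    | @mul a b α β r ha hb h =>
      rw [← product_single_single hq hq1]
      set x : OpSeriesT F L := Finsupp.single α a with hx
      have hxm : x ∈ generatedSpace q S₀ := hsub ⟨(a, α), ha, rfl⟩
      have hTV : T ≤ generatedSpace q S₀ := Submodule.span_le.2 hmono
      generalize (Finsupp.single β b : OpSeriesT F L) = y at h ⊢
      induction h using Submodule.span_induction with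
      | mem w hw =>
        obtain ⟨l, hl, rfl⟩ := hw
        refine Submodule.subset_span ⟨(x, -(r : ℤ) - 1) :: l, ?_, rfl⟩
        intro y hy
        rcases List.mem_cons.1 hy with rfl | hy
        · exact ⟨⟨(a, α), ha, rfl⟩, by simp only; omega⟩
        · exact hl y hy
      | zero =>
        have := product_smul_right hq hq1 hS (-(r : ℤ) - 1) 0 hxm (zero_mem _)
        rw [smul_zero, zero_smul] at this
        rw [this]
        exact zero_mem _
      | add w w' hw hw' h h' =>
        rw [product_add_right hq hq1 hS _ hxm (hTV hw) (hTV hw')]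
        exact add_mem h h'
      | smul c w hw h =>
        rw [product_smul_right hq hq1 hS _ c hxm (hTV hw)]
        exact Submodule.smul_mem _ c h
  intro w hw
  rw [← Finsupp.sum_single w]
  exact Submodule.sum_mem _ fun α _ => key _ α (hw α)

/-- If all finite sequences of generators are quasi-commutative, the span of the monomials is the
smallest graded nonlocal `q`-vertex algebra containing the generators. -/
theorem isLeast_generatedSpace (hq : q ≠ 0) (hq1 : ∀ n : ℕ, 0 < n → q ^ n ≠ 1)
    (hS : ∀ l : List (OpSeries F L × ℕ), (∀ x ∈ l, x ∈ S₀) → QuasiCommList q l) :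
    IsLeast {W | IsGradedNonlocalVA q W ∧
      (fun x : OpSeries F L × ℕ => (Finsupp.single x.2 x.1 : OpSeriesT F L)) '' S₀ ⊆ W}
      (generatedSpace q S₀) := by
  refine ⟨⟨isGradedNonlocalVA_generatedSpace hq hq1 hS, ?_⟩, fun W hW => ?_⟩
  · rintro _ ⟨x, hx, rfl⟩
    exact single_mem_generatedSpace (Generated.of_mem hq hq1 hS hx)
  · rw [generatedSpace_eq_span hq hq1 hS]
    exact Submodule.span_le.2 (monomials_subset hW.1 hW.2)

end GeneratedSpace

/-! ### Exchange relations -/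

section Exchange

variable {F : Type*} [Field F] {L : Type*} [AddCommGroup L] [Module F L] {m : ℕ}

/-- `Y_{w_1}(z_{w_1}) ⋯ Y_{w_l}(z_{w_l})` for a list `w` of indices, as a formal distribution in all
the variables. -/
def orderedProd (Y : Fin m → ℤ → Module.End F L) (w : List (Fin m)) : Distribution F L m :=
  fun n => (w.map fun k => Y k (n k)).prod

theorem mulDist_eq_orderedProd (Y : Fin m → ℤ → Module.End F L) :
    mulDist Y = orderedProd Y (List.finRange m) := by
  funext n
  rw [mulDist, orderedProd, List.ofFn_eq_map]

/-- The exchange relation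
`(1 - c z_j/z_i) a(z_i) b(z_j) = (d - e z_j/z_i) b(z_j) a(z_i)`. -/
def Exchange (a b : ℤ → Module.End F L) (c d e : F) : Prop :=
  ∀ k l : ℤ, a k * b l - c • (a (k + 1) * b (l - 1)) = d • (b l * a k) - e • (b (l - 1) * a (k + 1))

theorem ratioPoly_linear_convMul {M : Type*} [AddCommGroup M] [Module F M] (x y : F) (i j : Fin m)
    (X : (Fin m → ℤ) → M) (n : Fin m → ℤ) :
    convMul (ratioPoly F (Polynomial.C x - Polynomial.C y * Polynomial.X) i j) X n
      = x • X n - y • X (n - (Pi.single j (1 : ℤ) - Pi.single i (1 : ℤ))) := by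
  have hdeg : (Polynomial.C x - Polynomial.C y * Polynomial.X).natDegree < 2 := by
    have h1 : (Polynomial.C x - Polynomial.C y * Polynomial.X).natDegree ≤ 1 := by compute_degree
    omega
  rw [ratioPoly_convMul, Polynomial.sum_over_range' _ _ 2 hdeg]
  · simp [Finset.sum_range_succ, Polynomial.coeff_X, Polynomial.coeff_C, sub_eq_add_neg]
  · intro k
    rw [zero_smul]

theorem orderedProd_congr {Y : Fin m → ℤ → Module.End F L} {w : List (Fin m)} {n n' : Fin m → ℤ}
    (h : ∀ k ∈ w, n k = n' k) : orderedProd Y w n = orderedProd Y w n' := by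
  unfold orderedProd
  rw [List.map_congr_left fun k hk => by rw [h k hk]]

/-- Up to a factor, two adjacent fields in a product satisfying an exchange relation may be
swapped. -/
theorem orderedProd_swap {Y : Fin m → ℤ → Module.End F L} {u t : List (Fin m)} {i j : Fin m}
    (hij : i ≠ j) (hi : i ∉ u ∧ i ∉ t) (hj : j ∉ u ∧ j ∉ t) {c d e : F}
    (h : Exchange (Y i) (Y j) c d e) (v : L) :
    convMul (ratioPoly F (Polynomial.C 1 - Polynomial.C c * Polynomial.X) i j)
        (fun n => orderedProd Y (u ++ i :: j :: t) n v)
      = convMul (ratioPoly F (Polynomial.C d - Polynomial.C e * Polynomial.X) i j)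
        (fun n => orderedProd Y (u ++ j :: i :: t) n v) := by
  funext n
  rw [ratioPoly_linear_convMul, ratioPoly_linear_convMul]
  set n' := n - (Pi.single j (1 : ℤ) - Pi.single i (1 : ℤ)) with hn'
  have hn'i : n' i = n i + 1 := by simp [hn', hij]
  have hn'j : n' j = n j - 1 := by simp [hn', hij.symm]
  have hn'k : ∀ k, k ≠ i → k ≠ j → n' k = n k := fun k h1 h2 => by simp [hn', h1, h2]
  have hsplit : ∀ (k l : Fin m) (n : Fin m → ℤ), orderedProd Y (u ++ k :: l :: t) n
      = orderedProd Y u n * (Y k (n k) * Y l (n l)) * orderedProd Y t n := by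
    intro k l n
    simp only [orderedProd, List.map_append, List.map_cons, List.prod_append, List.prod_cons,
      mul_assoc]
  have hu : orderedProd Y u n' = orderedProd Y u n := orderedProd_congr fun k hk =>
    hn'k k (fun h => hi.1 (h ▸ hk)) fun h => hj.1 (h ▸ hk)
  have ht : orderedProd Y t n' = orderedProd Y t n := orderedProd_congr fun k hk =>
    hn'k k (fun h => hi.2 (h ▸ hk)) fun h => hj.2 (h ▸ hk)
  simp only [hsplit, hu, ht, hn'i, hn'j, ← LinearMap.smul_apply, ← LinearMap.sub_apply]
  congr 1
  have := congrArg (fun x => orderedProd Y u n * x * orderedProd Y t n) (h (n i) (n j))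
  simpa only [mul_sub, sub_mul, mul_smul_comm, smul_mul_assoc, one_smul] using this

/-- Moving the field `Y_i` to the right end of a product shows that, up to a factor, the product has
only finitely many negative powers of `z_i`. -/
theorem boundedBelowIn_orderedProd {Y : Fin m → ℤ → Module.End F L}
    (hY : ∀ i v, ∃ N : ℤ, ∀ n < N, Y i n v = 0) {c d e : Fin m → Fin m → F} {i : Fin m}
    (hex : ∀ j, i < j → Exchange (Y i) (Y j) (c i j) (d i j) (e i j)) (v : L) (t : List (Fin m)) :
    ∀ u : List (Fin m), (u ++ i :: t).Nodup → (∀ j ∈ t, i < j) →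
      BoundedBelowIn i (convMul (t.map fun j =>
        ratioPoly F (Polynomial.C 1 - Polynomial.C (c i j) * Polynomial.X) i j).prod
          fun n => orderedProd Y (u ++ i :: t) n v) := by
  induction t with
  | nil =>
    intro u _ _
    rw [List.map_nil, List.prod_nil, one_convMul]
    obtain ⟨N, hN⟩ := hY i v
    refine ⟨N, fun n hn => ?_⟩
    simp only [orderedProd, List.map_append, List.map_cons, List.map_nil, List.prod_append,
      List.prod_cons, List.prod_nil, mul_one, Module.End.mul_apply]
    rw [hN _ hn, map_zero]
  | cons j t ih =>
    intro u hnd hlt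
    have hij : i < j := hlt j List.mem_cons_self
    have hperm : (u ++ i :: j :: t).Perm ((u ++ [j]) ++ i :: t) := by
      rw [List.append_assoc]
      exact (List.Perm.swap j i t).append_left u
    have h1 : i ∉ u ∧ i ∉ t := by
      simp only [List.nodup_append, List.nodup_cons, List.mem_cons, ne_eq] at hnd
      exact ⟨fun h => hnd.2.2 i h i (Or.inl rfl) rfl, fun h => hnd.2.1.1 (Or.inr h)⟩
    have h2 : j ∉ u ∧ j ∉ t := by
      simp only [List.nodup_append, List.nodup_cons, List.mem_cons, ne_eq] at hnd
      exact ⟨fun h => hnd.2.2 j h j (Or.inr (Or.inl rfl)) rfl, hnd.2.1.2.1⟩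
    have := (ih (u ++ [j]) (hperm.nodup_iff.1 hnd) fun k hk =>
      hlt k (List.mem_cons_of_mem _ hk)).convMul
        (ratioPoly F (Polynomial.C (d i j) - Polynomial.C (e i j) * Polynomial.X) i j)
    rw [convMul_comm, List.append_assoc, List.singleton_append,
      ← orderedProd_swap hij.ne h1 h2 (hex j hij), convMul_comm, ← convMul_mul] at this
    rwa [List.map_cons, List.prod_cons]

/-- Fields which satisfy exchange relations have a regular product. -/
theorem regular_of_exchange {q : F} {Y : Fin m → ℤ → Module.End F L}
    (hY : ∀ i v, ∃ N : ℤ, ∀ n < N, Y i n v = 0)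
    (hex : ∀ i j, i < j → ∃ c d e : F, (∀ n : ℕ, 1 - c * q ^ n ≠ 0) ∧ Exchange (Y i) (Y j) c d e) :
    Regular q (mulDist Y) := by
  have hex' : ∀ i j, ∃ c d e : F, i < j →
      (∀ n : ℕ, 1 - c * q ^ n ≠ 0) ∧ Exchange (Y i) (Y j) c d e := by
    intro i j
    by_cases hij : i < j
    · obtain ⟨c, d, e, h⟩ := hex i j hij
      exact ⟨c, d, e, fun _ => h⟩
    · exact ⟨0, 0, 0, fun h => absurd h hij⟩
  choose c d e hcde using hex'
  set f : Fin m → Fin m → AddMonoidAlgebra F (Fin m → ℤ) := fun i j =>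
    ratioPoly F (Polynomial.C 1 - Polynomial.C (c i j) * Polynomial.X) i j with hf
  refine ⟨∏ i, ∏ j ∈ Finset.Ioi i, f i j, ?_, fun v => laurent_iff.2 fun i => ?_⟩
  · refine prod_mem fun i _ => prod_mem fun j hj => ?_
    have hij := Finset.mem_Ioi.1 hj
    refine ratioPoly_mem_regularizers (fun n => ?_) hij.le
    simpa using (hcde i j hij).1 n
  · obtain ⟨u, t, hut⟩ := List.append_of_mem (List.mem_finRange i)
    have hnd : (u ++ i :: t).Nodup := hut ▸ List.nodup_finRange m
    have hlt : ∀ j ∈ t, i < j := by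
      have hs : (u ++ i :: t).Pairwise (· < ·) := hut ▸ List.pairwise_lt_finRange m
      exact fun j hj => List.rel_of_pairwise_cons (List.pairwise_append.1 hs).2.1 hj
    have hb := boundedBelowIn_orderedProd hY (fun j hij => (hcde i j hij).2) v t u hnd hlt
    have htnd : t.Nodup := (List.nodup_cons.1 (List.nodup_append.1 hnd).2.1).2
    have hdvd : (t.map fun j => f i j).prod ∣ ∏ i, ∏ j ∈ Finset.Ioi i, f i j := by
      rw [← List.prod_toFinset _ htnd]
      refine (Finset.prod_dvd_prod_of_subset _ _ _ fun j hj => ?_).trans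
        (Finset.dvd_prod_of_mem _ (Finset.mem_univ i))
      exact Finset.mem_Ioi.2 (hlt j (List.mem_toFinset.1 hj))
    obtain ⟨R, hR⟩ := hdvd
    rw [hR, mul_comm, convMul_mul, mulDist_eq_orderedProd, hut]
    exact hb.convMul R

theorem Exchange.rescale {a b : ℤ → Module.End F L} {c d e : F} (h : Exchange a b c d e) {s s' : F}
    (hs : s ≠ 0) (hs' : s' ≠ 0) :
    Exchange (rescale s a) (rescale s' b) (c * (s' / s)) d (e * (s' / s)) := by
  intro k l
  have h1 : s' / s * s ^ (k + 1) * s' ^ (l - 1) = s ^ k * s' ^ l := by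
    rw [zpow_add_one₀ hs, zpow_sub_one₀ hs']
    field_simp
  have h2 : ∀ x : F, x * (s' / s) * (s ^ (k + 1) * s' ^ (l - 1)) = s ^ k * s' ^ l * x := by
    intro x
    rw [← h1]
    ring
  have h3 : ∀ x : F, x * (s' / s) * (s' ^ (l - 1) * s ^ (k + 1)) = s ^ k * s' ^ l * x := by
    intro x
    rw [← h1]
    ring
  have h4 : ∀ x : F, x * (s' ^ l * s ^ k) = s ^ k * s' ^ l * x := fun x => by ring
  have := congrArg (fun x => (s ^ k * s' ^ l) • x) (h k l)
  simpa only [QVA.rescale, smul_mul_smul_comm, smul_smul, h2, h3, h4, smul_sub] using this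

end Exchange

/-! ### Currents of quantum affine algebras -/

section QuantumAffine

theorem qq_ne_zero : qq ≠ 0 := pow_ne_zero 2 RatFunc.X_ne_zero

theorem qq_zpow_ne_one {k : ℤ} (hk : k ≠ 0) : qq ^ k ≠ 1 := by
  have hnat : ∀ n : ℕ, n ≠ 0 → qq ^ n ≠ 1 := by
    intro n hn h
    rw [qq, ← pow_mul] at h
    have h1 : algebraMap (Polynomial ℂ) (RatFunc ℂ) (Polynomial.X ^ (2 * n))
        = algebraMap (Polynomial ℂ) (RatFunc ℂ) 1 := by
      rw [map_pow, RatFunc.algebraMap_X, map_one, h]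
    have h2 := congrArg Polynomial.natDegree (RatFunc.algebraMap_injective ℂ h1)
    rw [Polynomial.natDegree_X_pow, Polynomial.natDegree_one] at h2
    omega
  intro h
  rcases Int.natAbs_eq k with hk' | hk'
  · rw [hk', zpow_natCast] at h
    exact hnat _ (by omega) h
  · rw [hk', zpow_neg, inv_eq_one, zpow_natCast] at h
    exact hnat _ (by omega) h

theorem ADEType.cartan_diag (X : ADEType) (i : Fin X.rank) : X.cartan i i = 2 := by
  cases X with
  | A n hn => exact congrFun (CartanMatrix.A_diag n) i
  | D n hn => exact CartanMatrix.D_diag n i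
  | E6 => exact CartanMatrix.E₆_diag i
  | E7 => exact CartanMatrix.E₇_diag i
  | E8 => exact CartanMatrix.E₈_diag i

theorem ADEType.cartan_isSimplyLaced (X : ADEType) : X.cartan.IsSimplyLaced := by
  cases X with
  | A n hn => exact CartanMatrix.isSimplyLaced_A n
  | D n hn => exact CartanMatrix.isSimplyLaced_D n
  | E6 => exact CartanMatrix.isSimplyLaced_E₆
  | E7 => exact CartanMatrix.isSimplyLaced_E₇
  | E8 => exact CartanMatrix.isSimplyLaced_E₈

theorem symInt_one : symInt 1 = 1 := by
  have h : qq - qq⁻¹ ≠ 0 := by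
    intro h
    have h1 : qq ^ (2 : ℤ) = 1 := by
      rw [zpow_two]
      nth_rewrite 2 [sub_eq_zero.1 h]
      exact mul_inv_cancel₀ qq_ne_zero
    exact qq_zpow_ne_one two_ne_zero h1
  rw [symInt, zpow_one, zpow_neg_one, div_self h]

/-- For `a_{ij} = 0` the Serre expression is a commutator. -/
theorem serre_eq_commutator {A : Type*} [Ring A] [Algebra Kq A] {N : ℕ} {z : ℤ} (hN : N = 1)
    (hz : z = 1) (x y : A) :
    ∑ _σ : Equiv.Perm (Fin N), ∑ s ∈ Finset.range (N + 1), ((-1 : Kq) ^ s * symBinom z s) •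
      (((List.ofFn fun _ : Fin N => x).take s).prod * y *
        ((List.ofFn fun _ : Fin N => x).drop s).prod) = y * x - x * y := by
  subst hN hz
  simp [Finset.sum_range_succ, symBinom, symInt_one, sub_eq_add_neg]

variable {X : ADEType}

theorem Uq.x_comm {ε : ℤˣ} {i j : Fin X.rank} (hij : i ≠ j) (h : X.cartan i j = 0) (k l : ℤ) :
    (Uq.x ε i k * Uq.x ε j l : Uq X) = Uq.x ε j l * Uq.x ε i k := by
  have h1 := RingQuot.mkAlgHom_rel Kq (DrinfeldRel.serre (A := X.cartan) ε i j hij l fun _ => k)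
  rw [serre_eq_commutator (by rw [h]; rfl) (by rw [h, sub_zero]), map_sub, map_mul, map_mul,
    map_zero] at h1
  exact (sub_eq_zero.1 h1).symm

theorem Uq.x_exchange (ε : ℤˣ) (i j : Fin X.rank) (k l : ℤ) :
    (Uq.x ε i (k + 1) * Uq.x ε j l : Uq X)
        - qq ^ ((ε : ℤ) * X.cartan i j) • (Uq.x ε i k * Uq.x ε j (l + 1))
      = qq ^ ((ε : ℤ) * X.cartan i j) • (Uq.x ε j l * Uq.x ε i (k + 1))
        - Uq.x ε j (l + 1) * Uq.x ε i k := by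
  have h1 := RingQuot.mkAlgHom_rel Kq (DrinfeldRel.x_x (A := X.cartan) ε i j k l)
  simp only [map_sub, map_smul, map_mul] at h1
  exact sub_eq_sub_iff_sub_eq_sub.1 h1

variable {L : Type*} [AddCommGroup L] [Module Kq L] [Module (Uq X) L] [IsScalarTower Kq (Uq X) L]
  (hL : IsRestricted X L)

theorem current_exchange (ε : ℤˣ) (i j : Fin X.rank) :
    Exchange (current hL ε i).1 (current hL ε j).1 (qq ^ ((ε : ℤ) * X.cartan i j))
      (qq ^ ((ε : ℤ) * X.cartan i j)) 1 := by
  intro k l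
  have h := congrArg (Algebra.lsmul Kq Kq L) (Uq.x_exchange ε i j (-k - 1 - 1) (-l - 1))
  simp only [map_sub, map_smul, map_mul] at h
  simp only [current, one_smul]
  rw [show -k - 1 - 1 + 1 = -k - 1 by ring, show -l - 1 + 1 = -(l - 1) - 1 by ring,
    show -k - 1 - 1 = -(k + 1) - 1 by ring] at h
  exact h

theorem current_exchange_of_eq_zero (ε : ℤˣ) {i j : Fin X.rank} (hij : i ≠ j)
    (h : X.cartan i j = 0) : Exchange (current hL ε i).1 (current hL ε j).1 0 1 0 := by
  intro k l
  have h := congrArg (Algebra.lsmul Kq Kq L) (Uq.x_comm (ε := ε) hij h (-k - 1) (-l - 1))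
  simp only [map_mul] at h
  simp only [current, one_smul, zero_smul, sub_zero]
  exact h

theorem Compatible.mono {m : ℕ} {E : Fin m → ℤ} {α : Fin m → ℕ} (hE : Compatible E α) {k k' : Fin m}
    (h : k ≤ k') : E k ≤ E k' := by
  obtain ⟨k', hk'⟩ := k'
  obtain ⟨d, rfl⟩ : ∃ d, k' = k + d := ⟨k' - k, by have : (k : ℕ) ≤ k' := h; omega⟩
  clear h
  induction d with
  | zero => exact le_refl _
  | succ d ih =>
    have h1 := ih (by omega)
    have h2 := hE ⟨k + d, by omega⟩ ⟨k + (d + 1), hk'⟩ rfl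
    omega

/-- The factor by which the exchange relation of two currents is multiplied has no zeros at the
nonnegative powers of `q^{±2}`, by the parity of the Cartan matrix entries. -/
theorem exists_exchange_current (ε : ℤˣ) (i j : Fin X.rank) {x y : ℤ} (hxy : x ≤ y) :
    ∃ c d e : Kq, (∀ n : ℕ, 1 - c * (qq ^ (2 * (ε : ℤ))) ^ n ≠ 0) ∧
      Exchange (rescale ((qq ^ (2 * (ε : ℤ))) ^ x) (current hL ε i).1)
        (rescale ((qq ^ (2 * (ε : ℤ))) ^ y) (current hL ε j).1) c d e := by
  have hq : qq ^ (2 * (ε : ℤ)) ≠ 0 := zpow_ne_zero _ qq_ne_zero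
  by_cases h0 : X.cartan i j = 0
  · have hij : i ≠ j := by
      rintro rfl
      rw [X.cartan_diag] at h0
      exact two_ne_zero h0
    exact ⟨_, _, _, fun n => by simp,
      (current_exchange_of_eq_zero hL ε hij h0).rescale (zpow_ne_zero _ hq) (zpow_ne_zero _ hq)⟩
  · refine ⟨_, _, _, fun n => ?_,
      (current_exchange hL ε i j).rescale (zpow_ne_zero _ hq) (zpow_ne_zero _ hq)⟩
    have hA : X.cartan i j = 2 ∨ X.cartan i j = -1 := by
      by_cases hij : i = j
      · exact Or.inl (hij ▸ X.cartan_diag i)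
      · exact Or.inr ((X.cartan_isSimplyLaced hij).resolve_left h0)
    have hpow : qq ^ ((ε : ℤ) * X.cartan i j) * ((qq ^ (2 * (ε : ℤ))) ^ y
        / (qq ^ (2 * (ε : ℤ))) ^ x) * (qq ^ (2 * (ε : ℤ))) ^ n
        = qq ^ ((ε : ℤ) * (X.cartan i j + 2 * (y - x + n))) := by
      rw [← zpow_natCast, ← zpow_sub₀ hq, mul_assoc, ← zpow_add₀ hq, ← zpow_mul,
        ← zpow_add₀ qq_ne_zero]
      congr 1
      ring
    rw [hpow, sub_ne_zero]
    refine (qq_zpow_ne_one (mul_ne_zero (Units.ne_zero ε) ?_)).symm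
    omega

/-- All finite sequences of currents of the same sign are quasi-commutative. -/
theorem quasiCommList_currents (ε : ℤˣ) (α : Fin X.rank → ℕ) (l : List (OpSeries Kq L × ℕ))
    (hl : ∀ x ∈ l, x ∈ Set.range fun i => (current hL ε i, α i)) :
    QuasiCommList (qq ^ (2 * (ε : ℤ))) l := by
  intro E hE
  have hl' : ∀ k : Fin l.length, ∃ i, (current hL ε i, α i) = l[k] := fun k =>
    hl _ (List.getElem_mem _)
  choose i hi using hl'
  have hi' : ∀ k : Fin l.length, (l[k]).1 = current hL ε (i k) := fun k => by rw [← hi k]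
  simp only [hi']
  refine regular_of_exchange (fun k v => ?_) fun k k' hk =>
    exists_exchange_current hL ε _ _ (hE.mono hk.le)
  obtain ⟨N, hN⟩ := (current hL ε (i k)).2 v
  exact ⟨N, fun n hn => by rw [rescale, LinearMap.smul_apply, hN n hn, smul_zero]⟩

theorem qq_zpow_two_mul_pow_ne_one (ε : ℤˣ) (n : ℕ) (hn : 0 < n) :
    (qq ^ (2 * (ε : ℤ))) ^ n ≠ 1 := by
  rw [← zpow_natCast, ← zpow_mul]
  refine qq_zpow_ne_one (mul_ne_zero (mul_ne_zero two_ne_zero (Units.ne_zero ε)) ?_)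
  omega

end QuantumAffine

end QVA

end

open QVA in
theorem theorem2p15 (X : ADEType) (L : Type*) [AddCommGroup L] [Module Kq L] [Module (Uq X) L]
    [IsScalarTower Kq (Uq X) L] (hL : IsRestricted X L) (ε : ℤˣ) (α : Fin X.rank → ℕ) :
    IsQuasiCommSet (qq ^ (2 * (ε : ℤ))) (currents hL ε α) ∧
    ∃ V : Submodule Kq (OpSeriesT Kq L),
      IsLeast {W | IsGradedNonlocalVA (qq ^ (2 * (ε : ℤ))) W ∧ currents hL ε α ⊆ W} V ∧
      (∀ V', IsLeast {W | IsGradedNonlocalVA (qq ^ (2 * (ε : ℤ))) W ∧ currents hL ε α ⊆ W} V' →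
        V' = V) ∧
      IsQuasiCommSet (qq ^ (2 * (ε : ℤ))) (V : Set (OpSeriesT Kq L)) ∧
      V = Submodule.span Kq (monomials (qq ^ (2 * (ε : ℤ))) (currents hL ε α)) := by
  have hq : qq ^ (2 * (ε : ℤ)) ≠ 0 := zpow_ne_zero _ qq_ne_zero
  have hq1 := qq_zpow_two_mul_pow_ne_one ε
  have hS := quasiCommList_currents hL ε α
  have himage : currents hL ε α = (fun x : OpSeries Kq L × ℕ => Finsupp.single x.2 x.1) ''
      Set.range fun i => (current hL ε i, α i) := by
    rw [← Set.range_comp]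
    rfl
  have hleast := isLeast_generatedSpace hq hq1 hS
  have hspan := generatedSpace_eq_span hq hq1 hS
  have hqc := isQuasiCommSet_generatedSpace hq hq1 hS
  rw [← himage] at hleast hspan
  exact ⟨fun m a ha => hqc m a fun k => hleast.1.2 (ha k), _, hleast,
    fun V' hV' => hV'.unique hleast, hqc, hspan⟩
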